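/- Let $R$ be a commutative $\mathbb C$-algebra, $K=R((t))$, $\mathcal O=R[[t]]$, $\mathfrak m=t\mathcal O$, $e_i=t^i$, and $(f,g)=\operatorname{res}(g\,df)$ the residue form on $K$. Let $\theta_R$ be the Lie algebra of $\mathbb C$-derivations of $R$, let $\theta_{K,R}$ be the Lie algebra of $\mathfrak m$-adically continuous $\mathbb C$-derivations of $K$ that map $R$ to $R$, and let $\theta_{K/R}\subset\theta_{K,R}$ consist of those that kill $R$. An $R$-subalgebra $A\subset K$ is of *Fock type* if: (1) $A$ is a flat $R$-algebra of finite type; (2) $A\cap\mathcal O=R$ and $K/(A+\mathcal O)$ is a free $R$-module of finite rank; (3) $(a,b)=0$ for all $a,b\in A$; (4) every $D\in\theta_{K/R}$ with $D(A)\subset A$ maps $A^\perp=\{f\in K:(f,a)=0\ \forall a\in A\}$ into $A$. Let $\hat K=K\oplus R\hbar$ be the Heisenberg Lie algebra over $R$ with bracket $[f+r\hbar,g+s\hbar]=(f,g)\hbar$, $U\hat K$ its universal enveloping algebra over $R$ (product $\circ$), $\bar U\hat K=\varprojlim_N U\hat K/(U\hat K\circ\mathfrak m^N)$, and $\mathbb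 F(K,\mathcal O)$ the quotient of $U\hat K$ by the left ideal generated by $\mathcal O$ and $\hbar-1$, with generator $v_o$. Put $\mathbb F(K,\mathcal O)_A=\mathbb F(K,\mathcal O)/A\circ\mathbb F(K,\mathcal O)$. Let $\hat\theta_{K,R}$ be the Lie algebra of pairs $\hat D=(D,T)$, $D\in\theta_{K,R}$, $T\in\operatorname{End}_{\mathbb C}\mathbb F(K,\mathcal O)$, generated by: the pairs $(D,\hat\tau(D))$ with $D\in\theta_{K/R}$ and $\hat\tau(D)=\frac1{2\hbar}\sum_{i,j\ne0}\frac{(D(e_i),e_j)}{ij}:\!e_{-i}\circ e_{-j}\!:$ (normal ordering puts the factor with the higher index last); the pairs $(D,T)$ with $D\in\theta_{K,R}$ killing all $e_i$ and $T$ the coefficientwise derivation by $D$ with respect to the monomials $e_{k_1}\circ\cdots\circ e_{k_r}v_o$; and the pairs $(0,r)$ with $r\in R$. For an $R$-subalgebra $A\subset K$ let $\theta_{K,A,R}\subset\theta_{K,R}$ be the Lie subalgebra of derivations preserving $A$, $\hat\theta_{K,A,R}$ its preimage in $\hat\theta_{K,R}$, and $\theta_R^A\subset\theta_R$ the image of $\theta_{K,A,R}$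 under restriction to $R$. A *central extension by $R$* of a Lie subalgebra $\mathfrak g\subset\theta_R$ that is an $R$-submodule is meant in the sense of Lie algebroids: an exact sequence $0\to R\to E\to\mathfrak g\to0$ of $R$-modules in which $E\to\mathfrak g$ is a homomorphism of complex Lie algebras, $[x,ry]=r[x,y]+x(r)y$ for $x,y\in E$ and $r\in R$ (where $x$ acts on $R$ through $\mathfrak g$), and $1\in R$ is central in $E$ (hence $[x,r]=x(r)$). In an *action* of $E$ on an $R$-module $V$ the elements of $R\subset E$ act as multiplication by scalars, the action is $R$-linear in $E$, and $x(rv)=r\,x(v)+x(r)v$. **Proposition.** Let $A\subset K$ be of Fock type. Then: (a) $\hat\theta_{K,A,R}$ is an extension of $\theta_{K,A,R}$ by $R$: every $D\in\theta_{K,A,R}$ has a lift in $\hat\theta_{K,A,R}$, and the elements of $\hat\theta_{K,A,R}$ over $D=0$ are exactly the scalars $r\in R$. (b) Every $\hat D=(D,T)\in\hat\theta_{K,A,R}$ satisfies $[T,f]=D(f)$ on $\mathbb F(K,\mathcal O)$ for all $f\in K$. The map $D$ extends uniquely to a continuous additive derivation $[\hat D,-]$ of $\bar U\hat K$ that kills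 $\hbar$ and acts as $D$ on the scalars $R$; it preserves $A\circ\bar U\hat K$. Moreover $T$ preserves $A\circ\mathbb F(K,\mathcal O)$, so that $\hat\theta_{K,A,R}$ acts on $\mathbb F(K,\mathcal O)_A$. (c) This action factors through an action of a central extension of $\theta_R^A$ by $R$: there are a central extension $E$ of $\theta_R^A$ by $R$, an action of $E$ on $\mathbb F(K,\mathcal O)_A$, and a surjective homomorphism of complex Lie algebras $\hat\theta_{K,A,R}\to E$, compatible with multiplication by elements of $R$, lying over the restriction map $\theta_{K,A,R}\to\theta_R^A$, equal to the identity on $R$, and compatible with the two actions. (d) If $A$ is (formally) smooth over $R$, then $\theta_R^A=\theta_R$, so that the action factors through an action of a central extension of $\theta_R$ by $R$. -/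

import Mathlib

universe u

attribute [local instance 100] LieRing.ofAssociativeRing

noncomputable section

namespace WZW

/-! ### The ring `K = R((t))`, its filtration and its residue form -/

section LaurentRing

variable (R : Type u) [CommRing R]

/-- The ring `K = R((t))` of formal Laurent series; a type synonym of `HahnSeries ℤ R`, so that
the only algebra structures on it are the ones given below. -/
def K : Type u := HahnSeries ℤ R

instance : CommRing (K R) := inferInstanceAs (CommRing (HahnSeries ℤ R))

/-- The structure map `R → K` sends `r` to the constant series `r`; scalars act coefficientwise. -/
instance : Algebra R (K R) := HahnSeries.instAlgebra (Γ := ℤ) (R := R) (A := R)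

instance [Algebra ℂ R] : Algebra ℂ (K R) := HahnSeries.instAlgebra (Γ := ℤ) (R := ℂ) (A := R)

instance [Algebra ℂ R] : IsScalarTower ℂ R (K R) :=
  ⟨fun z r f => HahnSeries.ext (funext fun n => smul_assoc z r (HahnSeries.coeff f n))⟩

variable {R}

/-- The coefficient of `t ^ n`. -/
def coeff (f : K R) (n : ℤ) : R := HahnSeries.coeff f n

/-- The topological basis element `e_i = t ^ i` of `K`. -/
def e (i : ℤ) : K R := HahnSeries.single i (1 : R)

/-- The derivative `d/dt`. -/
def ddt (f : K R) : K R := LaurentSeries.derivative R (V := R) f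

/-- The residue form `(f, g) = res (g df)`: the coefficient of `t ^ (-1)` in `g * (df/dt)`. -/
def resForm (f g : K R) : R := coeff (g * ddt f) (-1)

@[ext] theorem K_ext {f g : K R} (h : ∀ n, coeff f n = coeff g n) : f = g :=
  HahnSeries.ext (funext h)

@[simp] theorem coeff_add (f g : K R) (n : ℤ) : coeff (f + g) n = coeff f n + coeff g n := rfl

@[simp] theorem coeff_smul (r : R) (f : K R) (n : ℤ) : coeff (r • f) n = r * coeff f n := rfl

@[simp] theorem coeff_zero (n : ℤ) : coeff (0 : K R) n = 0 := rfl

theorem coeff_algebraMap_zero (r : R) : coeff (algebraMap R (K R) r) 0 = r := by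
  rw [Algebra.algebraMap_eq_smul_one, coeff_smul]
  change r * HahnSeries.coeff (1 : HahnSeries ℤ R) 0 = r
  simp

theorem algebraMap_injective : Function.Injective (algebraMap R (K R)) := fun a b h => by
  rw [← coeff_algebraMap_zero a, h, coeff_algebraMap_zero]

theorem ddt_add (f g : K R) : ddt (f + g) = ddt f + ddt g :=
  map_add (LaurentSeries.derivative R (V := R)) f g

theorem ddt_smul (r : R) (f : K R) : ddt (r • f) = r • ddt f :=
  map_smul (LaurentSeries.derivative R (V := R)) r f

theorem series_coeff_deriv (f : HahnSeries ℤ R) (n : ℤ) :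
    HahnSeries.coeff (LaurentSeries.derivative R (V := R) f) n =
      ((n + 1 : ℤ) : R) * HahnSeries.coeff f (n + 1) := by
  rw [LaurentSeries.derivative_apply, LaurentSeries.hasseDeriv_coeff]
  simp

theorem series_residue (f g : HahnSeries ℤ R) :
    HahnSeries.coeff (g * LaurentSeries.derivative R (V := R) f) (-1) =
      ∑ p ∈ Finset.antidiagonal (HahnSeries.isPWO_support g) (HahnSeries.isPWO_support f) 0,
        HahnSeries.coeff g p.1 * ((p.2 : R) * HahnSeries.coeff f p.2) := by
  have h1 : HahnSeries.coeff (g * LaurentSeries.derivative R (V := R) f) (-1) =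
      HahnSeries.coeff (g * (HahnSeries.single (1 : ℤ) (1 : R) *
        LaurentSeries.derivative R (V := R) f)) 0 := by
    rw [mul_left_comm, show (0 : ℤ) = -1 + 1 by norm_num, HahnSeries.coeff_single_mul_add, one_mul]
  have h2 : ∀ n : ℤ, HahnSeries.coeff (HahnSeries.single (1 : ℤ) (1 : R) *
        LaurentSeries.derivative R (V := R) f) n = (n : R) * HahnSeries.coeff f n := by
    intro n
    rw [HahnSeries.coeff_single_mul, one_mul, series_coeff_deriv, sub_add_cancel]
  rw [h1, HahnSeries.coeff_mul_right' (HahnSeries.isPWO_support f)]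
  · exact Finset.sum_congr rfl fun p _ => by rw [h2]
  · intro n hn
    rw [HahnSeries.mem_support, h2] at hn
    exact fun h => hn (by rw [h, mul_zero])

theorem series_residue_swap (f g : HahnSeries ℤ R) :
    HahnSeries.coeff (g * LaurentSeries.derivative R (V := R) f) (-1) +
      HahnSeries.coeff (f * LaurentSeries.derivative R (V := R) g) (-1) = 0 := by
  rw [series_residue f g, series_residue g f]
  have h : ∑ p ∈ Finset.antidiagonal (HahnSeries.isPWO_support f) (HahnSeries.isPWO_support g) 0,
        HahnSeries.coeff f p.1 * ((p.2 : R) * HahnSeries.coeff g p.2) =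
      ∑ p ∈ Finset.antidiagonal (HahnSeries.isPWO_support g) (HahnSeries.isPWO_support f) 0,
        HahnSeries.coeff f p.2 * ((p.1 : R) * HahnSeries.coeff g p.1) := by
    refine Finset.sum_nbij' Prod.swap Prod.swap ?_ ?_ (by simp) (by simp) (by simp)
    · rintro ⟨a, b⟩ h
      simp only [Finset.mem_antidiagonal, Prod.swap_prod_mk] at h ⊢
      exact ⟨h.2.1, h.1, by rw [add_comm]; exact h.2.2⟩
    · rintro ⟨a, b⟩ h
      simp only [Finset.mem_antidiagonal, Prod.swap_prod_mk] at h ⊢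
      exact ⟨h.2.1, h.1, by rw [add_comm]; exact h.2.2⟩
  rw [h, ← Finset.sum_add_distrib]
  refine Finset.sum_eq_zero fun p hp => ?_
  simp only [Finset.mem_antidiagonal] at hp
  have h0 : ((p.1 : ℤ) : R) + ((p.2 : ℤ) : R) = 0 := by
    rw [← Int.cast_add, hp.2.2, Int.cast_zero]
  linear_combination (HahnSeries.coeff g p.1 * HahnSeries.coeff f p.2) * h0

theorem resForm_add_left (f f' g : K R) : resForm (f + f') g = resForm f g + resForm f' g := by
  simp [resForm, ddt_add, mul_add]

theorem resForm_add_right (f g g' : K R) : resForm f (g + g') = resForm f g + resForm f g' := by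
  simp [resForm, add_mul]

theorem resForm_smul_left (r : R) (f g : K R) : resForm (r • f) g = r * resForm f g := by
  simp [resForm, ddt_smul]

theorem resForm_smul_right (r : R) (f g : K R) : resForm f (r • g) = r * resForm f g := by
  simp [resForm]

theorem resForm_add_swap (f g : K R) : resForm f g + resForm g f = 0 :=
  series_residue_swap f g

theorem resForm_self [Algebra ℂ R] (f : K R) : resForm f f = 0 := by
  have h := resForm_add_swap f f
  rw [← two_mul] at h
  calc resForm f f = algebraMap ℂ R (1 / 2) * (2 * resForm f f) := by
        rw [← mul_assoc, ← map_ofNat (algebraMap ℂ R) 2, ← map_mul]; norm_num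
    _ = 0 := by rw [h, mul_zero]

variable (R)

/-- `𝔪 ^ N` for `N : ℤ`, where `𝔪 = t R[[t]]`: the Laurent series of order at least `N`. -/
def mPow (N : ℤ) : Submodule R (K R) where
  carrier := {f | ∀ n < N, coeff f n = 0}
  add_mem' hf hg n hn := by simp [hf n hn, hg n hn]
  zero_mem' n _ := by simp
  smul_mem' r f hf n hn := by simp [hf n hn]

/-- `𝒪 = R[[t]]` inside `K`. -/
abbrev ringO : Submodule R (K R) := mPow R 0

theorem mPow_anti {M N : ℤ} (h : M ≤ N) : mPow R N ≤ mPow R M :=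
  fun _ hf n hn => hf n (lt_of_lt_of_le hn h)

end LaurentRing

/-! ### Derivations -/

section Derivations

variable (R : Type u) [CommRing R] [Algebra ℂ R]

/-- Continuity of a derivation `K → K` for the `𝔪`-adic topology. -/
def IsCont {R : Type u} [CommRing R] [Algebra ℂ R] (D : Derivation ℂ (K R) (K R)) : Prop :=
  ∀ N : ℤ, ∃ M : ℤ, ∀ f ∈ mPow R M, D f ∈ mPow R N

/-- `θ_{K,R}`: the continuous `ℂ`-derivations of `K` that preserve `R`. -/
def thetaKR : LieSubalgebra ℂ (Derivation ℂ (K R) (K R)) where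
  carrier := {D | IsCont D ∧ ∀ r : R, ∃ s : R, D (algebraMap R (K R) r) = algebraMap R (K R) s}
  add_mem' := by
    rintro D E ⟨hD, hD'⟩ ⟨hE, hE'⟩
    refine ⟨fun N => ?_, fun r => ?_⟩
    · obtain ⟨M₁, h₁⟩ := hD N
      obtain ⟨M₂, h₂⟩ := hE N
      exact ⟨max M₁ M₂, fun f hf => (mPow R N).add_mem
        (h₁ f (mPow_anti R (le_max_left _ _) hf)) (h₂ f (mPow_anti R (le_max_right _ _) hf))⟩
    · obtain ⟨s, hs⟩ := hD' r
      obtain ⟨s', hs'⟩ := hE' r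
      exact ⟨s + s', by rw [Derivation.add_apply, hs, hs', map_add]⟩
  zero_mem' := ⟨fun N => ⟨0, fun f _ => (mPow R N).zero_mem⟩, fun r => ⟨0, by simp⟩⟩
  smul_mem' := by
    rintro z D ⟨hD, hD'⟩
    refine ⟨fun N => ?_, fun r => ?_⟩
    · obtain ⟨M, h⟩ := hD N
      refine ⟨M, fun f hf => ?_⟩
      rw [Derivation.smul_apply, ← algebraMap_smul R z (D f)]
      exact (mPow R N).smul_mem _ (h f hf)
    · obtain ⟨s, hs⟩ := hD' r
      refine ⟨z • s, ?_⟩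
      rw [Derivation.smul_apply, hs, Algebra.algebraMap_eq_smul_one,
        Algebra.algebraMap_eq_smul_one, smul_assoc]
  lie_mem' := by
    rintro D E ⟨hD, hD'⟩ ⟨hE, hE'⟩
    refine ⟨fun N => ?_, fun r => ?_⟩
    · obtain ⟨M₁, h₁⟩ := hD N
      obtain ⟨M₂, h₂⟩ := hE N
      obtain ⟨M₃, h₃⟩ := hE M₁
      obtain ⟨M₄, h₄⟩ := hD M₂
      refine ⟨max M₃ M₄, fun f hf => ?_⟩
      rw [Derivation.commutator_apply]
      exact (mPow R N).sub_mem (h₁ _ (h₃ f (mPow_anti R (le_max_left _ _) hf)))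
        (h₂ _ (h₄ f (mPow_anti R (le_max_right _ _) hf)))
    · obtain ⟨s, hs⟩ := hD' r
      obtain ⟨s', hs'⟩ := hE' r
      obtain ⟨a, ha⟩ := hD' s'
      obtain ⟨b, hb⟩ := hE' s
      exact ⟨a - b, by rw [Derivation.commutator_apply, hs, hs', ha, hb, map_sub]⟩

variable {R}

/-- `D` lies in `θ_{K/R}`: it is a continuous `ℂ`-derivation of `K` that kills `R`. -/
def IsVertical (D : Derivation ℂ (K R) (K R)) : Prop :=
  IsCont D ∧ ∀ r : R, D (algebraMap R (K R) r) = 0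

/-- `D` kills the basis `e_i = t ^ i`: the horizontal members of `θ_{K,R}`. -/
def IsHorizontal (D : Derivation ℂ (K R) (K R)) : Prop :=
  D ∈ thetaKR R ∧ ∀ i : ℤ, D (e i) = 0

/-- `θ_{K,A,R}`: the members of `θ_{K,R}` that preserve `A`. -/
def thetaKAR (A : Subalgebra R (K R)) : LieSubalgebra ℂ (Derivation ℂ (K R) (K R)) where
  carrier := {D | D ∈ thetaKR R ∧ ∀ a ∈ A, D a ∈ A}
  add_mem' := fun hD hE =>
    ⟨(thetaKR R).add_mem hD.1 hE.1, fun a ha => A.add_mem (hD.2 a ha) (hE.2 a ha)⟩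
  zero_mem' := ⟨(thetaKR R).zero_mem, fun _ _ => A.zero_mem⟩
  smul_mem' := fun z D hD => ⟨(thetaKR R).smul_mem z hD.1, fun a ha => by
    rw [Derivation.smul_apply, ← algebraMap_smul R z (D a)]
    exact A.smul_mem (hD.2 a ha) _⟩
  lie_mem' := fun hD hE => ⟨(thetaKR R).lie_mem hD.1 hE.1, fun a ha => by
    rw [Derivation.commutator_apply]
    exact A.sub_mem (hD.2 _ (hE.2 a ha)) (hE.2 _ (hD.2 a ha))⟩

/-- The derivation `δ` of `R` is the restriction to `R` of the derivation `D` of `K`. -/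
def Restricts (D : Derivation ℂ (K R) (K R)) (δ : Derivation ℂ R R) : Prop :=
  ∀ r : R, D (algebraMap R (K R) r) = algebraMap R (K R) (δ r)

/-- The image of `θ_{K,A,R}` in `θ_R`: the `ℂ`-derivations of `R` that lift to a continuous
derivation of `K` preserving `A`. -/
def liftable (A : Subalgebra R (K R)) : LieSubalgebra ℂ (Derivation ℂ R R) where
  carrier := {δ | ∃ D ∈ thetaKAR A, Restricts D δ}
  add_mem' := by
    rintro δ ε ⟨D, hD, h⟩ ⟨E, hE, h'⟩
    exact ⟨D + E, (thetaKAR A).add_mem hD hE, fun r => by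
      rw [Derivation.add_apply, h, h', Derivation.add_apply, map_add]⟩
  zero_mem' := ⟨0, (thetaKAR A).zero_mem, fun r => by simp⟩
  smul_mem' := by
    rintro z δ ⟨D, hD, h⟩
    exact ⟨z • D, (thetaKAR A).smul_mem z hD, fun r => by
      rw [Derivation.smul_apply, h, Derivation.smul_apply, Algebra.algebraMap_eq_smul_one,
        Algebra.algebraMap_eq_smul_one, smul_assoc]⟩
  lie_mem' := by
    rintro δ ε ⟨D, hD, h⟩ ⟨E, hE, h'⟩
    exact ⟨⁅D, E⁆, (thetaKAR A).lie_mem hD hE, fun r => by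
      rw [Derivation.commutator_apply, h, h', h, h', Derivation.commutator_apply, map_sub]⟩

/-- Subalgebras of Fock type. -/
structure IsFockType (A : Subalgebra R (K R)) : Prop where
  flat : Module.Flat R A
  finiteType : Algebra.FiniteType R A
  inter_ringO : ∀ f ∈ A, f ∈ ringO R → ∃ r : R, algebraMap R (K R) r = f
  free_quotient : Module.Free R (K R ⧸ (Subalgebra.toSubmodule A ⊔ ringO R))
  finite_quotient : Module.Finite R (K R ⧸ (Subalgebra.toSubmodule A ⊔ ringO R))
  isotropic : ∀ a ∈ A, ∀ b ∈ A, resForm a b = 0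
  perp : ∀ D : Derivation ℂ (K R) (K R), IsVertical D → (∀ a ∈ A, D a ∈ A) →
    ∀ f : K R, (∀ a ∈ A, resForm f a = 0) → D f ∈ A

end Derivations

/-! ### The Heisenberg algebra, its enveloping algebra and the Fock representation -/

section Fock

variable (R : Type u) [CommRing R]

/-- The underlying module `K ⊕ Rℏ` of the Heisenberg Lie algebra. -/
def Heis : Type u := K R × R

instance : AddCommGroup (Heis R) := inferInstanceAs (AddCommGroup (K R × R))

instance : Module R (Heis R) := inferInstanceAs (Module R (K R × R))

variable [Algebra ℂ R]

/-- The bracket `[f + rℏ, g + sℏ] = res (g df) ℏ`. -/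
instance : LieRing (Heis R) where
  bracket x y := ((0, resForm x.1 y.1) : K R × R)
  add_lie x y z := Prod.ext (add_zero (0 : K R)).symm (resForm_add_left x.1 y.1 z.1)
  lie_add x y z := Prod.ext (add_zero (0 : K R)).symm (resForm_add_right x.1 y.1 z.1)
  lie_self x := Prod.ext rfl (resForm_self x.1)
  leibniz_lie x y z := by
    have h0 : ∀ f : K R, resForm f 0 = 0 := fun f => by simp [resForm]
    have h0' : ∀ f : K R, resForm 0 f = 0 := fun f => by
      have := resForm_smul_left 0 (0 : K R) f
      rwa [zero_smul, zero_mul] at this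
    refine Prod.ext (add_zero (0 : K R)).symm ?_
    change resForm x.1 0 = resForm 0 z.1 + resForm y.1 0
    rw [h0, h0, h0', add_zero]

instance : LieAlgebra R (Heis R) where
  lie_smul r x y := Prod.ext (smul_zero r).symm (resForm_smul_right r x.1 y.1)

/-- `U K̂`, the universal enveloping algebra over `R` of the Heisenberg algebra. -/
abbrev UHeis : Type u := UniversalEnvelopingAlgebra R (Heis R)

variable {R}

/-- The image in `U K̂` of `f ∈ K`. -/
def inU (f : K R) : UHeis R := UniversalEnvelopingAlgebra.ι R (show Heis R from (f, 0))

/-- The central element `ℏ` of `U K̂`. -/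
def hbar : UHeis R := UniversalEnvelopingAlgebra.ι R (show Heis R from (0, 1))

/-- The normally ordered product `:e_i ∘ e_j:` in `U K̂` (the highest index comes last). -/
def normOrd (i j : ℤ) : UHeis R :=
  if i ≤ j then inU (e i) * inU (e j) else inU (e j) * inU (e i)

variable (R)

/-- The Fock representation `𝔽(K, 𝒪)`: the representation of `K̂` induced by the character
"coefficient of `ℏ`" of `𝒪 ⊕ Rℏ`, i.e. the quotient of `U K̂` by the left ideal generated by `𝒪`
and `ℏ - 1`. -/
def FockSpace : Type u :=
  UHeis R ⧸ Submodule.span (UHeis R) ({u | ∃ f ∈ ringO R, u = inU f} ∪ {hbar - 1} : Set (UHeis R))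

instance : AddCommGroup (FockSpace R) := inferInstanceAs (AddCommGroup (UHeis R ⧸ _))

instance : Module (UHeis R) (FockSpace R) := inferInstanceAs (Module (UHeis R) (UHeis R ⧸ _))

instance : Module R (FockSpace R) := inferInstanceAs (Module R (UHeis R ⧸ _))

instance : IsScalarTower R (UHeis R) (FockSpace R) :=
  inferInstanceAs (IsScalarTower R (UHeis R) (UHeis R ⧸ _))

instance : Module ℂ (FockSpace R) := Module.compHom (FockSpace R) (algebraMap ℂ R)

instance : IsScalarTower ℂ R (FockSpace R) :=
  ⟨fun z r v => by
    rw [Algebra.smul_def, mul_smul]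
    rfl⟩

/-- The generator `v_o`, the image of `1 ∈ U K̂`. -/
def vac : FockSpace R := Submodule.Quotient.mk (1 : UHeis R)

variable {R}

/-- Multiplication by `r : R` as a `ℂ`-linear operator on the Fock space. -/
def scalarOp (r : R) : Module.End ℂ (FockSpace R) where
  toFun v := r • v
  map_add' := smul_add r
  map_smul' z v := by
    rw [← algebraMap_smul R z v, RingHom.id_apply, ← algebraMap_smul R z (r • v), smul_comm]

/-- `A ∘ 𝔽(K, 𝒪)`. -/
def AFock (A : Subalgebra R (K R)) : Submodule R (FockSpace R) :=
  Submodule.span R {w | ∃ a ∈ A, ∃ v : FockSpace R, w = inU a • v}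

/-- The space of coinvariants `𝔽(K, 𝒪)_A`. -/
abbrev Coinv (A : Subalgebra R (K R)) : Type u := FockSpace R ⧸ AFock A

variable (R)

/-- The left ideal `U K̂ ∘ 𝔪 ^ N` of `U K̂`. -/
def idealJ (N : ℕ) : Submodule (UHeis R) (UHeis R) :=
  Submodule.span (UHeis R) {u | ∃ f ∈ mPow R (N : ℤ), u = inU f}

theorem idealJ_anti {M N : ℕ} (h : M ≤ N) : idealJ R N ≤ idealJ R M :=
  Submodule.span_mono (by
    rintro _ ⟨f, hf, rfl⟩
    exact ⟨f, mPow_anti R (by exact_mod_cast h) hf, rfl⟩)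

/-- The completion `Ū K̂ = lim U K̂ / (U K̂ ∘ 𝔪 ^ N)`, as a left `U K̂`-module. -/
def Ubar : Submodule (UHeis R) (∀ N : ℕ, UHeis R ⧸ idealJ R N) where
  carrier := {x | ∀ N : ℕ, Submodule.factor (idealJ_anti R (Nat.le_succ N)) (x (N + 1)) = x N}
  add_mem' hx hy N := by rw [Pi.add_apply, map_add, hx N, hy N, Pi.add_apply]
  zero_mem' N := by simp
  smul_mem' u x hx N := by rw [Pi.smul_apply, map_smul, hx N, Pi.smul_apply]

/-- The unit element of `Ū K̂`. -/
def Ubar.one : Ubar R := ⟨fun _ => Submodule.Quotient.mk 1, fun _ => rfl⟩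

variable {R}

/-- `A ∘ Ū K̂`. -/
def AUbar (A : Subalgebra R (K R)) : Submodule R (Ubar R) :=
  Submodule.span R {y | ∃ a ∈ A, ∃ x : Ubar R, y = inU a • x}

/-- `δ` is the continuous derivation `[D̂, -]` of `Ū K̂` attached to a derivation `D` of `K` whose
restriction to `R` is `δ₀`: it extends `D`, kills `ℏ`, and acts on scalars through `δ₀`. -/
structure IsCommutatorAction (D : Derivation ℂ (K R) (K R)) (δ₀ : Derivation ℂ R R)
    (δ : Ubar R →+ Ubar R) : Prop where
  map_one : δ (Ubar.one R) = 0
  map_inU : ∀ (f : K R) (x : Ubar R), δ (inU f • x) = inU (D f) • x + inU f • δ x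
  map_hbar : ∀ x : Ubar R, δ ((hbar : UHeis R) • x) = (hbar : UHeis R) • δ x
  map_smul : ∀ (r : R) (x : Ubar R), δ (r • x) = δ₀ r • x + r • δ x
  continuous : ∀ N : ℕ, ∃ M : ℕ, ∀ x : Ubar R, x.1 M = 0 → (δ x).1 N = 0

end Fock

/-! ### The extension `θ̂_{K,R}` of `θ_{K,R}` -/

section Lifts

variable {R : Type u} [CommRing R] [Algebra ℂ R]

/-- For `D ∈ θ_{K/R}`: the operator `T` on the Fock space is the action of
`τ̂(D) = (1/2ℏ) ∑_{i,j ≠ 0} (D e_i, e_j) / (ij) :e_{-i} ∘ e_{-j}:` (where `ℏ` acts as `1`).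
On each vector only finitely many terms of the sum are nonzero. -/
def IsSugawara (D : Derivation ℂ (K R) (K R)) (T : Module.End ℂ (FockSpace R)) : Prop :=
  ∀ v : FockSpace R, T v = ∑ᶠ p : {i : ℤ // i ≠ 0} × {j : ℤ // j ≠ 0},
    (algebraMap ℂ R (1 / (2 * (p.1.1 : ℂ) * (p.2.1 : ℂ))) * resForm (D (e p.1.1)) (e p.2.1)) •
      ((normOrd (-p.1.1) (-p.2.1) : UHeis R) • v)

/-- For `D` horizontal: the operator `T` on the Fock space is coefficientwise derivation by `D`
with respect to the monomials `e_{k_1} ∘ ⋯ ∘ e_{k_r} v_o`. Here `δ` is the restriction of `D` to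
`R`. -/
def IsCoefficientwise (δ : Derivation ℂ R R) (T : Module.End ℂ (FockSpace R)) : Prop :=
  ∀ (r : R) (l : List ℤ), T (r • ((l.map fun k => (inU (e k) : UHeis R)).prod • vac R)) =
    δ r • ((l.map fun k => (inU (e k) : UHeis R)).prod • vac R)

variable (R)

/-- Pairs consisting of a derivation of `K` and an operator on the Fock space. -/
abbrev Pairs : Type u := Derivation ℂ (K R) (K R) × Module.End ℂ (FockSpace R)

/-- `θ̂_{K,R}`: its members are pairs `(D, T)` of a `D ∈ θ_{K,R}` and a lift `T` of `D` to an
operator on the Fock space. It is generated by the `(D, τ̂(D))` with `D ∈ θ_{K/R}`, the horizontal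
derivations acting coefficientwise, and the scalars `R`. -/
def hatThetaKR : LieSubalgebra ℂ (Pairs R) :=
  LieSubalgebra.lieSpan ℂ (Pairs R)
    ({x | IsVertical x.1 ∧ IsSugawara x.1 x.2} ∪
     {x | IsHorizontal x.1 ∧ ∃ δ, Restricts x.1 δ ∧ IsCoefficientwise δ x.2} ∪
     {x | ∃ r : R, x = (0, scalarOp r)})

variable {R}

/-- `θ̂_{K,A,R}`: the preimage of `θ_{K,A,R}` in `θ̂_{K,R}`. -/
def hatThetaKAR (A : Subalgebra R (K R)) : LieSubalgebra ℂ (Pairs R) :=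
  hatThetaKR R ⊓ (thetaKAR A).comap (LieHom.fst ℂ _ _)

end Lifts

/-! ### Central extensions by the ring of functions -/

section Extension

variable {R : Type u} [CommRing R] [Algebra ℂ R]

/-- The data of a central extension by `R`, in the sense of Lie algebroids over `R`, of a Lie
subalgebra `𝔤` of `θ_R = Der_ℂ(R)`: an exact sequence `0 → R → E → 𝔤 → 0` in which `E` is at the
same time a complex Lie algebra and an `R`-module, the maps are compatible with both structures,
the bracket satisfies the Leibniz rule, and the image of `1 ∈ R` is central in `E` (so that
`[x, r] = x(r)` for `x ∈ E` and `r ∈ R`). -/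
structure CentralExtension (𝔤 : LieSubalgebra ℂ (Derivation ℂ R R))
    (E : Type u) [LieRing E] [LieAlgebra ℂ E] [Module R E] where
  proj : E →ₗ⁅ℂ⁆ Derivation ℂ R R
  proj_smul : ∀ (r : R) (x : E), proj (r • x) = r • proj x
  range_proj : proj.range = 𝔤
  incl : R →ₗ[R] E
  incl_injective : Function.Injective incl
  exact : ∀ x : E, proj x = 0 ↔ ∃ r : R, incl r = x
  leibniz : ∀ (x y : E) (r : R), ⁅x, r • y⁆ = r • ⁅x, y⁆ + proj x r • y
  central : ∀ x : E, ⁅x, incl 1⁆ = 0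

/-- An action of a central extension by `R` on an `R`-module `V`: a representation over `ℂ` that is
`R`-linear in the Lie algebra variable, satisfies the Leibniz rule on `V`, and for which the
subalgebra `R` acts by scalar multiplication. -/
structure CentralExtension.IsAction {𝔤 : LieSubalgebra ℂ (Derivation ℂ R R)}
    {E : Type u} [LieRing E] [LieAlgebra ℂ E] [Module R E] (X : CentralExtension 𝔤 E)
    {V : Type u} [AddCommGroup V] [Module R V] [Module ℂ V]
    (ρ : E →ₗ⁅ℂ⁆ Module.End ℂ V) : Prop where
  smul_left : ∀ (r : R) (x : E) (v : V), ρ (r • x) v = r • ρ x v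
  leibniz : ∀ (x : E) (r : R) (v : V), ρ x (r • v) = r • ρ x v + X.proj x r • v
  incl : ∀ (r : R) (v : V), ρ (X.incl r) v = r • v

end Extension

end WZW

end

noncomputable section

namespace WZW

/-! ### Laurent series: coefficients, filtration, density of Laurent polynomials -/

section LaurentLemmas

variable {R : Type u} [CommRing R]

/-! The key to (a) is that `θ̂_{K,R}`, defined by generators, is the Lie algebra of all first order
lifts: pairs `(D, T)` with `[T, f] = D(f)` and with `T` a derivation over `D|_R` (`hatThetaKR_eq`).
A member of `θ_{K,R}` is the sum of a vertical part `h d/dt` and the coefficientwise extension of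
its restriction to `R`. The vertical part is lifted by the Sugawara operator: commuting with `e_k`
singles out the indices `i = k` and `j = k`, and their two equal contributions cancel the factor 1/2
(`sugOp_act_e`). The horizontal part lifts because its derivation of `U K̂` preserves the left ideal
that defines the Fock space. A lift of `0` commutes with `K`, so it sends `v_o` to a vector killed
by `𝒪`, hence to a multiple of `v_o`, and is therefore a scalar.

That last fact, like its analogue for coinvariants, rests on an Euler operator `∑ bᵢ oᵢ`, with `oᵢ ∈
𝒪` dual to the letters `bᵢ`. On words of length `n` it is multiplication by `n` up to shorter words.
A vector killed by all `oᵢ` is thus killed by the Euler operator and, as `n > 0` is invertible, can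
be rewritten with shorter words until only a multiple of `v_o` is left (`exists_sub_smul_vac_mem`).

For (b), a derivation of `K` over a derivation `δ` of `R` preserves the residue form up to `δ`,
since the residue of an exact form is zero. Hence `x ↦ x + D(x)ε` is a Lie homomorphism into dual
numbers on which `R` acts through `r + δ(r)ε`; its extension to `U K̂` has a derivation as `ε`-part,
and this derivation is continuous enough to pass to the completion.

For (c), let `E` be the image of the lifts in `Der(R) × End(𝔽_A)`. Two facts make it a central
extension by `R`. First, a vertical `D` preserving `A` acts by a scalar
(`IsFockType.exists_sub_smul_mem`): modulo `A ∘ 𝔽` the Fock space is spanned by words in lifts `bᵢ ∈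
A^⊥` of a basis of `K/(A + 𝒪)`, the dual `oᵢ` also lie in `A^⊥`, and condition (4) says exactly that
`T` commutes with `A^⊥` modulo `A ∘ 𝔽`. Second, scalars act faithfully
(`IsFockType.eq_zero_of_smul_vac_mem`): the Fock space maps to a polynomial ring, with `f` acting as
multiplication by its polar part plus a constant vector field. A splitting of `K` along `A` and `𝒪`
allows the vector fields of all `a ∈ A` to be zero; then `A ∘ 𝔽` has image without constant terms,
while `v_o` goes to 1.

For (d), formal smoothness lifts `A → A` to the twisted dual numbers of `A`, so `δ` extends to a
derivation of `A`. An element `f ∈ A` with a pole and invertible leading coefficient makes the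
fractions `f^(-l) a` dense in `K`. The quotient rule extends the derivation to them, and it
converges because functions in `A` of bounded pole order lie in a finitely generated module, so that
their derivatives have bounded poles too (`Splitting.exists_extension`). -/

@[simp] theorem coeff_sub (f g : K R) (n : ℤ) : coeff (f - g) n = coeff f n - coeff g n := rfl

/-- The coefficient of `t ^ n` as a linear form. -/
def coeffLin (n : ℤ) : K R →ₗ[R] R where
  toFun f := coeff f n
  map_add' _ _ := rfl
  map_smul' _ _ := rfl

theorem coeff_sum {ι : Type*} (s : Finset ι) (f : ι → K R) (n : ℤ) :
    coeff (∑ i ∈ s, f i) n = ∑ i ∈ s, coeff (f i) n :=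
  map_sum (coeffLin n) f s

theorem coeff_e (i n : ℤ) : coeff (e i : K R) n = if n = i then 1 else 0 := by
  classical
  change HahnSeries.coeff (HahnSeries.single i (1 : R)) n = _
  rw [HahnSeries.coeff_single]
  congr

theorem coeff_e_mul (i : ℤ) (f : K R) (n : ℤ) : coeff (e i * f) n = coeff f (n - i) :=
  (HahnSeries.coeff_single_mul (Γ' := ℤ) (r := (1 : R)) (x := f)).trans (one_mul _)

theorem e_zero : (e 0 : K R) = 1 := rfl

theorem e_mul_e (i j : ℤ) : (e i * e j : K R) = e (i + j) := by
  ext n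
  rw [coeff_e_mul, coeff_e, coeff_e]
  congr 1
  exact propext ⟨fun h => by omega, fun h => by omega⟩

theorem e_mem_mPow (i : ℤ) : (e i : K R) ∈ mPow R i := fun n hn => by
  rw [coeff_e, if_neg hn.ne]

theorem exists_mem_mPow (f : K R) : ∃ N : ℤ, f ∈ mPow R N := by
  by_cases h : (show HahnSeries ℤ R from f) = 0
  · refine ⟨0, fun n _ => ?_⟩
    change HahnSeries.coeff (show HahnSeries ℤ R from f) n = 0
    rw [h]; rfl
  · exact ⟨HahnSeries.order (show HahnSeries ℤ R from f), fun n hn =>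
      HahnSeries.coeff_eq_zero_of_lt_order hn⟩

theorem exists_nat_mem_mPow (f : K R) : ∃ N : ℕ, f ∈ mPow R (-(N : ℤ)) := by
  obtain ⟨N, hN⟩ := exists_mem_mPow f
  exact ⟨(-N).toNat, mPow_anti R (by omega) hN⟩

theorem mul_mem_mPow {M N : ℤ} {f g : K R} (hf : f ∈ mPow R M) (hg : g ∈ mPow R N) :
    f * g ∈ mPow R (M + N) := by
  intro n hn
  change HahnSeries.coeff ((show HahnSeries ℤ R from f) * (show HahnSeries ℤ R from g)) n = 0
  rw [HahnSeries.coeff_mul]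
  refine Finset.sum_eq_zero fun p hp => ?_
  rw [Finset.mem_antidiagonal] at hp
  rcases lt_or_ge p.1 M with h | h
  · exact absurd (hf _ h) hp.1
  · exact absurd (hg p.2 (by have := hp.2.2; omega)) hp.2.1

theorem pow_mem_mPow {M : ℤ} {f : K R} (hf : f ∈ mPow R M) (n : ℕ) :
    f ^ n ∈ mPow R (n * M) := by
  induction n with
  | zero => simpa [← e_zero] using e_mem_mPow (R := R) 0
  | succ n ih =>
    rw [pow_succ]
    have := mul_mem_mPow ih hf
    rwa [show ((n + 1 : ℕ) : ℤ) * M = n * M + M by push_cast; ring]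

theorem algebraMap_eq_smul_e (r : R) : algebraMap R (K R) r = r • e 0 :=
  Algebra.algebraMap_eq_smul_one r

theorem algebraMap_mem_ringO (r : R) : algebraMap R (K R) r ∈ ringO R := by
  rw [algebraMap_eq_smul_e]
  exact (ringO R).smul_mem _ (e_mem_mPow 0)

theorem eq_zero_of_forall_mem_mPow {f : K R} (h : ∀ N : ℕ, f ∈ mPow R (N : ℤ)) : f = 0 := by
  ext n
  exact h (n + 1).toNat n (by omega)

theorem sub_sum_Ico_mem {M : ℤ} {f : K R} (hf : f ∈ mPow R M) (N : ℤ) :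
    f - ∑ i ∈ Finset.Ico M N, coeff f i • e i ∈ mPow R N := by
  intro n hn
  rw [coeff_sub, coeff_sum]
  simp only [coeff_smul, coeff_e, mul_ite, mul_one, mul_zero]
  rw [Finset.sum_ite_eq]
  split_ifs with h
  · simp
  · rw [sub_zero]
    exact hf n (by rw [Finset.mem_Ico] at h; omega)

/-- Every Laurent series is a Laurent polynomial up to any given order. -/
theorem exists_approx (f : K R) (N : ℤ) :
    ∃ s : Finset ℤ, (∀ i ∈ s, i < N) ∧ f - ∑ i ∈ s, coeff f i • e i ∈ mPow R N := by
  obtain ⟨M, hM⟩ := exists_mem_mPow f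
  exact ⟨Finset.Ico M N, fun i hi => (Finset.mem_Ico.1 hi).2, sub_sum_Ico_mem hM N⟩

/-- The symmetric range and the index `-j` match the way `e_{-j}` occurs in the Sugawara sum; the
constant term is included and turns out to be harmless. -/
theorem sub_sum_coeff_mem {B : ℕ} {g : K R} (hg : g ∈ mPow R (-(B : ℤ))) :
    g - ∑ j ∈ Finset.Icc (-(B : ℤ)) B, coeff g (-j) • e (-j) ∈ mPow R ((B : ℤ) + 1) := by
  intro n hn
  rw [coeff_sub, coeff_sum]
  have : ∀ j ∈ Finset.Icc (-(B : ℤ)) B, coeff (coeff g (-j) • e (-j)) n =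
      if -n = j then coeff g n else 0 := by
    intro j _
    rw [coeff_smul, coeff_e]
    by_cases h : -n = j
    · rw [if_pos h, if_pos (by omega), mul_one, ← h, neg_neg]
    · rw [if_neg h, if_neg (by omega), mul_zero]
  rw [Finset.sum_congr rfl this, Finset.sum_ite_eq]
  split_ifs with h
  · rw [sub_self]
  · rw [sub_zero]
    exact hg n (by rw [Finset.mem_Icc] at h; omega)

/-- Continuity of an additive map. -/
def AddCont (φ : K R →+ K R) : Prop := ∀ N : ℤ, ∃ M : ℤ, ∀ f ∈ mPow R M, φ f ∈ mPow R N

/-- A set of Laurent series that spans a dense additive subgroup. -/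
def SpansDense (T : Set (K R)) : Prop :=
  ∀ (f : K R) (N : ℤ), ∃ g ∈ AddSubgroup.closure T, f - g ∈ mPow R N

theorem spansDense_monomials : SpansDense {f : K R | ∃ (r : R) (i : ℤ), f = r • e i} := by
  intro f N
  obtain ⟨s, -, hs⟩ := exists_approx f N
  exact ⟨_, sum_mem fun i _ => AddSubgroup.subset_closure ⟨_, i, rfl⟩, hs⟩

/-- A continuous additive map that vanishes on a dense subgroup is zero. -/
theorem AddCont.eq_zero {φ : K R →+ K R} (hc : AddCont φ) {T : Set (K R)} (hT : SpansDense T)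
    (h : ∀ g ∈ T, φ g = 0) (f : K R) : φ f = 0 := by
  have h' : ∀ g ∈ AddSubgroup.closure T, φ g = 0 := fun g hg =>
    (AddSubgroup.closure_le φ.ker).2 (fun g hg => h g hg) hg
  refine eq_zero_of_forall_mem_mPow fun N => ?_
  obtain ⟨M, hM⟩ := hc N
  obtain ⟨g, hg, hfg⟩ := hT f M
  have := hM _ hfg
  rwa [map_sub, h' g hg, sub_zero] at this

theorem mul_right_continuous (g : K R) (N : ℤ) : ∃ M : ℤ, ∀ f ∈ mPow R M, f * g ∈ mPow R N := by
  obtain ⟨L, hL⟩ := exists_mem_mPow g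
  exact ⟨N - L, fun f hf => by simpa using mul_mem_mPow hf hL⟩

/-- A continuous additive map satisfies the Leibniz rule if it does so on a dense subgroup. -/
theorem AddCont.leibniz {φ : K R →+ K R} (hc : AddCont φ) {T : Set (K R)} (hT : SpansDense T)
    (h : ∀ f ∈ T, ∀ g ∈ T, φ (f * g) = φ f * g + f * φ g) (f g : K R) :
    φ (f * g) = φ f * g + f * φ g := by
  -- The defect of the Leibniz rule is biadditive, symmetric and continuous in each variable, so the
  -- density argument can be applied to one variable after the other.
  let B : K R →+ K R →+ K R :=
    AddMonoidHom.mk' (fun f => AddMonoidHom.mk' (fun g => φ (f * g) - φ f * g - f * φ g)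
      (fun a b => by rw [mul_add, map_add, map_add]; ring))
      (fun a b => by
        ext1 x
        simp only [AddMonoidHom.mk'_apply, AddMonoidHom.add_apply, add_mul, map_add]; ring)
  have hB : ∀ f g, B f g = φ (f * g) - φ f * g - f * φ g := fun _ _ => rfl
  have hsymm : ∀ f g, B f g = B g f := fun f g => by rw [hB, hB, mul_comm f]; ring
  have cont : ∀ g : K R, AddCont (B g) := by
    intro g N
    obtain ⟨M₁, h₁⟩ := hc N
    obtain ⟨M₂, h₂⟩ := mul_right_continuous g M₁
    obtain ⟨M₃, h₃⟩ := mul_right_continuous g N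
    obtain ⟨M₄, h₄⟩ := hc M₃
    obtain ⟨M₅, h₅⟩ := mul_right_continuous (φ g) N
    refine ⟨max M₂ (max M₄ M₅), fun f hf => ?_⟩
    rw [hsymm, hB]
    exact (mPow R N).sub_mem ((mPow R N).sub_mem (h₁ _ (h₂ f (mPow_anti R (by simp) hf)))
      (h₃ _ (h₄ f (mPow_anti R (by simp) hf)))) (h₅ f (mPow_anti R (by simp) hf))
  have h₁ : ∀ g ∈ T, ∀ f, B g f = 0 := fun g hg f =>
    (cont g).eq_zero hT (fun f hf => by rw [hB, h g hg f hf]; ring) f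
  have h₂ := (cont f).eq_zero hT (fun g hg => by rw [hsymm, h₁ g hg]) g
  rw [hB] at h₂
  linear_combination h₂

/-! ### The derivative -/

theorem coeff_ddt (f : K R) (n : ℤ) : coeff (ddt f) n = ((n + 1 : ℤ) : R) * coeff f (n + 1) :=
  series_coeff_deriv f n

theorem ddt_mem_mPow {N : ℤ} {f : K R} (hf : f ∈ mPow R N) : ddt f ∈ mPow R (N - 1) :=
  fun n hn => by rw [coeff_ddt, hf (n + 1) (by omega), mul_zero]

/-- The factor `n + 1` kills the only coefficient that could produce a simple pole. This is sharper
than the general shift by one, and it is what makes `𝒪` isotropic. -/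
theorem ddt_mem_ringO {f : K R} (hf : f ∈ ringO R) : ddt f ∈ ringO R := fun n hn => by
  rw [coeff_ddt]
  rcases lt_or_eq_of_le (show n + 1 ≤ 0 by omega) with h | h
  · rw [hf _ h, mul_zero]
  · rw [h, Int.cast_zero, zero_mul]

theorem ddt_e (i : ℤ) : ddt (e i : K R) = (i : R) • e (i - 1) := by
  ext n
  rw [coeff_ddt, coeff_smul, coeff_e, coeff_e]
  by_cases h : n + 1 = i
  · rw [if_pos h, if_pos (by omega), h]
  · rw [if_neg h, if_neg (by omega), mul_zero, mul_zero]

theorem ddt_algebraMap (r : R) : ddt (algebraMap R (K R) r) = 0 := by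
  rw [algebraMap_eq_smul_e, ddt_smul, ddt_e]; simp

theorem ddt_mul (f g : K R) : ddt (f * g) = ddt f * g + f * ddt g := by
  refine AddCont.leibniz (φ := AddMonoidHom.mk' ddt ddt_add)
    (fun N => ⟨N + 1, fun f hf => by simpa using ddt_mem_mPow hf⟩) spansDense_monomials ?_ f g
  rintro _ ⟨r, i, rfl⟩ _ ⟨s, j, rfl⟩
  simp only [AddMonoidHom.mk'_apply, smul_mul_smul_comm, e_mul_e, ddt_smul, ddt_e]
  rw [smul_mul_assoc, mul_smul_comm, e_mul_e, e_mul_e,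
    show i - 1 + j = i + j - 1 by ring, show i + (j - 1) = i + j - 1 by ring]
  simp only [smul_smul, ← add_smul]
  push_cast
  congr 1; ring

/-! ### The residue form -/

theorem resForm_e_left (i : ℤ) (g : K R) : resForm (e i) g = (i : R) * coeff g (-i) := by
  rw [resForm, ddt_e, mul_smul_comm, coeff_smul, mul_comm g, coeff_e_mul]
  congr 2; ring

theorem resForm_swap (f g : K R) : resForm f g = -resForm g f :=
  eq_neg_of_add_eq_zero_left (resForm_add_swap f g)

theorem resForm_e_right (f : K R) (i : ℤ) : resForm f (e i) = -((i : R) * coeff f (-i)) := by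
  rw [resForm_swap, resForm_e_left]

theorem resForm_eq_zero {M N : ℤ} (h : 0 < M + N) {f g : K R} (hf : f ∈ mPow R M)
    (hg : g ∈ mPow R N) : resForm f g = 0 :=
  mul_mem_mPow hg (ddt_mem_mPow hf) _ (by omega)

theorem resForm_ringO {f g : K R} (hf : f ∈ ringO R) (hg : g ∈ ringO R) : resForm f g = 0 :=
  mul_mem_mPow hg (ddt_mem_ringO hf) _ (by omega)

theorem resForm_algebraMap_left (r : R) (g : K R) : resForm (algebraMap R (K R) r) g = 0 := by
  rw [resForm, ddt_algebraMap, mul_zero, coeff_zero]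

theorem resForm_algebraMap_right (f : K R) (r : R) : resForm f (algebraMap R (K R) r) = 0 := by
  rw [resForm_swap, resForm_algebraMap_left, neg_zero]

variable (R) in
/-- The residue form as a bilinear map. -/
def resLin : K R →ₗ[R] K R →ₗ[R] R :=
  LinearMap.mk₂ R resForm resForm_add_left resForm_smul_left resForm_add_right resForm_smul_right

@[simp] theorem resLin_apply (f g : K R) : resLin R f g = resForm f g := rfl

theorem resForm_sub_left (f f' g : K R) : resForm (f - f') g = resForm f g - resForm f' g :=
  LinearMap.map_sub₂ (resLin R) f f' g

theorem coeff_ddt_neg_one (f : K R) : coeff (ddt f) (-1) = 0 := by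
  rw [coeff_ddt]; simp

/-- The two integrands add up to the exact form `d(g h f')`, and exact forms have no residue. -/
theorem resForm_mul_ddt (h f g : K R) : resForm (h * ddt f) g + resForm f (h * ddt g) = 0 := by
  rw [resForm, resForm, ← coeff_add]
  have : g * ddt (h * ddt f) + h * ddt g * ddt f = ddt (g * (h * ddt f)) := by
    rw [ddt_mul g]; ring
  rw [this, coeff_ddt_neg_one]

end LaurentLemmas

/-! ### Linear forms represented by the residue pairing -/

section Functional

variable {R : Type u} [CommRing R] [Algebra ℂ R]

theorem complex_smul_eq (z : ℂ) (f : K R) : z • f = algebraMap ℂ R z • f :=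
  (algebraMap_smul R z f).symm

theorem algebraMap_inv_mul {z : ℂ} (hz : z ≠ 0) :
    algebraMap ℂ R z⁻¹ * algebraMap ℂ R z = 1 := by
  rw [← map_mul, inv_mul_cancel₀ hz, map_one]

theorem algebraMap_inv_mul_int {n : ℤ} (hn : n ≠ 0) :
    algebraMap ℂ R (n : ℂ)⁻¹ * (n : R) = 1 := by
  have := algebraMap_inv_mul (R := R) (z := (n : ℂ)) (by exact_mod_cast hn)
  rwa [map_intCast] at this

/-- Every linear form on `K` that vanishes on `𝒪` is `(o, -)` for some `o ∈ 𝒪`. -/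
theorem exists_resForm_eq (l : K R →ₗ[R] R) (hl : ∀ f ∈ ringO R, l f = 0) :
    ∃ o ∈ ringO R, ∀ f, resForm o f = l f := by
  -- Since `(t^n, t^(-n)) = n`, the coefficient of `t^n` must be `l(t^(-n)) / n`. Only `n > 0`
  -- matters, because `l` vanishes on `𝒪`.
  let c : ℤ → R := fun n => if 0 < n then algebraMap ℂ R (n : ℂ)⁻¹ * l (e (-n)) else 0
  let o : K R := HahnSeries.ofSuppBddBelow c ⟨0, fun n hn => by
    by_contra h
    exact hn (if_neg (by omega))⟩
  have ho : ∀ n, coeff o n = c n := fun n => rfl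
  have hoO : o ∈ ringO R := fun n hn => by rw [ho]; exact if_neg (by omega)
  refine ⟨o, hoO, fun f => ?_⟩
  obtain ⟨s, hs, hf⟩ := exists_approx f 0
  rw [← sub_add_cancel f (∑ i ∈ s, coeff f i • e i), map_add, hl _ hf, resForm_add_right,
    resForm_ringO hoO hf, ← resLin_apply, map_sum, map_sum]
  congr 1
  refine Finset.sum_congr rfl fun i hi => ?_
  have hi' := hs i hi
  rw [map_smul, map_smul, resLin_apply, resForm_e_right, ho]
  have := algebraMap_inv_mul_int (R := R) (n := -i) (by omega)
  simp only [c]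
  rw [if_pos (by omega), neg_neg]
  push_cast at this ⊢
  rw [smul_eq_mul, smul_eq_mul]
  linear_combination (coeff f i * l (e i)) * this

end Functional

/-! ### Horizontal and vertical derivations -/

section DerivationLemmas

variable {R : Type u} [CommRing R] [Algebra ℂ R]

/-- Apply a derivation of `R` to the coefficients of a Laurent series. -/
def mapCoeff (δ : Derivation ℂ R R) (f : K R) : K R :=
  HahnSeries.map (show HahnSeries ℤ R from f) (δ : R →ₗ[ℂ] R)

@[simp] theorem coeff_mapCoeff (δ : Derivation ℂ R R) (f : K R) (n : ℤ) :
    coeff (mapCoeff δ f) n = δ (coeff f n) := rfl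

theorem mapCoeff_add (δ : Derivation ℂ R R) (f g : K R) :
    mapCoeff δ (f + g) = mapCoeff δ f + mapCoeff δ g := by
  ext n; simp

theorem mapCoeff_mem_mPow (δ : Derivation ℂ R R) {N : ℤ} {f : K R} (hf : f ∈ mPow R N) :
    mapCoeff δ f ∈ mPow R N := fun n hn => by rw [coeff_mapCoeff, hf n hn, map_zero]

theorem mapCoeff_smul_e (δ : Derivation ℂ R R) (r : R) (i : ℤ) :
    mapCoeff δ (r • e i) = δ r • e i := by
  ext n
  rw [coeff_mapCoeff, coeff_smul, coeff_smul, coeff_e]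
  split_ifs <;> simp

theorem mapCoeff_ddt (δ : Derivation ℂ R R) (f : K R) :
    mapCoeff δ (ddt f) = ddt (mapCoeff δ f) := by
  ext n
  rw [coeff_mapCoeff, coeff_ddt, coeff_ddt, coeff_mapCoeff, Derivation.leibniz]
  simp

theorem coeff_complex_smul (z : ℂ) (f : K R) (n : ℤ) : coeff (z • f) n = z • coeff f n := rfl

/-- The coefficientwise extension to `K` of a derivation of `R`. -/
def horizontalDer (δ : Derivation ℂ R R) : Derivation ℂ (K R) (K R) :=
  Derivation.mk'
    { toFun := mapCoeff δ
      map_add' := mapCoeff_add δ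
      map_smul' := fun z f => by
        ext n
        rw [coeff_mapCoeff, coeff_complex_smul, Derivation.map_smul]
        rfl }
    (fun f g => by
      have := AddCont.leibniz (φ := AddMonoidHom.mk' (mapCoeff δ) (mapCoeff_add δ))
        (fun N => ⟨N, fun f hf => mapCoeff_mem_mPow δ hf⟩) spansDense_monomials (by
          rintro _ ⟨r, i, rfl⟩ _ ⟨s, j, rfl⟩
          simp only [AddMonoidHom.mk'_apply, smul_mul_smul_comm, e_mul_e, mapCoeff_smul_e,
            Derivation.leibniz, ← add_smul]
          congr 1
          simp only [smul_eq_mul]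
          ring) f g
      change mapCoeff δ (f * g) = f * mapCoeff δ g + g * mapCoeff δ f
      simp only [AddMonoidHom.mk'_apply] at this
      rw [this]; ring)

theorem horizontalDer_apply (δ : Derivation ℂ R R) (f : K R) :
    horizontalDer δ f = mapCoeff δ f := rfl

theorem horizontalDer_restricts (δ : Derivation ℂ R R) :
    Restricts (horizontalDer δ) δ := fun r => by
  rw [horizontalDer_apply, algebraMap_eq_smul_e, mapCoeff_smul_e, algebraMap_eq_smul_e]

theorem horizontalDer_mem (δ : Derivation ℂ R R) : horizontalDer δ ∈ thetaKR R :=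
  ⟨fun N => ⟨N, fun _ hf => mapCoeff_mem_mPow δ hf⟩, fun r => ⟨δ r, horizontalDer_restricts δ r⟩⟩

theorem horizontalDer_isHorizontal (δ : Derivation ℂ R R) : IsHorizontal (horizontalDer δ) :=
  ⟨horizontalDer_mem δ, fun i => by
    rw [horizontalDer_apply, ← one_smul R (e i), mapCoeff_smul_e]; simp⟩

theorem mem_thetaKR_of_isVertical {D : Derivation ℂ (K R) (K R)} (hD : IsVertical D) :
    D ∈ thetaKR R :=
  ⟨hD.1, fun r => ⟨0, by rw [hD.2, map_zero]⟩⟩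

theorem IsVertical.restricts {D : Derivation ℂ (K R) (K R)} (hD : IsVertical D) :
    Restricts D 0 := fun r => by rw [hD.2]; simp

theorem Restricts.isVertical {D : Derivation ℂ (K R) (K R)} (hD : D ∈ thetaKR R)
    (h : Restricts D 0) : IsVertical D := ⟨hD.1, fun r => by rw [h r]; simp⟩

theorem Restricts.unique {D : Derivation ℂ (K R) (K R)} {δ ε : Derivation ℂ R R}
    (h : Restricts D δ) (h' : Restricts D ε) : δ = ε :=
  Derivation.ext fun r => algebraMap_injective ((h r).symm.trans (h' r))

theorem Restricts.add {D E : Derivation ℂ (K R) (K R)} {δ ε : Derivation ℂ R R}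
    (h : Restricts D δ) (h' : Restricts E ε) : Restricts (D + E) (δ + ε) := fun r => by
  simp [h r, h' r]

theorem Restricts.sub {D E : Derivation ℂ (K R) (K R)} {δ ε : Derivation ℂ R R}
    (h : Restricts D δ) (h' : Restricts E ε) : Restricts (D - E) (δ - ε) := fun r => by
  simp [h r, h' r]

theorem Restricts.complex_smul {D : Derivation ℂ (K R) (K R)} {δ : Derivation ℂ R R}
    (h : Restricts D δ) (z : ℂ) : Restricts (z • D) (z • δ) := fun r => by
  rw [Derivation.smul_apply, h, Derivation.smul_apply, Algebra.algebraMap_eq_smul_one,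
    Algebra.algebraMap_eq_smul_one, smul_assoc]

theorem Restricts.smul {D : Derivation ℂ (K R) (K R)} {δ : Derivation ℂ R R}
    (h : Restricts D δ) (r : R) : Restricts (r • D) (r • δ) := fun s => by
  rw [Derivation.smul_apply, h, Derivation.smul_apply, Algebra.algebraMap_eq_smul_one,
    Algebra.algebraMap_eq_smul_one, smul_assoc]

theorem Restricts.lie {D E : Derivation ℂ (K R) (K R)} {δ ε : Derivation ℂ R R}
    (h : Restricts D δ) (h' : Restricts E ε) : Restricts ⁅D, E⁆ ⁅δ, ε⁆ := fun r => by
  rw [Derivation.commutator_apply, h, h', h, h', Derivation.commutator_apply, map_sub]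

theorem Restricts.map_smul {D : Derivation ℂ (K R) (K R)} {δ : Derivation ℂ R R}
    (h : Restricts D δ) (r : R) (f : K R) : D (r • f) = δ r • f + r • D f := by
  rw [Algebra.smul_def, Derivation.leibniz, h r, smul_eq_mul, smul_eq_mul, Algebra.smul_def,
    Algebra.smul_def]
  ring

theorem IsVertical.map_smul {D : Derivation ℂ (K R) (K R)} (hD : IsVertical D) (r : R) (f : K R) :
    D (r • f) = r • D f := by
  rw [hD.restricts.map_smul]; simp

theorem smul_mem_thetaKR {D : Derivation ℂ (K R) (K R)} (hD : D ∈ thetaKR R) (r : R) :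
    r • D ∈ thetaKR R := by
  refine ⟨fun N => ?_, fun s => ?_⟩
  · obtain ⟨M, hM⟩ := hD.1 N
    exact ⟨M, fun f hf => (mPow R N).smul_mem r (hM f hf)⟩
  · obtain ⟨x, hx⟩ := hD.2 s
    refine ⟨r * x, ?_⟩
    rw [Derivation.smul_apply, hx, map_mul, ← Algebra.smul_def]

/-- A member of `θ_{K,R}` restricts to a derivation of `R`. -/
theorem exists_restricts {D : Derivation ℂ (K R) (K R)} (hD : D ∈ thetaKR R) :
    ∃ δ, Restricts D δ := by
  choose s hs using hD.2
  refine ⟨Derivation.mk'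
    { toFun := s
      map_add' := fun x y => algebraMap_injective (by
        rw [← hs, map_add, map_add, map_add, hs, hs])
      map_smul' := fun z x => algebraMap_injective (by
        rw [← hs, Algebra.algebraMap_eq_smul_one, smul_assoc, Derivation.map_smul,
          ← Algebra.algebraMap_eq_smul_one, hs, RingHom.id_apply,
          Algebra.algebraMap_eq_smul_one, Algebra.algebraMap_eq_smul_one, smul_assoc]) }
    (fun x y => algebraMap_injective (by
        change algebraMap R (K R) (s (x * y)) = _
        rw [← hs, map_mul, Derivation.leibniz, hs, hs, map_add, smul_eq_mul, smul_eq_mul,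
          smul_eq_mul, smul_eq_mul, map_mul, map_mul]
        rfl)), fun r => hs r⟩

/-- Two continuous derivations that agree on `R` and on the monomials are equal. -/
theorem derivation_ext {D E : Derivation ℂ (K R) (K R)} (hD : IsCont D) (hE : IsCont E)
    (hR : ∀ r, D (algebraMap R (K R) r) = E (algebraMap R (K R) r))
    (he : ∀ i, D (e i) = E (e i)) : D = E := by
  ext1 f
  rw [← sub_eq_zero]
  refine AddCont.eq_zero (φ := ((D : K R →ₗ[ℂ] K R) - (E : K R →ₗ[ℂ] K R)).toAddMonoidHom)
    (fun N => ?_) spansDense_monomials ?_ f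
  · obtain ⟨M₁, h₁⟩ := hD N
    obtain ⟨M₂, h₂⟩ := hE N
    exact ⟨max M₁ M₂, fun f hf => (mPow R N).sub_mem
      (h₁ f (mPow_anti R (le_max_left _ _) hf)) (h₂ f (mPow_anti R (le_max_right _ _) hf))⟩
  · rintro _ ⟨r, i, rfl⟩
    change D (r • e i) - E (r • e i) = 0
    rw [Algebra.smul_def, Derivation.leibniz, Derivation.leibniz, hR, he, sub_self]

theorem IsHorizontal.eq_horizontalDer {D : Derivation ℂ (K R) (K R)} (hD : IsHorizontal D)
    {δ : Derivation ℂ R R} (h : Restricts D δ) : D = horizontalDer δ :=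
  derivation_ext hD.1.1 (horizontalDer_mem δ).1
    (fun r => (h r).trans (horizontalDer_restricts δ r).symm)
    (fun i => (hD.2 i).trans ((horizontalDer_isHorizontal δ).2 i).symm)

theorem ddt_complex_smul (z : ℂ) (f : K R) : ddt (z • f) = z • ddt f := by
  rw [complex_smul_eq, ddt_smul, complex_smul_eq]

/-- The vertical derivation `h d/dt`. -/
def verticalDer (h : K R) : Derivation ℂ (K R) (K R) :=
  Derivation.mk'
    { toFun := fun f => h * ddt f
      map_add' := fun f g => by rw [ddt_add, mul_add]
      map_smul' := fun z f => by
        rw [ddt_complex_smul, complex_smul_eq, complex_smul_eq, mul_smul_comm]; rfl }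
    (fun f g => by
      change h * ddt (f * g) = f * (h * ddt g) + g * (h * ddt f)
      rw [ddt_mul]; ring)

theorem verticalDer_apply (h f : K R) : verticalDer h f = h * ddt f := rfl

theorem verticalDer_isVertical (h : K R) : IsVertical (verticalDer h) := by
  refine ⟨fun N => ?_, fun r => by rw [verticalDer_apply, ddt_algebraMap, mul_zero]⟩
  obtain ⟨M, hM⟩ := mul_right_continuous h N
  refine ⟨M + 1, fun f hf => ?_⟩
  rw [verticalDer_apply, mul_comm]
  exact hM _ (by simpa using ddt_mem_mPow hf)

/-- Nonnegative powers follow from the Leibniz rule by induction, negative ones by differentiating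
`t^n t^(-n) = 1`. Continuity plays no role here. -/
theorem derivation_e_one (D : Derivation ℂ (K R) (K R)) (i : ℤ) :
    D (e i) = ((i : R) • e (i - 1)) * D (e 1) := by
  have hn : ∀ n : ℕ, D (e n) = (((n : ℤ) : R) • e ((n : ℤ) - 1)) * D (e 1) := by
    intro n
    induction n with
    | zero =>
      rw [Nat.cast_zero, e_zero]
      simp
    | succ n ih =>
      rw [Nat.cast_succ, ← e_mul_e, Derivation.leibniz, ih, smul_eq_mul, smul_eq_mul,
        ← mul_assoc, mul_smul_comm, e_mul_e]
      rw [show (1 : ℤ) + ((n : ℤ) - 1) = n by ring, add_sub_cancel_right, ← add_mul]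
      push_cast
      rw [add_smul, one_smul]; ring
  obtain ⟨n, rfl | rfl⟩ := i.eq_nat_or_neg
  · exact hn n
  · have h : D (e (n : ℤ) * e (-(n : ℤ))) = 0 := by
      rw [e_mul_e, add_neg_cancel, e_zero]; simp
    rw [Derivation.leibniz, hn, smul_eq_mul, smul_eq_mul] at h
    have h1 : (e (n : ℤ) : K R) * e (-(n : ℤ)) = 1 := by rw [e_mul_e, add_neg_cancel, e_zero]
    have h2 : (e (-(n : ℤ) - 1) : K R) = e (-(n : ℤ)) * e (-(n : ℤ)) * e ((n : ℤ) - 1) := by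
      rw [e_mul_e, e_mul_e]; congr 1; ring
    have h3 : (((-(n : ℤ) : ℤ) : R)) • (e (-(n : ℤ) - 1) : K R) =
        -(e (-(n : ℤ)) * e (-(n : ℤ)) * ((((n : ℤ) : R)) • e ((n : ℤ) - 1))) := by
      rw [h2, mul_smul_comm, Int.cast_neg, neg_smul]
    rw [h3]
    linear_combination e (-(n : ℤ)) * h - D (e (-(n : ℤ))) * h1

/-- By continuity a derivation is determined by its values on `R` and on the monomials, hence a
vertical one by its value at `t`. -/
theorem IsVertical.eq_verticalDer {D : Derivation ℂ (K R) (K R)} (hD : IsVertical D) :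
    D = verticalDer (D (e 1)) :=
  derivation_ext hD.1 (verticalDer_isVertical _).1
    (fun r => by rw [hD.2, (verticalDer_isVertical _).2])
    (fun i => by rw [derivation_e_one, verticalDer_apply, ddt_e, mul_comm])

theorem isVertical_sub_horizontalDer {D : Derivation ℂ (K R) (K R)} (hD : D ∈ thetaKR R)
    {δ : Derivation ℂ R R} (h : Restricts D δ) : IsVertical (D - horizontalDer δ) :=
  Restricts.isVertical ((thetaKR R).sub_mem hD (horizontalDer_mem δ))
    (by simpa using h.sub (horizontalDer_restricts δ))

theorem IsVertical.resForm_add {D : Derivation ℂ (K R) (K R)} (hD : IsVertical D) (f g : K R) :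
    resForm (D f) g + resForm f (D g) = 0 := by
  rw [hD.eq_verticalDer]
  exact resForm_mul_ddt _ f g

/-- The residue form is invariant under `θ_{K,R}`. -/
theorem Restricts.resForm_add {D : Derivation ℂ (K R) (K R)} (hD : D ∈ thetaKR R)
    {δ : Derivation ℂ R R} (h : Restricts D δ) (f g : K R) :
    resForm (D f) g + resForm f (D g) = δ (resForm f g) := by
  -- The vertical part preserves the form because exact forms have no residue; the horizontal part
  -- differentiates the coefficients of `g df` and accounts for `δ` on the right.
  obtain ⟨E, hE, rfl⟩ : ∃ E, IsVertical E ∧ D = E + horizontalDer δ :=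
    ⟨_, isVertical_sub_horizontalDer hD h, (sub_add_cancel _ _).symm⟩
  have h₁ := hE.resForm_add f g
  have h₂ : resForm (horizontalDer δ f) g + resForm f (horizontalDer δ g) = δ (resForm f g) := by
    simp only [resForm]
    rw [horizontalDer_apply, ← mapCoeff_ddt, ← coeff_mapCoeff, ← horizontalDer_apply,
      ← horizontalDer_apply, Derivation.leibniz, coeff_add, smul_eq_mul, smul_eq_mul,
      mul_comm (ddt f), horizontalDer_apply]
  rw [Derivation.add_apply, Derivation.add_apply, resForm_add_left, resForm_add_right]
  linear_combination h₁ + h₂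

end DerivationLemmas

/-! ### Twisted dual numbers -/

section Twisted

variable {R : Type u} [CommRing R] [Algebra ℂ R]

/-- The dual numbers over an `R`-algebra `B`, as an `R`-algebra through `r ↦ r + δ(r) ε`. -/
def TwistedDual (_δ : Derivation ℂ R R) (B : Type u) : Type u := TrivSqZeroExt B B

instance (δ : Derivation ℂ R R) (B : Type u) [Ring B] : Ring (TwistedDual δ B) :=
  inferInstanceAs (Ring (TrivSqZeroExt B B))

instance (δ : Derivation ℂ R R) (B : Type u) [CommRing B] : CommRing (TwistedDual δ B) :=
  inferInstanceAs (CommRing (TrivSqZeroExt B B))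

namespace TwistedDual

variable {δ : Derivation ℂ R R} {B : Type u}

/-- The element `x + y ε`. -/
def mk (δ : Derivation ℂ R R) (x y : B) : TwistedDual δ B := ((x, y) : B × B)

/-- The constant part. -/
def re (z : TwistedDual δ B) : B := TrivSqZeroExt.fst z

/-- The coefficient of `ε`. -/
def im (z : TwistedDual δ B) : B := TrivSqZeroExt.snd z

@[simp] theorem re_mk (x y : B) : (mk δ x y).re = x := rfl

@[simp] theorem im_mk (x y : B) : (mk δ x y).im = y := rfl

theorem ext {z w : TwistedDual δ B} (h : z.re = w.re) (h' : z.im = w.im) : z = w :=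
  TrivSqZeroExt.ext h h'

variable [Ring B]

@[simp] theorem re_add (z w : TwistedDual δ B) : (z + w).re = z.re + w.re := rfl

@[simp] theorem im_add (z w : TwistedDual δ B) : (z + w).im = z.im + w.im := rfl

@[simp] theorem re_sub (z w : TwistedDual δ B) : (z - w).re = z.re - w.re := rfl

@[simp] theorem im_sub (z w : TwistedDual δ B) : (z - w).im = z.im - w.im := rfl

@[simp] theorem re_mul (z w : TwistedDual δ B) : (z * w).re = z.re * w.re := rfl

@[simp] theorem im_mul (z w : TwistedDual δ B) : (z * w).im = z.re * w.im + z.im * w.re := rfl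

@[simp] theorem re_one : (1 : TwistedDual δ B).re = 1 := rfl

@[simp] theorem im_one : (1 : TwistedDual δ B).im = 0 := rfl

@[simp] theorem re_zero : (0 : TwistedDual δ B).re = 0 := rfl

@[simp] theorem im_zero : (0 : TwistedDual δ B).im = 0 := rfl

variable [Algebra R B]

/-- The structure map `r ↦ r + δ(r) ε`. -/
def structureMap (δ : Derivation ℂ R R) (B : Type u) [Ring B] [Algebra R B] :
    R →+* TwistedDual δ B where
  toFun r := mk δ (algebraMap R B r) (algebraMap R B (δ r))
  map_one' := ext (by simp) (by simp)
  map_zero' := ext (by simp) (by simp)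
  map_add' r s := ext (by simp) (by simp)
  map_mul' r s := ext (by simp) (by
    simp only [im_mk, im_mul, re_mk, Derivation.leibniz, smul_eq_mul, map_add, map_mul]
    rw [Algebra.commutes s])

/-- With this structure an `R`-algebra homomorphism into the dual numbers whose constant part is the
identity is the same thing as a derivation over `δ`. Derivations over `δ` thereby come under the
universal properties of enveloping and of formally smooth algebras. -/
instance : Algebra R (TwistedDual δ B) :=
  (structureMap δ B).toAlgebra' fun r x => ext (Algebra.commutes r _) (by
    change algebraMap R B r * x.im + algebraMap R B (δ r) * x.re =
      x.re * algebraMap R B (δ r) + x.im * algebraMap R B r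
    rw [Algebra.commutes, Algebra.commutes, add_comm])

@[simp] theorem re_algebraMap (r : R) : (algebraMap R (TwistedDual δ B) r).re = algebraMap R B r :=
  rfl

@[simp] theorem im_algebraMap (r : R) :
    (algebraMap R (TwistedDual δ B) r).im = algebraMap R B (δ r) := rfl

@[simp] theorem re_smul (r : R) (z : TwistedDual δ B) : (r • z).re = r • z.re := by
  rw [Algebra.smul_def, Algebra.smul_def]; rfl

@[simp] theorem im_smul (r : R) (z : TwistedDual δ B) : (r • z).im = r • z.im + δ r • z.re := by
  rw [Algebra.smul_def, Algebra.smul_def, Algebra.smul_def]; rfl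

end TwistedDual

end Twisted

/-! ### The enveloping algebra -/

section Enveloping

variable {R : Type u} [CommRing R] [Algebra ℂ R]

theorem inU_add (f g : K R) : (inU (f + g) : UHeis R) = inU f + inU g := by
  rw [inU, inU, inU, ← map_add]
  congr 1
  exact Prod.ext rfl (add_zero (0 : R)).symm

theorem inU_smul (r : R) (f : K R) : (inU (r • f) : UHeis R) = r • inU f := by
  rw [inU, inU, ← map_smul]
  congr 1
  exact Prod.ext rfl (mul_zero r).symm

/-- `inU` as a linear map. -/
def inULin : K R →ₗ[R] UHeis R where
  toFun := inU
  map_add' := inU_add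
  map_smul' := inU_smul

theorem inU_zero : (inU (0 : K R) : UHeis R) = 0 := map_zero inULin

theorem ι_eq (f : K R) (r : R) :
    UniversalEnvelopingAlgebra.ι R (show Heis R from (f, r)) = inU f + r • (hbar : UHeis R) := by
  rw [inU, hbar, ← map_smul, ← map_add]
  congr 1
  refine Prod.ext (show f = f + r • (0 : K R) by simp) (show r = 0 + r • (1 : R) by simp)

theorem ι_mul_sub (x y : Heis R) :
    UniversalEnvelopingAlgebra.ι R x * UniversalEnvelopingAlgebra.ι R y -
      UniversalEnvelopingAlgebra.ι R y * UniversalEnvelopingAlgebra.ι R x =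
      resForm x.1 y.1 • (hbar : UHeis R) := by
  rw [← LieRing.of_associative_ring_bracket, ← LieHom.map_lie, hbar, ← map_smul]
  congr 1
  exact Prod.ext (smul_zero _).symm (mul_one _).symm

theorem inU_mul_sub (f g : K R) :
    (inU f * inU g - inU g * inU f : UHeis R) = resForm f g • hbar :=
  ι_mul_sub (show Heis R from (f, 0)) (show Heis R from (g, 0))

theorem hbar_mul_inU (f : K R) : (hbar * inU f : UHeis R) = inU f * hbar := by
  have := ι_mul_sub (show Heis R from (0, 1)) (show Heis R from (f, 0))
  rw [← sub_eq_zero]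
  refine this.trans ?_
  change resForm (0 : K R) f • _ = _
  rw [← map_zero (algebraMap R (K R)), resForm_algebraMap_left, zero_smul]

/-- The elements with property `P` form a subalgebra that contains the image of the Lie algebra. The
universal property factors the identity of `U K̂` through this subalgebra, which is therefore
everything. -/
theorem UHeis.induction {P : UHeis R → Prop} (hr : ∀ r, P (algebraMap R _ r))
    (hf : ∀ f, P (inU f)) (hh : P hbar) (hadd : ∀ u v, P u → P v → P (u + v))
    (hmul : ∀ u v, P u → P v → P (u * v)) (u : UHeis R) : P u := by
  let S : Subalgebra R (UHeis R) :=
    { carrier := {u | P u}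
      mul_mem' := fun {u v} => hmul u v
      add_mem' := fun {u v} => hadd u v
      algebraMap_mem' := hr }
  have hι : ∀ x : Heis R, UniversalEnvelopingAlgebra.ι R x ∈ S := fun x => by
    have : x = (x.1, x.2) := rfl
    rw [this, ι_eq]
    exact S.add_mem (hf _) (S.smul_mem hh _)
  let φ : Heis R →ₗ⁅R⁆ S :=
    { toFun := fun x => ⟨UniversalEnvelopingAlgebra.ι R x, hι x⟩
      map_add' := fun x y => Subtype.ext (map_add (UniversalEnvelopingAlgebra.ι R) x y)
      map_smul' := fun r x => Subtype.ext (map_smul (UniversalEnvelopingAlgebra.ι R) r x)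
      map_lie' := fun {x y} => Subtype.ext (LieHom.map_lie (UniversalEnvelopingAlgebra.ι R) x y) }
  have h : S.val.comp (UniversalEnvelopingAlgebra.lift R φ) = AlgHom.id R _ := by
    apply UniversalEnvelopingAlgebra.hom_ext
    ext x
    change S.val (UniversalEnvelopingAlgebra.lift R φ (UniversalEnvelopingAlgebra.ι R x)) = _
    rw [UniversalEnvelopingAlgebra.lift_ι_apply]
    rfl
  have h' := DFunLike.congr_fun h u
  rw [AlgHom.comp_apply, AlgHom.id_apply] at h'
  rw [← h']
  exact (UniversalEnvelopingAlgebra.lift R φ u).2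

theorem hbar_mul (u : UHeis R) : hbar * u = u * hbar := by
  induction u using UHeis.induction with
  | hr r => exact (Algebra.commutes r _).symm
  | hf f => exact hbar_mul_inU f
  | hh => rfl
  | hadd u v hu hv => rw [mul_add, add_mul, hu, hv]
  | hmul u v hu hv => rw [← mul_assoc, hu, mul_assoc, hv, mul_assoc]

/-! ### Extending a derivation of `K` to the enveloping algebra -/

section DerU

variable {D : Derivation ℂ (K R) (K R)} {δ : Derivation ℂ R R}

/-- The Lie homomorphism `x ↦ x + D(x) ε`. -/
def derLie (hD : D ∈ thetaKR R) (h : Restricts D δ) : Heis R →ₗ⁅R⁆ TwistedDual δ (UHeis R) where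
  toFun x := TwistedDual.mk δ (UniversalEnvelopingAlgebra.ι R x)
    (inU (D x.1) + δ x.2 • hbar)
  map_add' x y := TwistedDual.ext (map_add _ x y) (by
    change inU (D (x.1 + y.1)) + δ (x.2 + y.2) • hbar = _
    simp only [map_add, inU_add, add_smul, TwistedDual.im_add, TwistedDual.im_mk]
    abel)
  map_smul' r x := TwistedDual.ext (by simp) (by
    change inU (D (r • x.1)) + δ (r * x.2) • hbar = _
    have hx : UniversalEnvelopingAlgebra.ι R x = inU x.1 + x.2 • (hbar : UHeis R) := ι_eq _ _
    simp only [RingHom.id_apply, TwistedDual.im_smul, TwistedDual.im_mk, TwistedDual.re_mk, hx,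
      h.map_smul, Derivation.leibniz, inU_add, inU_smul, smul_add, smul_smul, smul_eq_mul,
      add_smul]
    rw [mul_comm (δ r)]
    abel)
  map_lie' {x y} := by
    rw [LieRing.of_associative_ring_bracket]
    refine TwistedDual.ext ?_ ?_
    · exact (LieHom.map_lie _ x y).trans (LieRing.of_associative_ring_bracket _ _)
    · change inU (D (0 : K R)) + δ (resForm x.1 y.1) • hbar = _
      have hx : UniversalEnvelopingAlgebra.ι R x = inU x.1 + x.2 • (hbar : UHeis R) := ι_eq _ _
      have hy : UniversalEnvelopingAlgebra.ι R y = inU y.1 + y.2 • (hbar : UHeis R) := ι_eq _ _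
      have e₁ := inU_mul_sub (D x.1) y.1
      have e₂ := inU_mul_sub x.1 (D y.1)
      have c₁ := hbar_mul_inU (D x.1)
      have c₂ := hbar_mul_inU (D y.1)
      have c₃ := hbar_mul_inU x.1
      have c₄ := hbar_mul_inU y.1
      -- Compatibility with the bracket is precisely the invariance of the residue form; afterwards
      -- only the centrality of `ℏ` is needed.
      rw [← h.resForm_add hD, add_smul, ← e₁, ← e₂]
      simp only [map_zero, inU_zero, TwistedDual.im_sub, TwistedDual.im_mul, TwistedDual.im_mk,
        TwistedDual.re_mk, hx, hy, mul_add, add_mul, smul_mul_assoc, mul_smul_comm, c₁, c₂, c₃, c₄]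
      module

variable (hD : D ∈ thetaKR R) (h : Restricts D δ)

/-- The algebra homomorphism `u ↦ u + D(u) ε`. -/
def derHom : UHeis R →ₐ[R] TwistedDual δ (UHeis R) :=
  UniversalEnvelopingAlgebra.lift R (derLie hD h)

theorem derHom_ι (x : Heis R) : derHom hD h (UniversalEnvelopingAlgebra.ι R x) =
    TwistedDual.mk δ (UniversalEnvelopingAlgebra.ι R x) (inU (D x.1) + δ x.2 • hbar) :=
  UniversalEnvelopingAlgebra.lift_ι_apply R _ x

theorem re_derHom (u : UHeis R) : (derHom hD h u).re = u := by
  induction u using UHeis.induction with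
  | hr r => rw [AlgHom.commutes]; rfl
  | hf f => rw [inU, derHom_ι]; rfl
  | hh => rw [hbar, derHom_ι]; rfl
  | hadd u v hu hv => rw [map_add, TwistedDual.re_add, hu, hv]
  | hmul u v hu hv => rw [map_mul, TwistedDual.re_mul, hu, hv]

/-- The derivation of `U K̂` that extends `D`, kills `ℏ` and is `δ` on scalars. -/
def derU : UHeis R →+ UHeis R :=
  AddMonoidHom.mk' (fun u => (derHom hD h u).im) fun u v => by rw [map_add, TwistedDual.im_add]

theorem derU_apply (u : UHeis R) : derU hD h u = (derHom hD h u).im := rfl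

theorem derU_mul (u v : UHeis R) : derU hD h (u * v) = u * derU hD h v + derU hD h u * v := by
  simp only [derU_apply, map_mul, TwistedDual.im_mul, re_derHom]

theorem derU_inU (f : K R) : derU hD h (inU f) = inU (D f) := by
  rw [derU_apply, inU, derHom_ι, TwistedDual.im_mk]
  simp

theorem derU_hbar : derU hD h hbar = 0 := by
  rw [derU_apply, hbar, derHom_ι, TwistedDual.im_mk]
  simp [inU_zero]

theorem derU_smul (r : R) (u : UHeis R) : derU hD h (r • u) = δ r • u + r • derU hD h u := by
  simp only [derU_apply, map_smul, TwistedDual.im_smul, re_derHom, add_comm]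

theorem derU_one : derU hD h 1 = 0 := by
  rw [derU_apply, map_one]; rfl

end DerU

end Enveloping

/-! ### The Fock space -/

section FockLemmas

variable {R : Type u} [CommRing R] [Algebra ℂ R]

theorem mk_eq_smul_vac (u : UHeis R) : (Submodule.Quotient.mk u : FockSpace R) = u • vac R := by
  rw [vac]
  exact congrArg _ (mul_one u).symm

theorem exists_eq_smul_vac (v : FockSpace R) : ∃ u : UHeis R, v = u • vac R := by
  obtain ⟨u, rfl⟩ := Submodule.Quotient.mk_surjective _ v
  exact ⟨u, mk_eq_smul_vac u⟩

theorem inU_smul_vac {f : K R} (hf : f ∈ ringO R) : (inU f : UHeis R) • vac R = 0 := by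
  rw [← mk_eq_smul_vac]
  exact (Submodule.Quotient.mk_eq_zero _).2 (Submodule.subset_span (Or.inl ⟨f, hf, rfl⟩))

theorem hbar_smul_vac : (hbar : UHeis R) • vac R = vac R := by
  rw [← sub_eq_zero, ← sub_eq_zero, sub_zero, ← one_smul (UHeis R) (vac R), ← mul_smul, ← sub_smul,
    mul_one, ← mk_eq_smul_vac]
  exact (Submodule.Quotient.mk_eq_zero _).2 (Submodule.subset_span (Or.inr rfl))

theorem hbar_smul (v : FockSpace R) : (hbar : UHeis R) • v = v := by
  obtain ⟨u, rfl⟩ := exists_eq_smul_vac v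
  rw [← mul_smul, hbar_mul, mul_smul, hbar_smul_vac]

theorem algebraMap_smul_fock (r : R) (v : FockSpace R) :
    (algebraMap R (UHeis R) r) • v = r • v := algebraMap_smul (UHeis R) r v

/-- The operator of multiplication by `f ∈ K` on the Fock space. -/
def act : K R →ₗ[R] FockSpace R →ₗ[R] FockSpace R :=
  LinearMap.mk₂ R (fun f v => (inU f : UHeis R) • v)
    (fun f g v => by rw [inU_add, add_smul]) (fun r f v => by rw [inU_smul, smul_assoc])
    (fun f v w => smul_add _ _ _) (fun r f v => smul_comm _ _ _)

theorem act_apply (f : K R) (v : FockSpace R) : act f v = (inU f : UHeis R) • v := rfl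

theorem act_comm (f g : K R) (v : FockSpace R) :
    act f (act g v) = act g (act f v) + resForm f g • v := by
  simp only [act_apply, ← mul_smul]
  rw [← sub_eq_iff_eq_add', ← sub_smul, inU_mul_sub, smul_assoc, hbar_smul]

theorem act_vac {f : K R} (hf : f ∈ ringO R) : act f (vac R) = 0 := inU_smul_vac hf

/-- The constant 1 is in the radical of the residue form, so it is central, and it kills the vacuum
because it lies in `𝒪`. This is why the Sugawara sum can omit the index 0. -/
theorem act_one (v : FockSpace R) : act (1 : K R) v = 0 := by
  obtain ⟨u, rfl⟩ := exists_eq_smul_vac v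
  have hc : ∀ w : UHeis R, inU 1 * w = w * inU 1 := by
    intro w
    induction w using UHeis.induction with
    | hr r => exact (Algebra.commutes r _).symm
    | hf f =>
      rw [← sub_eq_zero, inU_mul_sub, ← map_one (algebraMap R (K R)), resForm_algebraMap_left,
        zero_smul]
    | hh => exact (hbar_mul _).symm
    | hadd u v hu hv => rw [mul_add, add_mul, hu, hv]
    | hmul u v hu hv => rw [← mul_assoc, hu, mul_assoc, hv, mul_assoc]
  rw [act_apply, ← mul_smul, hc, mul_smul, inU_smul_vac, smul_zero]
  rw [← map_one (algebraMap R (K R))]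
  exact algebraMap_mem_ringO 1

theorem fock_induction {P : FockSpace R → Prop} (h0 : P (vac R))
    (hadd : ∀ v w, P v → P w → P (v + w)) (hr : ∀ (r : R) v, P v → P (r • v))
    (hf : ∀ f v, P v → P (act f v)) (v : FockSpace R) : P v := by
  obtain ⟨u, rfl⟩ := exists_eq_smul_vac v
  suffices ∀ v, P v → P (u • v) from this _ h0
  induction u using UHeis.induction with
  | hr r => intro v hv; rw [algebraMap_smul_fock]; exact hr r v hv
  | hf f => exact hf f
  | hh => intro v hv; rwa [hbar_smul]
  | hadd u w hu hw => intro v hv; rw [add_smul]; exact hadd _ _ (hu v hv) (hw v hv)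
  | hmul u w hu hw => intro v hv; rw [mul_smul]; exact hu _ (hw v hv)

/-- Every vector of the Fock space is killed by `𝔪 ^ N` for some `N`. -/
theorem exists_act_eq_zero (v : FockSpace R) :
    ∃ N : ℕ, ∀ f ∈ mPow R (N : ℤ), act f v = 0 := by
  induction v using fock_induction with
  | h0 => exact ⟨0, fun f hf => act_vac hf⟩
  | hadd v w hv hw =>
    obtain ⟨M, hM⟩ := hv
    obtain ⟨N, hN⟩ := hw
    exact ⟨max M N, fun f hf => by
      rw [map_add, hM f (mPow_anti R (by simp) hf), hN f (mPow_anti R (by simp) hf), add_zero]⟩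
  | hr r v hv =>
    obtain ⟨M, hM⟩ := hv
    exact ⟨M, fun f hf => by rw [map_smul, hM f hf, smul_zero]⟩
  | hf g v hv =>
    obtain ⟨M, hM⟩ := hv
    obtain ⟨N, hN⟩ := exists_nat_mem_mPow g
    -- Order above `N` forces the commutator of `f` with `g` to vanish, `g` having a pole of order
    -- at most `N`; order at least `M` lets `f` kill `v`.
    exact ⟨max M (N + 1), fun f hf => by
      rw [act_comm, hM f (mPow_anti R (by simp) hf), map_zero, zero_add,
        resForm_eq_zero (M := N + 1) (by omega) (mPow_anti R (by simp) hf) hN, zero_smul]⟩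

/-- The vector `f₁ ∘ ⋯ ∘ fₙ v_o`. -/
def word (l : List (K R)) : FockSpace R := (l.map fun f => (inU f : UHeis R)).prod • vac R

@[simp] theorem word_nil : word ([] : List (K R)) = vac R := one_smul _ _

@[simp] theorem word_cons (f : K R) (l : List (K R)) : word (f :: l) = act f (word l) := by
  rw [word, List.map_cons, List.prod_cons, mul_smul]; rfl

theorem span_word : Submodule.span R (Set.range (word (R := R))) = ⊤ := by
  rw [eq_top_iff]
  intro v _
  induction v using fock_induction with
  | h0 => exact Submodule.subset_span ⟨[], word_nil⟩
  | hadd v w hv hw => exact Submodule.add_mem _ (hv trivial) (hw trivial)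
  | hr r v hv => exact Submodule.smul_mem _ r (hv trivial)
  | hf f v hv =>
    have : Submodule.span R (Set.range (word (R := R))) ≤
        (Submodule.span R (Set.range (word (R := R)))).comap (act f) := by
      rw [Submodule.span_le]
      rintro _ ⟨l, rfl⟩
      exact Submodule.subset_span ⟨f :: l, word_cons f l⟩
    exact this (hv trivial)

/-- The span of the words of length less than `n` in the family `b`. -/
def wordSpan {ι : Type*} (b : ι → K R) (n : ℕ) : Submodule R (FockSpace R) :=
  Submodule.span R {v | ∃ l : List ι, l.length < n ∧ v = word (l.map b)}

theorem wordSpan_mono {ι : Type*} (b : ι → K R) {m n : ℕ} (h : m ≤ n) :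
    wordSpan b m ≤ wordSpan b n :=
  Submodule.span_mono (by rintro _ ⟨l, hl, rfl⟩; exact ⟨l, by omega, rfl⟩)

theorem act_wordSpan {ι : Type*} (b : ι → K R) (i : ι) {n : ℕ} {v : FockSpace R}
    (hv : v ∈ wordSpan b n) : act (b i) v ∈ wordSpan b (n + 1) := by
  have : wordSpan b n ≤ (wordSpan b (n + 1)).comap (act (b i)) := by
    rw [wordSpan, Submodule.span_le]
    rintro _ ⟨l, hl, rfl⟩
    exact Submodule.subset_span ⟨i :: l, by simpa using hl, by simp⟩
  exact this hv

/-- Move `o` to the right until it meets the vacuum and dies there. Each commutator on the way is a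
scalar that replaces both `o` and one letter, so all remaining words are strictly shorter. -/
theorem act_ringO_word {ι : Type*} (b : ι → K R) {o : K R} (ho : o ∈ ringO R) (l : List ι) :
    act o (word (l.map b)) ∈ wordSpan b l.length := by
  induction l with
  | nil => rw [List.map_nil, word_nil, act_vac ho]; exact Submodule.zero_mem _
  | cons i l ih =>
    rw [List.map_cons, word_cons, act_comm]
    refine Submodule.add_mem _ (act_wordSpan b i ih) (Submodule.smul_mem _ _ ?_)
    exact Submodule.subset_span ⟨l, by simp, rfl⟩

/-- If `K` is spanned by `𝒪`, a family `b`, and elements that map the Fock space into `N`, then the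
Fock space is spanned modulo `N` by the words in `b`. -/
theorem exists_mem_wordSpan_sup {ι : Type*} (N : Submodule R (FockSpace R)) (b : ι → K R)
    (hb : ∀ i, ∀ v ∈ N, act (b i) v ∈ N)
    (hK : ∀ f : K R, ∃ c ∈ Submodule.span R (Set.range b), ∃ a, (∀ v, act a v ∈ N) ∧
      ∃ o ∈ ringO R, f = c + a + o) (v : FockSpace R) : ∃ n, v ∈ wordSpan b n ⊔ N := by
  have hmono : ∀ {m n : ℕ}, m ≤ n → wordSpan b m ⊔ N ≤ wordSpan b n ⊔ N := fun h =>
    sup_le_sup_right (wordSpan_mono b h) N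
  have hbn : ∀ (i : ι) (n : ℕ) (v : FockSpace R), v ∈ wordSpan b n ⊔ N →
      act (b i) v ∈ wordSpan b (n + 1) ⊔ N := by
    intro i n v hv
    obtain ⟨x, hx, y, hy, rfl⟩ := Submodule.mem_sup.1 hv
    rw [map_add]
    exact Submodule.add_mem_sup (act_wordSpan b i hx) (hb i y hy)
  -- Induction on the length of words in arbitrary letters. Decompose the leading letter: the part
  -- in the span of `b` adds one letter to an expression already known, the part `a` lands in `N`,
  -- and the part in `𝒪` shortens the word.
  have hn : ∀ n, wordSpan (id : K R → K R) n ≤ wordSpan b n ⊔ N := by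
    intro n
    induction n with
    | zero =>
      rw [wordSpan, Submodule.span_le]
      rintro _ ⟨l, hl, -⟩
      omega
    | succ n ih =>
      conv_lhs => rw [wordSpan]
      rw [Submodule.span_le]
      rintro _ ⟨l, hl, rfl⟩
      rcases l with _ | ⟨f, l⟩
      · exact Submodule.mem_sup_left (Submodule.subset_span ⟨[], by simp, rfl⟩)
      have hl' : l.length < n := by simpa using hl
      have hw : word (l.map id) ∈ wordSpan b n ⊔ N :=
        ih (Submodule.subset_span ⟨l, hl', rfl⟩)
      obtain ⟨c, hc, a, ha, o, ho, rfl⟩ := hK f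
      rw [List.map_cons, word_cons, id, map_add, map_add, LinearMap.add_apply,
        LinearMap.add_apply]
      refine Submodule.add_mem _ (Submodule.add_mem _ ?_ (Submodule.mem_sup_right (ha _))) ?_
      · clear hl
        induction hc using Submodule.span_induction with
        | mem x hx => obtain ⟨i, rfl⟩ := hx; exact hbn i n _ hw
        | zero => rw [map_zero, LinearMap.zero_apply]; exact Submodule.zero_mem _
        | add x y _ _ hx hy => rw [map_add, LinearMap.add_apply]; exact Submodule.add_mem _ hx hy
        | smul r x _ hx =>
          rw [map_smul, LinearMap.smul_apply]; exact Submodule.smul_mem _ r hx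
      · have := act_ringO_word id ho l
        exact hmono (by omega) (ih (wordSpan_mono _ hl'.le this))
  have hv : v ∈ Submodule.span R (Set.range (word (R := R))) := by rw [span_word]; trivial
  induction hv using Submodule.span_induction with
  | mem x hx =>
    obtain ⟨l, rfl⟩ := hx
    exact ⟨l.length + 1, hn _ (Submodule.subset_span ⟨l, by simp, by simp⟩)⟩
  | zero => exact ⟨0, Submodule.zero_mem _⟩
  | add x y _ _ hx hy =>
    obtain ⟨m, hm⟩ := hx
    obtain ⟨n, hn⟩ := hy
    exact ⟨max m n, Submodule.add_mem _ (hmono (le_max_left _ _) hm) (hmono (le_max_right _ _) hn)⟩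
  | smul r x _ hx =>
    obtain ⟨n, hn⟩ := hx
    exact ⟨n, Submodule.smul_mem _ r hn⟩

/-- The Euler operator `∑ bᵢ oᵢ`. -/
def euler {ι : Type*} (b o : ι → K R) (s : Finset ι) : FockSpace R →ₗ[R] FockSpace R :=
  ∑ i ∈ s, act (b i) ∘ₗ act (o i)

theorem euler_apply {ι : Type*} (b o : ι → K R) (s : Finset ι) (v : FockSpace R) :
    euler b o s v = ∑ i ∈ s, act (b i) (act (o i) v) := by
  simp [euler]

/-- Euler's identity for homogeneous polynomials: each letter `bⱼ` is reproduced once by its dual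
`oⱼ`. The `bᵢ` need not commute with one another, but their commutators are scalars that leave an
`oᵢ` acting on a shorter word. -/
theorem euler_word_sub_mem {ι : Type*} (b o : ι → K R) (ho : ∀ i, o i ∈ ringO R)
    (hob : ∀ i, resForm (o i) (b i) = 1) (hob' : ∀ i j, i ≠ j → resForm (o i) (b j) = 0)
    (s : Finset ι) (l : List ι) (hl : ∀ i ∈ l, i ∈ s) :
    euler b o s (word (l.map b)) - (l.length : R) • word (l.map b) ∈ wordSpan b l.length := by
  classical
  induction l with
  | nil =>
    rw [euler_apply, Finset.sum_eq_zero fun i _ => by rw [List.map_nil, word_nil,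
      act_vac (ho i), map_zero]]
    simp
  | cons j l ih =>
    have ih' := act_wordSpan b j (ih fun i hi => hl i (List.mem_cons_of_mem _ hi))
    have h₁ : ∑ i ∈ s, resForm (b i) (b j) • act (o i) (word (l.map b)) ∈
        wordSpan b (l.length + 1) :=
      Submodule.sum_mem _ fun i _ => Submodule.smul_mem _ _
        (wordSpan_mono b (Nat.le_succ _) (act_ringO_word b (ho i) l))
    have h₂ : euler b o s (act (b j) (word (l.map b))) =
        act (b j) (euler b o s (word (l.map b))) +
          ∑ i ∈ s, resForm (b i) (b j) • act (o i) (word (l.map b)) +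
          act (b j) (word (l.map b)) := by
      rw [euler_apply, euler_apply, map_sum, ← Finset.sum_add_distrib]
      have : ∀ i ∈ s, act (b i) (act (o i) (act (b j) (word (l.map b)))) =
          (act (b j) (act (b i) (act (o i) (word (l.map b)))) +
            resForm (b i) (b j) • act (o i) (word (l.map b))) +
          if i = j then act (b j) (word (l.map b)) else 0 := by
        intro i _
        rw [act_comm (o i), map_add, act_comm (b i) (b j), map_smul]
        congr 1
        split_ifs with h
        · rw [h, hob, one_smul]
        · rw [hob' i j h, zero_smul]
      rw [Finset.sum_congr rfl this, Finset.sum_add_distrib, Finset.sum_ite_eq',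
        if_pos (hl j List.mem_cons_self)]
    rw [List.map_cons, word_cons, h₂, List.length_cons]
    have h₃ := Submodule.add_mem _ ih' h₁
    rw [map_sub, map_smul] at h₃
    convert h₃ using 1
    push_cast
    rw [add_smul, one_smul]
    abel

/-- The index set may be infinite, so the Euler operator is truncated to a finite set containing all
letters that occur. Words of length below `n` have the wrong eigenvalue but already belong to the
error term. -/
theorem exists_smul_sub_euler_mem {ι : Type*} (b o : ι → K R) (ho : ∀ i, o i ∈ ringO R)
    (hob : ∀ i, resForm (o i) (b i) = 1) (hob' : ∀ i j, i ≠ j → resForm (o i) (b j) = 0)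
    (n : ℕ) {v : FockSpace R} (hv : v ∈ wordSpan b (n + 1)) :
    ∃ s₀ : Finset ι, ∀ s, s₀ ⊆ s → (n : R) • v - euler b o s v ∈ wordSpan b n := by
  classical
  rw [wordSpan] at hv
  induction hv using Submodule.span_induction with
  | mem x hx =>
    obtain ⟨l, hl, rfl⟩ := hx
    refine ⟨l.toFinset, fun s hs => ?_⟩
    have h₁ := wordSpan_mono b (Nat.lt_succ_iff.1 hl)
      (euler_word_sub_mem b o ho hob hob' s l fun i hi => hs (List.mem_toFinset.2 hi))
    have h₂ : ((n : R) - (l.length : R)) • word (l.map b) ∈ wordSpan b n := by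
      rcases eq_or_lt_of_le (Nat.lt_succ_iff.1 hl) with h | h
      · rw [h, sub_self, zero_smul]; exact Submodule.zero_mem _
      · exact Submodule.smul_mem _ _ (Submodule.subset_span ⟨l, h, rfl⟩)
    convert Submodule.sub_mem _ h₂ h₁ using 1
    rw [sub_smul]; abel
  | zero => exact ⟨∅, fun s _ => by simp⟩
  | add x y _ _ hx hy =>
    obtain ⟨s₁, h₁⟩ := hx
    obtain ⟨s₂, h₂⟩ := hy
    refine ⟨s₁ ∪ s₂, fun s hs => ?_⟩
    have := Submodule.add_mem _ (h₁ s (Finset.union_subset_left hs))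
      (h₂ s (Finset.union_subset_right hs))
    rw [smul_add, map_add]
    convert this using 1
    abel
  | smul r x _ hx =>
    obtain ⟨s₁, h₁⟩ := hx
    refine ⟨s₁, fun s hs => ?_⟩
    rw [map_smul, smul_comm, ← smul_sub]
    exact Submodule.smul_mem _ r (h₁ s hs)

/-- If the Fock space is spanned modulo `N` by words in `b` and the `oᵢ ∈ 𝒪` are dual to the `bᵢ`,
then a vector killed modulo `N` by all the `oᵢ` is modulo `N` a multiple of the vacuum. -/
theorem exists_sub_smul_vac_mem {ι : Type*} (N : Submodule R (FockSpace R)) (b o : ι → K R)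
    (hb : ∀ i, ∀ v ∈ N, act (b i) v ∈ N)
    (ho : ∀ i, o i ∈ ringO R) (hob : ∀ i, resForm (o i) (b i) = 1)
    (hob' : ∀ i j, i ≠ j → resForm (o i) (b j) = 0) (hN : ∀ i, ∀ v ∈ N, act (o i) v ∈ N)
    {w : FockSpace R} (n : ℕ) (hw : w ∈ wordSpan b n ⊔ N) (how : ∀ i, act (o i) w ∈ N) :
    ∃ r : R, w - r • vac R ∈ N := by
  have hE : ∀ s : Finset ι, ∀ v, (∀ i, act (o i) v ∈ N) → euler b o s v ∈ N := fun s v hv => by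
    rw [euler_apply]
    exact Submodule.sum_mem _ fun i _ => hb i _ (hv i)
  induction n with
  | zero =>
    obtain ⟨x, hx, y, hy, rfl⟩ := Submodule.mem_sup.1 hw
    have : wordSpan b 0 ≤ ⊥ := by
      rw [wordSpan, Submodule.span_le]
      rintro _ ⟨l, hl, -⟩
      omega
    rw [(Submodule.mem_bot R).1 (this hx)]
    exact ⟨0, by simpa using hy⟩
  | succ n ih =>
    obtain ⟨x, hx, y, hy, hxy⟩ := Submodule.mem_sup.1 hw
    -- Words of length below 1 are just the vacuum. Above that, the Euler operator multiplies the
    -- longest words by `n + 1`, yet sends `w` into `N`; so `(n + 1) w` is expressed by shorter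
    -- words modulo `N`, and `n + 1` is invertible over `ℂ`.
    rcases n with _ | n
    · have : wordSpan b 1 ≤ Submodule.span R {vac R} := by
        rw [wordSpan, Submodule.span_le]
        rintro _ ⟨l, hl, rfl⟩
        rw [List.length_eq_zero_iff.1 (by omega : l.length = 0), List.map_nil, word_nil]
        exact Submodule.subset_span rfl
      obtain ⟨r, rfl⟩ := Submodule.mem_span_singleton.1 (this hx)
      exact ⟨r, by rw [← hxy]; simpa using hy⟩
    · refine ih ?_
      obtain ⟨s, hs⟩ := exists_smul_sub_euler_mem b o ho hob hob' (n + 1) hx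
      have h₁ := hs s subset_rfl
      have h₂ := hE s w how
      have h₃ := hE s y fun i => hN i y hy
      have h₄ : ((n + 1 : ℕ) : R) • w ∈ wordSpan b (n + 1) ⊔ N := by
        have : ((n + 1 : ℕ) : R) • w = (((n + 1 : ℕ) : R) • x - euler b o s x) +
            (((n + 1 : ℕ) : R) • y + euler b o s w - euler b o s y) := by
          rw [← hxy, map_add, smul_add]; abel
        rw [this]
        exact Submodule.add_mem_sup h₁
          (N.sub_mem (N.add_mem (N.smul_mem _ hy) h₂) h₃)
      have h₅ := Submodule.smul_mem _ (algebraMap ℂ R ((n + 1 : ℤ) : ℂ)⁻¹) h₄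
      have h₆ := algebraMap_inv_mul_int (R := R) (n := (n + 1 : ℤ)) (by omega)
      rw [smul_smul] at h₅
      push_cast at h₅ h₆
      rwa [h₆, one_smul] at h₅

/-- The vectors killed by `𝒪` are the multiples of the vacuum. -/
theorem exists_eq_smul_vac_of_ringO {w : FockSpace R} (hw : ∀ f ∈ ringO R, act f w = 0) :
    ∃ r : R, w = r • vac R := by
  -- The negative powers of `t` span a complement of `𝒪` in `K`; their duals are `t^(n+1) / (n+1)`.
  -- The submodule `N` is zero here.
  let b : ℕ → K R := fun n => e (-((n : ℤ) + 1))
  let o : ℕ → K R := fun n => algebraMap ℂ R (((n : ℤ) + 1 : ℤ) : ℂ)⁻¹ • e ((n : ℤ) + 1)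
  have ho : ∀ n, o n ∈ ringO R := fun n =>
    (ringO R).smul_mem _ (mPow_anti R (by omega) (e_mem_mPow _))
  have hbo : ∀ i j, resForm (o i) (b j) =
      if i = j then 1 else 0 := by
    intro i j
    have h := algebraMap_inv_mul_int (R := R) (n := (i : ℤ) + 1) (by omega)
    simp only [o, b]
    rw [resForm_smul_left, resForm_e_left, coeff_e]
    by_cases hij : i = j
    · rw [if_pos hij, if_pos (by omega), mul_one, h]
    · rw [if_neg hij, if_neg (by omega), mul_zero, mul_zero]
  obtain ⟨n, hn⟩ := exists_mem_wordSpan_sup (⊥ : Submodule R (FockSpace R)) b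
    (fun i v hv => by rw [(Submodule.mem_bot R).1 hv, map_zero]; exact Submodule.zero_mem _)
    (fun f => by
      obtain ⟨s, hs, hf⟩ := exists_approx f 0
      refine ⟨∑ i ∈ s, coeff f i • e i, Submodule.sum_mem _ fun i hi => Submodule.smul_mem _ _
        (Submodule.subset_span ⟨(-i - 1).toNat, ?_⟩), 0, by simp, _, hf, by abel⟩
      have := hs i hi
      simp only [b]
      congr 1
      omega) w
  obtain ⟨r, hr⟩ := exists_sub_smul_vac_mem ⊥ b o
    (fun i v hv => by rw [(Submodule.mem_bot R).1 hv, map_zero]; exact Submodule.zero_mem _) ho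
    (fun i => by rw [hbo, if_pos rfl]) (fun i j hij => by rw [hbo, if_neg hij])
    (fun i v hv => by rw [(Submodule.mem_bot R).1 hv, map_zero]; exact Submodule.zero_mem _) n hn
    (fun i => by rw [hw _ (ho i)]; exact Submodule.zero_mem _)
  exact ⟨r, sub_eq_zero.1 ((Submodule.mem_bot R).1 hr)⟩

end FockLemmas

/-! ### Lifts of derivations to the Fock space -/

section LiftLemmas

variable {R : Type u} [CommRing R] [Algebra ℂ R]

/-- `x = (D, T)` is a lift: `T` is a first order operator on the Fock space with symbol `D`. -/
structure IsLift (x : Pairs R) : Prop where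
  mem : x.1 ∈ thetaKR R
  map_act : ∀ (f : K R) (v : FockSpace R), x.2 (act f v) = act (x.1 f) v + act f (x.2 v)
  map_smul : ∀ δ, Restricts x.1 δ → ∀ (r : R) (v : FockSpace R),
    x.2 (r • v) = δ r • v + r • x.2 v

theorem complex_smul_fock (z : ℂ) (v : FockSpace R) : z • v = algebraMap ℂ R z • v := rfl

theorem act_complex_smul (z : ℂ) (f : K R) (v : FockSpace R) : act (z • f) v = z • act f v := by
  rw [complex_smul_eq, map_smul]; rfl

theorem act_smul_complex (z : ℂ) (f : K R) (v : FockSpace R) : act f (z • v) = z • act f v := by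
  rw [complex_smul_fock, map_smul]; rfl

instance : SMulCommClass ℂ R (FockSpace R) :=
  ⟨fun z r v => by rw [complex_smul_fock, complex_smul_fock, smul_comm]⟩

/-- The lifts form a Lie algebra. -/
def liftAlgebra : LieSubalgebra ℂ (Pairs R) where
  carrier := {x | IsLift x}
  add_mem' := by
    rintro x y hx hy
    obtain ⟨ε, hε⟩ := exists_restricts hx.mem
    obtain ⟨η, hη⟩ := exists_restricts hy.mem
    refine ⟨(thetaKR R).add_mem hx.mem hy.mem, fun f v => ?_, fun δ hδ r v => ?_⟩
    · change x.2 (act f v) + y.2 (act f v) = act (x.1 f + y.1 f) v + act f (x.2 v + y.2 v)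
      rw [hx.map_act, hy.map_act, map_add, map_add, LinearMap.add_apply]; abel
    · obtain rfl := hδ.unique (hε.add hη)
      change x.2 (r • v) + y.2 (r • v) = (ε r + η r) • v + r • (x.2 v + y.2 v)
      rw [hx.map_smul _ hε, hy.map_smul _ hη, add_smul, smul_add]; abel
  zero_mem' := ⟨(thetaKR R).zero_mem, fun f v => by
      change 0 = act (0 : K R) v + act f 0
      simp, fun δ hδ r v => by
      obtain rfl := hδ.unique (ε := 0) (fun r => by simp)
      change (0 : FockSpace R) = (0 : R) • v + r • 0
      simp⟩
  smul_mem' := by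
    rintro z x hx
    obtain ⟨ε, hε⟩ := exists_restricts hx.mem
    refine ⟨(thetaKR R).smul_mem z hx.mem, fun f v => ?_, fun δ hδ r v => ?_⟩
    · change z • x.2 (act f v) = act (z • x.1 f) v + act f (z • x.2 v)
      rw [hx.map_act, act_complex_smul, act_smul_complex, smul_add]
    · obtain rfl := hδ.unique (hε.complex_smul z)
      change z • x.2 (r • v) = (z • ε r) • v + r • (z • x.2 v)
      rw [hx.map_smul _ hε, smul_add, smul_assoc, smul_comm z r]
  lie_mem' := by
    rintro x y hx hy
    obtain ⟨ε, hε⟩ := exists_restricts hx.mem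
    obtain ⟨η, hη⟩ := exists_restricts hy.mem
    refine ⟨(thetaKR R).lie_mem hx.mem hy.mem, fun f v => ?_, fun δ hδ r v => ?_⟩
    · change x.2 (y.2 (act f v)) - y.2 (x.2 (act f v)) =
        act (⁅x.1, y.1⁆ f) v + act f (x.2 (y.2 v) - y.2 (x.2 v))
      rw [Derivation.commutator_apply, hx.map_act, hy.map_act, map_add, map_add, map_sub,
        map_sub, LinearMap.sub_apply, hx.map_act, hx.map_act, hy.map_act, hy.map_act]
      abel
    · obtain rfl := hδ.unique (hε.lie hη)
      change x.2 (y.2 (r • v)) - y.2 (x.2 (r • v)) = ⁅ε, η⁆ r • v + r • (x.2 (y.2 v) - y.2 (x.2 v))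
      rw [Derivation.commutator_apply, hx.map_smul _ hε, hy.map_smul _ hη, map_add, map_add,
        hx.map_smul _ hε, hx.map_smul _ hε, hy.map_smul _ hη, hy.map_smul _ hη, sub_smul, smul_sub]
      abel

theorem isLift_scalarOp (r : R) : IsLift ((0, scalarOp r) : Pairs R) :=
  ⟨(thetaKR R).zero_mem, fun f v => by
    change r • act f v = act (0 : K R) v + act f (r • v)
    simp, fun δ hδ s v => by
    obtain rfl := hδ.unique (ε := 0) (fun r => by simp)
    change r • s • v = (0 : R) • v + s • r • v
    rw [zero_smul, zero_add, smul_comm]⟩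

/-- A lift of the zero derivation is a scalar. -/
theorem IsLift.exists_scalarOp {x : Pairs R} (hx : IsLift x) (h0 : x.1 = 0) :
    ∃ r : R, x = (0, scalarOp r) := by
  have hact : ∀ f v, x.2 (act f v) = act f (x.2 v) := fun f v => by
    rw [hx.map_act, h0]; simp
  have hsmul : ∀ (r : R) v, x.2 (r • v) = r • x.2 v := fun r v => by
    rw [hx.map_smul 0 (fun r => by rw [h0]; simp)]; simp
  -- The operator commutes with `𝒪`, so the image of the vacuum is again killed by `𝒪`.
  obtain ⟨r, hr⟩ := exists_eq_smul_vac_of_ringO (w := x.2 (vac R)) (fun f hf => by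
    rw [← hact, act_vac hf, map_zero])
  refine ⟨r, Prod.ext h0 (LinearMap.ext fun v => ?_)⟩
  change x.2 v = r • v
  induction v using fock_induction with
  | h0 => exact hr
  | hadd v w hv hw => rw [map_add, hv, hw, smul_add]
  | hr s v hv => rw [hsmul, hv, smul_comm]
  | hf f v hv => rw [hact, hv, _root_.map_smul]

/-! ### Horizontal lifts -/

section Horizontal

variable (δ : Derivation ℂ R R)

/-- A coefficientwise derivation preserves `𝒪` and kills `ℏ - 1`, so it preserves the left ideal
defining the Fock space. A vertical derivation may fail to preserve `𝒪`, which is why its lift takes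
a different construction. -/
theorem derU_smul_vac_eq_zero {u : UHeis R} (hu : u • vac R = 0) :
    derU (horizontalDer_mem δ) (horizontalDer_restricts δ) u • vac R = 0 := by
  rw [← mk_eq_smul_vac] at hu
  replace hu := (Submodule.Quotient.mk_eq_zero _).1 hu
  induction hu using Submodule.span_induction with
  | mem x hx =>
    rcases hx with ⟨f, hf, rfl⟩ | rfl
    · rw [derU_inU]
      exact inU_smul_vac (mapCoeff_mem_mPow δ hf)
    · rw [map_sub, derU_hbar, derU_one, sub_zero, zero_smul]
  | zero => rw [map_zero, zero_smul]
  | add x y _ _ hx hy =>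
    rw [map_add, add_smul, hx, hy, add_zero]
  | smul a x hx' hx =>
    have hx'' : x • vac R = 0 := by
      rw [← mk_eq_smul_vac]
      exact (Submodule.Quotient.mk_eq_zero _).2 hx'
    rw [smul_eq_mul, derU_mul, add_smul, mul_smul, mul_smul, hx, hx'', smul_zero, smul_zero,
      add_zero]

/-- The map `u ↦ u v_o`. -/
def toFock : UHeis R →+ FockSpace R :=
  (LinearMap.toSpanSingleton (UHeis R) _ (vac R)).toAddMonoidHom

theorem toFock_surjective : Function.Surjective (toFock (R := R)) := fun v => by
  obtain ⟨u, rfl⟩ := exists_eq_smul_vac v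
  exact ⟨u, rfl⟩

/-- The additive operator `u v_o ↦ δ(u) v_o`. -/
def horizontalAdd : FockSpace R →+ FockSpace R :=
  AddMonoidHom.liftOfSurjective toFock toFock_surjective
    ⟨toFock.comp (derU (horizontalDer_mem δ) (horizontalDer_restricts δ)), fun _ hu =>
      derU_smul_vac_eq_zero δ hu⟩

theorem horizontalAdd_smul_vac (u : UHeis R) : horizontalAdd δ (u • vac R) =
    derU (horizontalDer_mem δ) (horizontalDer_restricts δ) u • vac R :=
  AddMonoidHom.liftOfRightInverse_comp_apply toFock _ _ _ u

theorem horizontalAdd_smul (r : R) (v : FockSpace R) :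
    horizontalAdd δ (r • v) = δ r • v + r • horizontalAdd δ v := by
  obtain ⟨u, rfl⟩ := exists_eq_smul_vac v
  rw [← smul_assoc, horizontalAdd_smul_vac, horizontalAdd_smul_vac, derU_smul, add_smul,
    smul_assoc, smul_assoc]

/-- The coefficientwise action of `δ` on the Fock space. -/
def horizontalOp : Module.End ℂ (FockSpace R) where
  toFun := horizontalAdd δ
  map_add' := map_add _
  map_smul' z v := by
    rw [complex_smul_fock, horizontalAdd_smul, Derivation.map_algebraMap, zero_smul, zero_add]
    rfl

theorem isLift_horizontal : IsLift ((horizontalDer δ, horizontalOp δ) : Pairs R) := by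
  refine ⟨horizontalDer_mem δ, fun f v => ?_, fun ε hε r v => ?_⟩
  · obtain ⟨u, rfl⟩ := exists_eq_smul_vac v
    change horizontalAdd δ (inU f • u • vac R) =
      inU (horizontalDer δ f) • u • vac R + inU f • horizontalAdd δ (u • vac R)
    rw [← mul_smul, horizontalAdd_smul_vac, horizontalAdd_smul_vac, derU_mul, derU_inU, add_smul,
      mul_smul, mul_smul, add_comm]
  · obtain rfl := hε.unique (horizontalDer_restricts δ)
    exact horizontalAdd_smul _ r v

theorem derU_prod_e (l : List ℤ) : derU (horizontalDer_mem δ) (horizontalDer_restricts δ)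
    ((l.map fun k => (inU (e k) : UHeis R)).prod) = 0 := by
  induction l with
  | nil => exact derU_one _ _
  | cons k l ih =>
    rw [List.map_cons, List.prod_cons, derU_mul, ih, derU_inU, (horizontalDer_isHorizontal δ).2,
      inU_zero, zero_mul, mul_zero, add_zero]

theorem horizontalOp_isCoefficientwise : IsCoefficientwise δ (horizontalOp δ) := fun r l => by
  change horizontalAdd δ _ = _
  rw [horizontalAdd_smul, horizontalAdd_smul_vac, derU_prod_e, zero_smul, smul_zero, add_zero]

theorem mem_wordSpan_e (v : FockSpace R) : ∃ n, v ∈ wordSpan (e (R := R)) n := by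
  obtain ⟨n, hn⟩ := exists_mem_wordSpan_sup (⊥ : Submodule R (FockSpace R)) e
    (fun i v hv => by rw [(Submodule.mem_bot R).1 hv, map_zero]; exact Submodule.zero_mem _)
    (fun f => by
      obtain ⟨s, -, hf⟩ := exists_approx f 0
      exact ⟨∑ i ∈ s, coeff f i • e i, Submodule.sum_mem _ fun i hi => Submodule.smul_mem _ _
        (Submodule.subset_span ⟨i, rfl⟩), 0, by simp, _, hf, by abel⟩) v
  exact ⟨n, by rwa [sup_bot_eq] at hn⟩

theorem IsCoefficientwise.unique {δ : Derivation ℂ R R} {S T : Module.End ℂ (FockSpace R)}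
    (hS : IsCoefficientwise δ S) (hT : IsCoefficientwise δ T) : S = T := by
  refine LinearMap.ext fun v => ?_
  obtain ⟨n, hn⟩ := mem_wordSpan_e v
  rw [← one_smul R v]
  -- The operators are only `ℂ`-linear, so a scalar from `R` has to be carried through the induction
  -- on the span.
  generalize (1 : R) = r
  rw [wordSpan] at hn
  induction hn using Submodule.span_induction generalizing r with
  | mem x hx =>
    obtain ⟨l, -, rfl⟩ := hx
    have := (hS r l).trans (hT r l).symm
    rwa [show word (l.map e) = (l.map fun k => (inU (e k) : UHeis R)).prod • vac R by
      rw [word, List.map_map]; rfl]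
  | zero => rw [smul_zero, map_zero, map_zero]
  | add x y _ _ hx hy => rw [smul_add, map_add, map_add, hx, hy]
  | smul s x _ hx => rw [smul_smul, hx]

end Horizontal

/-! ### Vertical lifts -/

section Vertical

/-- The coefficient of `:e_{-i} ∘ e_{-j}:` in `τ̂(D)`. -/
def sugCoeff (D : Derivation ℂ (K R) (K R)) (i j : ℤ) : R :=
  algebraMap ℂ R (1 / (2 * (i : ℂ) * (j : ℂ))) * resForm (D (e i)) (e j)

/-- The term of `τ̂(D)` with index `(i, j)`, as an operator. -/
def sugTerm (D : Derivation ℂ (K R) (K R)) (i j : ℤ) : FockSpace R →ₗ[R] FockSpace R where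
  toFun v := sugCoeff D i j • ((normOrd (-i) (-j) : UHeis R) • v)
  map_add' v w := by rw [smul_add, smul_add]
  map_smul' r v := by rw [smul_comm _ r v, smul_comm, RingHom.id_apply]

theorem sugTerm_apply (D : Derivation ℂ (K R) (K R)) (i j : ℤ) (v : FockSpace R) :
    sugTerm D i j v = sugCoeff D i j • ((normOrd (-i) (-j) : UHeis R) • v) := rfl

theorem sugCoeff_zero_left (D : Derivation ℂ (K R) (K R)) (j : ℤ) : sugCoeff D 0 j = 0 := by
  simp [sugCoeff]

theorem sugCoeff_zero_right (D : Derivation ℂ (K R) (K R)) (i : ℤ) : sugCoeff D i 0 = 0 := by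
  simp [sugCoeff]

/-- Normal ordering lets the factor of higher index act first, so it is enough that one of the two
indices is large. -/
theorem normOrd_smul_eq_zero {N : ℕ} {v : FockSpace R} (hv : ∀ f ∈ mPow R (N : ℤ), act f v = 0)
    {i j : ℤ} (h : (N : ℤ) ≤ i ∨ (N : ℤ) ≤ j) : (normOrd i j : UHeis R) • v = 0 := by
  have he : ∀ k : ℤ, (N : ℤ) ≤ k → (inU (e k) : UHeis R) • v = 0 := fun k hk =>
    hv _ (mPow_anti R hk (e_mem_mPow k))
  rw [normOrd]
  split_ifs with hij
  · rw [mul_smul, he j (by omega), smul_zero]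
  · rw [mul_smul, he i (by omega), smul_zero]

/-- The ordering affects the product by a central term only, so the commutator with `f` has the same
form in both cases. -/
theorem normOrd_act (i j : ℤ) (f : K R) (v : FockSpace R) :
    (normOrd i j : UHeis R) • act f v = act f ((normOrd i j : UHeis R) • v) +
      (resForm (e j) f • act (e i) v + resForm (e i) f • act (e j) v) := by
  rw [normOrd]
  split_ifs with hij
  · rw [mul_smul, mul_smul]
    simp only [← act_apply]
    rw [act_comm (e j), map_add, act_comm (e i) f, map_smul]; abel
  · rw [mul_smul, mul_smul]
    simp only [← act_apply]
    rw [act_comm (e i), map_add, act_comm (e j) f, map_smul]; abel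

variable {D : Derivation ℂ (K R) (K R)}

/-- Invariance of the residue form under a vertical `D`, combined with its antisymmetry, makes `(D
e_i, e_j)` symmetric. -/
theorem sugCoeff_symm (hD : IsVertical D) (i j : ℤ) : sugCoeff D i j = sugCoeff D j i := by
  have h := hD.resForm_add (e i) (e j)
  have h' := resForm_swap (e i) (D (e j))
  rw [sugCoeff, sugCoeff, mul_right_comm (2 : ℂ)]
  congr 1
  linear_combination h - h'

/-- This is the normalization behind the factor `1/(2ij)`: commuting with `e_i` produces the term
`-i` times the coefficient twice, which together give the coefficient of `e_{-j}` in `D(e_i)`. -/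
theorem sugCoeff_mul (D : Derivation ℂ (K R) (K R)) {i j : ℤ} (hi : i ≠ 0) (hj : j ≠ 0) :
    2 * (-(i : R) * sugCoeff D i j) = coeff (D (e i)) (-j) := by
  have h : algebraMap ℂ R (1 / (2 * (i : ℂ) * (j : ℂ))) * (2 * (i : R) * (j : R)) = 1 := by
    have := algebraMap_inv_mul (R := R) (z := 2 * (i : ℂ) * (j : ℂ)) (by
      have h₁ : (i : ℂ) ≠ 0 := by exact_mod_cast hi
      have h₂ : (j : ℂ) ≠ 0 := by exact_mod_cast hj
      exact mul_ne_zero (mul_ne_zero two_ne_zero h₁) h₂)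
    rw [one_div]
    rwa [map_mul _ (2 * (i : ℂ)), map_mul _ (2 : ℂ), map_intCast, map_intCast, map_ofNat] at this
  rw [sugCoeff, resForm_e_right]
  linear_combination coeff (D (e i)) (-j) * h

theorem exists_sugCoeff_eq_zero (D : Derivation ℂ (K R) (K R)) :
    ∃ C : ℤ, ∀ i j, C < i + j → sugCoeff D i j = 0 := by
  obtain ⟨M, hM⟩ := exists_mem_mPow (D (e 1))
  -- `D(e_i) = i t^(i-1) D(t)` has order at least `i - 1 + M`, and a pairing of elements whose
  -- orders have positive sum is zero.
  refine ⟨1 - M, fun i j h => ?_⟩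
  rw [sugCoeff, derivation_e_one, resForm_eq_zero (M := i - 1 + M) (by omega) _ (e_mem_mPow j),
    mul_zero]
  exact mul_mem_mPow ((mPow R _).smul_mem _ (e_mem_mPow _)) hM

/-- A nonzero term has `i + j` bounded above by the order of `D`, and `i`, `j` each bounded below
because otherwise `e_{-i}` or `e_{-j}` kills `v`. These bounds confine both indices to a box. -/
theorem exists_sugTerm_eq_zero (D : Derivation ℂ (K R) (K R)) (v : FockSpace R) :
    ∃ B : ℕ, ∀ i j, sugTerm D i j v ≠ 0 →
      i ∈ Finset.Icc (-(B : ℤ)) B ∧ j ∈ Finset.Icc (-(B : ℤ)) B := by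
  obtain ⟨C, hC⟩ := exists_sugCoeff_eq_zero D
  obtain ⟨N, hN⟩ := exists_act_eq_zero v
  refine ⟨N + C.natAbs, fun i j h => ?_⟩
  have h₁ : ¬ C < i + j := fun h' => h (by rw [sugTerm_apply, hC i j h', zero_smul])
  have h₂ : ¬ ((N : ℤ) ≤ -i ∨ (N : ℤ) ≤ -j) := fun h' => h (by
    rw [sugTerm_apply, normOrd_smul_eq_zero hN h', smul_zero])
  rw [Finset.mem_Icc, Finset.mem_Icc]
  omega

theorem finite_support_sugTerm (D : Derivation ℂ (K R) (K R)) (v : FockSpace R) :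
    (Function.support fun p : {i : ℤ // i ≠ 0} × {j : ℤ // j ≠ 0} =>
      sugTerm D p.1.1 p.2.1 v).Finite := by
  obtain ⟨B, hB⟩ := exists_sugTerm_eq_zero D v
  refine Set.Finite.subset (((Finset.Icc (-(B : ℤ)) B).subtype (· ≠ 0) ×ˢ
    (Finset.Icc (-(B : ℤ)) B).subtype (· ≠ 0)).finite_toSet) fun p hp => ?_
  have := hB _ _ hp
  simpa using this

/-- Any sufficiently large box computes the sum. It may include the index 0, where the coefficient
vanishes by the convention `1 / 0 = 0`. -/
theorem exists_finsum_sugTerm (D : Derivation ℂ (K R) (K R)) (v : FockSpace R) :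
    ∃ B₀ : ℕ, ∀ B : ℕ, B₀ ≤ B →
    ∑ᶠ p : {i : ℤ // i ≠ 0} × {j : ℤ // j ≠ 0}, sugTerm D p.1.1 p.2.1 v =
      ∑ i ∈ Finset.Icc (-(B : ℤ)) B, ∑ j ∈ Finset.Icc (-(B : ℤ)) B, sugTerm D i j v := by
  obtain ⟨B₀, hB₀⟩ := exists_sugTerm_eq_zero D v
  refine ⟨B₀, fun B hB => ?_⟩
  rw [finsum_eq_sum_of_support_subset (s := (Finset.Icc (-(B : ℤ)) B).subtype (· ≠ 0) ×ˢ
    (Finset.Icc (-(B : ℤ)) B).subtype (· ≠ 0)), Finset.sum_product]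
  · have hj : ∀ i : ℤ, ∑ j ∈ (Finset.Icc (-(B : ℤ)) B).subtype (· ≠ 0), sugTerm D i j.1 v =
        ∑ j ∈ Finset.Icc (-(B : ℤ)) B, sugTerm D i j v := fun i => by
      rw [Finset.sum_subtype_eq_sum_filter (fun j => sugTerm D i j v), Finset.sum_filter_of_ne]
      rintro j - h rfl
      exact h (by rw [sugTerm_apply, sugCoeff_zero_right, zero_smul])
    simp only [hj]
    rw [Finset.sum_subtype_eq_sum_filter
      (fun i => ∑ j ∈ Finset.Icc (-(B : ℤ)) B, sugTerm D i j v), Finset.sum_filter_of_ne]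
    rintro i - h rfl
    exact h (Finset.sum_eq_zero fun j _ => by rw [sugTerm_apply, sugCoeff_zero_left, zero_smul])
  · intro p hp
    have := hB₀ _ _ hp
    simp only [Finset.mem_Icc] at this
    simp only [Finset.coe_product, Set.mem_prod, Finset.mem_coe, Finset.mem_subtype,
      Finset.mem_Icc]
    omega

/-- The operator `τ̂(D)` on the Fock space. -/
def sugOp (D : Derivation ℂ (K R) (K R)) : FockSpace R →ₗ[R] FockSpace R where
  toFun v := ∑ᶠ p : {i : ℤ // i ≠ 0} × {j : ℤ // j ≠ 0}, sugTerm D p.1.1 p.2.1 v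
  map_add' v w := by
    rw [← finsum_add_distrib (finite_support_sugTerm D v) (finite_support_sugTerm D w)]
    exact finsum_congr fun p => map_add _ _ _
  map_smul' r v := by
    rw [RingHom.id_apply, smul_finsum' r (finite_support_sugTerm D v)]
    exact finsum_congr fun p => map_smul _ _ _

/-- `τ̂(D)` as a complex linear operator. -/
def sugEnd (D : Derivation ℂ (K R) (K R)) : Module.End ℂ (FockSpace R) where
  toFun := sugOp D
  map_add' := map_add _
  map_smul' z v := by rw [complex_smul_fock, map_smul]; rfl

theorem sugEnd_isSugawara (D : Derivation ℂ (K R) (K R)) : IsSugawara D (sugEnd D) := fun _ => rfl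

theorem IsSugawara.eq_sugEnd {T : Module.End ℂ (FockSpace R)} (hT : IsSugawara D T) :
    T = sugEnd D := LinearMap.ext hT

/-- `(e_{-i}, e_k)` vanishes unless `i = k`, so the commutator with `e_k` keeps just one row and one
column of the double sum. By symmetry of the coefficients these agree, and each is half of `D(e_k)`.
-/
theorem sugOp_act_e (hD : IsVertical D) (k : ℤ) (v : FockSpace R) :
    sugOp D (act (e k) v) = act (D (e k)) v + act (e k) (sugOp D v) := by
  by_cases hk : k = 0
  · rw [hk, e_zero]
    simp only [act_one]
    simp
  obtain ⟨B₁, h₁⟩ := exists_finsum_sugTerm D v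
  obtain ⟨B₂, h₂⟩ := exists_finsum_sugTerm D (act (e k) v)
  obtain ⟨N, hN⟩ := exists_act_eq_zero v
  obtain ⟨M, hM⟩ := exists_nat_mem_mPow (D (e k))
  -- One box that computes both Sugawara sums, contains the index `k` and the poles of `D(e_k)`, and
  -- leaves out only a tail of `D(e_k)` that kills `v`.
  obtain ⟨B, hB₁, hB₂, hB₃, hB₄, hB₅⟩ :
      ∃ B : ℕ, B₁ ≤ B ∧ B₂ ≤ B ∧ N ≤ B ∧ M ≤ B ∧ k.natAbs ≤ B :=
    ⟨B₁ + B₂ + N + M + k.natAbs, by omega, by omega, by omega, by omega, by omega⟩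
  have hkB : k ∈ Finset.Icc (-(B : ℤ)) B := by rw [Finset.mem_Icc]; omega
  have hv : sugOp D v = _ := h₁ B hB₁
  have hv' : sugOp D (act (e k) v) = _ := h₂ B hB₂
  have hterm : ∀ i j, sugTerm D i j (act (e k) v) = act (e k) (sugTerm D i j v) +
      ((if k = j then (-(k : R) * sugCoeff D k i) • act (e (-i)) v else 0) +
        if k = i then (-(k : R) * sugCoeff D k j) • act (e (-j)) v else 0) := by
    intro i j
    rw [sugTerm_apply, sugTerm_apply, normOrd_act, smul_add, smul_add,
      (act (e k)).map_smul (sugCoeff D i j), smul_smul, smul_smul, resForm_e_left, resForm_e_left, coeff_e, coeff_e,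
      neg_neg, neg_neg]
    congr 2
    · by_cases h : k = j
      · rw [if_pos h.symm, if_pos h, ← h, sugCoeff_symm hD i k]
        congr 1; push_cast; ring
      · rw [if_neg (Ne.symm h), if_neg h, mul_zero, mul_zero, zero_smul]
    · by_cases h : k = i
      · rw [if_pos h.symm, if_pos h, ← h]
        congr 1; push_cast; ring
      · rw [if_neg (Ne.symm h), if_neg h, mul_zero, mul_zero, zero_smul]
  have hsum : act (D (e k)) v =
      ∑ j ∈ Finset.Icc (-(B : ℤ)) B, (2 * (-(k : R) * sugCoeff D k j)) • act (e (-j)) v := by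
    have h := sub_sum_coeff_mem (mPow_anti R (by omega) hM : D (e k) ∈ mPow R (-(B : ℤ)))
    have h' := hN _ (mPow_anti R (by omega) h)
    rw [map_sub, LinearMap.sub_apply, sub_eq_zero] at h'
    rw [h', map_sum, LinearMap.sum_apply]
    refine Finset.sum_congr rfl fun j _ => ?_
    rw [map_smul, LinearMap.smul_apply]
    by_cases hj : j = 0
    · rw [hj, neg_zero, e_zero, act_one, smul_zero, smul_zero]
    · rw [sugCoeff_mul D hk hj]
  rw [hv', hsum, hv]
  simp only [hterm, Finset.sum_add_distrib]
  simp only [Finset.sum_ite_eq, if_pos hkB]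
  rw [Finset.sum_comm (f := fun i j => if k = i then _ else _)]
  simp only [Finset.sum_ite_eq, if_pos hkB, map_sum]
  rw [add_comm]
  congr 1
  rw [← Finset.sum_add_distrib]
  exact Finset.sum_congr rfl fun j _ => by rw [two_mul, add_smul]

theorem isLift_vertical (hD : IsVertical D) : IsLift ((D, sugEnd D) : Pairs R) := by
  refine ⟨mem_thetaKR_of_isVertical hD, fun f v => ?_, fun δ hδ r v => ?_⟩
  · change sugOp D (act f v) = act (D f) v + act f (sugOp D v)
    obtain ⟨N₁, h₁⟩ := exists_act_eq_zero v
    obtain ⟨N₂, h₂⟩ := exists_act_eq_zero (sugOp D v)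
    obtain ⟨M, hM⟩ := hD.1 N₁
    -- The relation is known for monomials. Truncate `f` so far out that the tail kills `v` and
    -- `τ̂(D) v`, and the image of the tail under the continuous `D` kills `v`.
    obtain ⟨s, -, hs⟩ := exists_approx f (max M (max N₁ N₂))
    set p : K R := ∑ i ∈ s, coeff f i • e i with hp
    have e₁ : act f v = act p v := by
      rw [← sub_eq_zero, ← LinearMap.sub_apply, ← map_sub]
      exact h₁ _ (mPow_anti R (by simp) hs)
    have e₂ : act f (sugOp D v) = act p (sugOp D v) := by
      rw [← sub_eq_zero, ← LinearMap.sub_apply, ← map_sub]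
      exact h₂ _ (mPow_anti R (by simp) hs)
    have e₃ : act (D f) v = act (D p) v := by
      rw [← sub_eq_zero, ← LinearMap.sub_apply, ← map_sub, ← map_sub]
      exact h₁ _ (hM _ (mPow_anti R (by simp) hs))
    rw [e₁, e₂, e₃, hp]
    simp only [map_sum, LinearMap.sum_apply, hD.map_smul, map_smul, LinearMap.smul_apply]
    rw [← Finset.sum_add_distrib]
    exact Finset.sum_congr rfl fun i _ => by rw [sugOp_act_e hD, smul_add]
  · obtain rfl := hδ.unique hD.restricts
    change sugOp D (r • v) = (0 : R) • v + r • sugOp D v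
    rw [map_smul, zero_smul, zero_add]

end Vertical

/-- `θ̂_{K,R}` consists of all lifts of members of `θ_{K,R}`. -/
theorem hatThetaKR_eq : hatThetaKR R = liftAlgebra := by
  refine le_antisymm (LieSubalgebra.lieSpan_le.2 ?_) fun x hx => ?_
  · rintro ⟨D, T⟩ ((⟨hD, hT⟩ | ⟨hD, δ, hδ, hT⟩) | ⟨r, h⟩)
    · have h : T = sugEnd D := IsSugawara.eq_sugEnd hT
      rw [h]
      exact isLift_vertical hD
    · have h : T = horizontalOp δ := hT.unique (horizontalOp_isCoefficientwise δ)
      have h' : D = horizontalDer δ := hD.eq_horizontalDer hδ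
      rw [h, h']
      exact isLift_horizontal δ
    · rw [h]
      exact isLift_scalarOp r
  · obtain ⟨δ, hδ⟩ := exists_restricts hx.mem
    have hE := isVertical_sub_horizontalDer hx.mem hδ
    have h₁ : ((x.1 - horizontalDer δ, sugEnd (x.1 - horizontalDer δ)) : Pairs R) ∈ hatThetaKR R :=
      LieSubalgebra.subset_lieSpan (Or.inl (Or.inl ⟨hE, sugEnd_isSugawara _⟩))
    have h₂ : ((horizontalDer δ, horizontalOp δ) : Pairs R) ∈ hatThetaKR R :=
      LieSubalgebra.subset_lieSpan (Or.inl (Or.inr ⟨horizontalDer_isHorizontal δ, δ,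
        horizontalDer_restricts δ, horizontalOp_isCoefficientwise δ⟩))
    -- Subtracting the Sugawara lift of the vertical part and the coefficientwise lift of the
    -- horizontal part leaves a lift of zero, which is a scalar.
    obtain ⟨r, hr⟩ := IsLift.exists_scalarOp (liftAlgebra.sub_mem hx
      (liftAlgebra.add_mem (isLift_vertical hE) (isLift_horizontal δ)))
      (by simp)
    have h₃ : ((0, scalarOp r) : Pairs R) ∈ hatThetaKR R :=
      LieSubalgebra.subset_lieSpan (Or.inr ⟨r, rfl⟩)
    rw [← sub_add_cancel x _, hr]
    exact add_mem h₃ (add_mem h₁ h₂)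

theorem exists_isLift {D : Derivation ℂ (K R) (K R)} (hD : D ∈ thetaKR R) :
    ∃ T, IsLift ((D, T) : Pairs R) := by
  obtain ⟨δ, hδ⟩ := exists_restricts hD
  have h := liftAlgebra.add_mem (isLift_vertical (isVertical_sub_horizontalDer hD hδ))
    (isLift_horizontal δ)
  rw [Prod.mk_add_mk, sub_add_cancel] at h
  exact ⟨_, h⟩

theorem mem_hatThetaKAR {A : Subalgebra R (K R)} {x : Pairs R} :
    x ∈ hatThetaKAR A ↔ IsLift x ∧ x.1 ∈ thetaKAR A := by
  rw [hatThetaKAR, hatThetaKR_eq]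
  exact Iff.rfl

theorem act_mem_AFock {A : Subalgebra R (K R)} {a : K R} (ha : a ∈ A) (v : FockSpace R) :
    act a v ∈ AFock A := Submodule.subset_span ⟨a, ha, v, rfl⟩

/-- The lifts of derivations preserving `A` preserve `A ∘ 𝔽(K, 𝒪)`. -/
theorem IsLift.map_AFock {A : Subalgebra R (K R)} {x : Pairs R} (hx : IsLift x)
    (hA : ∀ a ∈ A, x.1 a ∈ A) {v : FockSpace R} (hv : v ∈ AFock A) : x.2 v ∈ AFock A := by
  obtain ⟨δ, hδ⟩ := exists_restricts hx.mem
  induction hv using Submodule.span_induction with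
  | mem w hw =>
    obtain ⟨a, ha, v, rfl⟩ := hw
    have := hx.map_act a v
    rw [act_apply] at this
    rw [this]
    exact add_mem (act_mem_AFock (hA a ha) _) (act_mem_AFock ha _)
  | zero => rw [map_zero]; exact zero_mem _
  | add v w _ _ hv hw => rw [map_add]; exact add_mem hv hw
  | smul r v hv' hv =>
    rw [hx.map_smul δ hδ]
    exact add_mem (Submodule.smul_mem _ _ hv') (Submodule.smul_mem _ _ hv)

end LiftLemmas

/-! ### Subalgebras of Fock type: splitting and coinvariants -/

section Splitting

variable {R : Type u} [CommRing R] [Algebra ℂ R]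

/-- A linear splitting of `K` into parts in `A`, in `𝒪`, and in a complement of `A + 𝒪`. -/
structure Splitting (A : Subalgebra R (K R)) where
  α : K R →ₗ[R] K R
  β : K R →ₗ[R] K R
  γ : K R →ₗ[R] K R
  sum : ∀ x, α x + β x + γ x = x
  α_mem : ∀ x, α x ∈ A
  β_mem : ∀ x, β x ∈ ringO R
  γ_of_mem : ∀ a ∈ A, γ a = 0
  β_of_mem : ∀ a ∈ A, ∃ r, β a = algebraMap R (K R) r
  α_ringO : ∀ o ∈ ringO R, α o = 0
  γ_ringO : ∀ o ∈ ringO R, γ o = 0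
  bound : ℕ
  γ_mem : ∀ x, γ x ∈ mPow R (-(bound : ℤ))

/-- Freeness of `K/(A + 𝒪)` gives a linear section, and finiteness a common bound for the poles of
its values. Within `A + 𝒪` the component in `A` is ambiguous by `A ∩ 𝒪 = R`; requiring its constant
coefficient to be zero makes it unique. -/
theorem IsFockType.exists_splitting {A : Subalgebra R (K R)} (hA : IsFockType A) :
    Nonempty (Splitting A) := by
  let S := Subalgebra.toSubmodule A ⊔ ringO R
  have := hA.free_quotient
  have := hA.finite_quotient
  obtain ⟨s, hs⟩ := Module.projective_lifting_property S.mkQ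
    (LinearMap.id : (K R ⧸ S) →ₗ[R] (K R ⧸ S)) S.mkQ_surjective
  have hs' : ∀ q, S.mkQ (s q) = q := fun q => LinearMap.congr_fun hs q
  let γ : K R →ₗ[R] K R := s ∘ₗ S.mkQ
  have hγS : ∀ x ∈ S, γ x = 0 := fun x hx => by
    change s (S.mkQ x) = 0
    rw [Submodule.mkQ_apply, (Submodule.Quotient.mk_eq_zero S).2 hx, map_zero]
  let p : K R →ₗ[R] S := (LinearMap.id - γ).codRestrict S fun x => by
    rw [← Submodule.Quotient.mk_eq_zero, ← Submodule.mkQ_apply, LinearMap.sub_apply, map_sub,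
      sub_eq_zero]
    exact (hs' _).symm
  let c : K R →ₗ[R] K R := Algebra.linearMap R (K R) ∘ₗ coeffLin 0
  have hc : ∀ r, c (algebraMap R (K R) r) = algebraMap R (K R) r := fun r => by
    change algebraMap R (K R) (coeff (algebraMap R (K R) r) 0) = _
    rw [coeff_algebraMap_zero]
  -- Two partial maps, removal of the constant term on `A` and zero on `𝒪`. They agree on `A ∩ 𝒪 =
  -- R`, so they glue to the projection of `A + 𝒪`.
  let f : K R →ₗ.[R] K R := ⟨Subalgebra.toSubmodule A, (LinearMap.id - c) ∘ₗ Submodule.subtype _⟩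
  let g : K R →ₗ.[R] K R := ⟨ringO R, 0⟩
  have hfg : ∀ (x : f.domain) (y : g.domain), (x : K R) = y → f x = g y := by
    rintro ⟨x, hx⟩ ⟨y, hy⟩ h
    obtain rfl : x = y := h
    obtain ⟨r, rfl⟩ := hA.inter_ringO x hx hy
    exact sub_eq_zero.2 (hc r).symm
  let q : S →ₗ[R] K R := (f.sup g hfg).toFun
  have hq : ∀ (a : K R) (ha : a ∈ A) (o : K R) (ho : o ∈ ringO R) (h : a + o ∈ S),
      q ⟨a + o, h⟩ = a - c a := by
    intro a ha o ho h
    exact (LinearPMap.sup_apply hfg ⟨a, ha⟩ ⟨o, ho⟩ ⟨a + o, h⟩ rfl).trans (add_zero _)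
  have hq' : ∀ x : S, q x ∈ A ∧ (x : K R) - q x ∈ ringO R := by
    rintro ⟨x, hx⟩
    obtain ⟨a, ha, o, ho, rfl⟩ := Submodule.mem_sup.1 hx
    rw [hq a ha o ho]
    refine ⟨A.sub_mem ha (A.algebraMap_mem _), ?_⟩
    have : a + o - (a - c a) = o + c a := by abel
    change a + o - (a - c a) ∈ _
    rw [this]
    exact (ringO R).add_mem ho (algebraMap_mem_ringO _)
  obtain ⟨n, t, ht⟩ := Module.Finite.exists_fin (R := R) (M := K R ⧸ S)
  choose b hb using fun i => exists_nat_mem_mPow (s (t i))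
  have hb' : ∀ y, s y ∈ mPow R (-((Finset.univ.sup b : ℕ) : ℤ)) := by
    have : (⊤ : Submodule R (K R ⧸ S)) ≤ (mPow R (-((Finset.univ.sup b : ℕ) : ℤ))).comap s := by
      rw [← ht, Submodule.span_le]
      rintro _ ⟨i, rfl⟩
      exact mPow_anti R (neg_le_neg (by exact_mod_cast Finset.le_sup (Finset.mem_univ i))) (hb i)
    exact fun y => this trivial
  have hp : ∀ x (hx : x ∈ S), p x = ⟨x, hx⟩ := fun x hx => Subtype.ext (by
    change x - γ x = x
    rw [hγS x hx, sub_zero])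
  refine ⟨⟨q ∘ₗ p, LinearMap.id - γ - q ∘ₗ p, γ, fun x => ?_, fun x => (hq' _).1,
    fun x => (hq' (p x)).2, fun a ha => hγS a (Submodule.mem_sup_left ha), fun a ha => ?_,
    fun o ho => ?_, fun o ho => hγS o (Submodule.mem_sup_right ho), _, fun x => hb' _⟩⟩
  · simp
  · have haS : a ∈ S := Submodule.mem_sup_left ha
    refine ⟨coeff a 0, ?_⟩
    have h := hq a ha 0 (ringO R).zero_mem (by rwa [add_zero])
    simp only [add_zero] at h
    rw [LinearMap.sub_apply, LinearMap.sub_apply, hγS a haS, LinearMap.comp_apply, hp a haS, h]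
    change a - 0 - (a - c a) = c a
    abel
  · have hoS : o ∈ S := Submodule.mem_sup_right ho
    have h := hq 0 A.zero_mem o ho (by rwa [zero_add])
    simp only [zero_add, map_zero, sub_zero] at h
    rw [LinearMap.comp_apply, hp o hoS, h]

variable {A : Subalgebra R (K R)}

theorem Splitting.α_of_mem {R : Type u} [CommRing R] {A : Subalgebra R (K R)}
    (P : Splitting A) {a : K R} (ha : a ∈ A) :
    ∃ r, P.α a = a - algebraMap R (K R) r := by
  obtain ⟨r, hr⟩ := P.β_of_mem a ha
  refine ⟨r, ?_⟩
  have := P.sum a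
  rw [hr, P.γ_of_mem a ha] at this
  linear_combination this

/-- Every element of `K` is modulo `𝒪` orthogonal to `A`. -/
theorem Splitting.exists_sub_perp (P : Splitting A) (f : K R) :
    ∃ o ∈ ringO R, ∀ a ∈ A, resForm (f - o) a = 0 := by
  -- The form `x ↦ (f, α x)` vanishes on `𝒪`, so some `o ∈ 𝒪` represents it. On `A` it agrees with
  -- `(f, -)`, as `α` changes an element of `A` by a constant only and constants lie in the radical.
  obtain ⟨o, ho, h⟩ := exists_resForm_eq (resLin R f ∘ₗ P.α) fun x hx => by
    rw [LinearMap.comp_apply, P.α_ringO x hx, map_zero]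
  refine ⟨o, ho, fun a ha => ?_⟩
  obtain ⟨r, hr⟩ := P.α_of_mem ha
  rw [resForm_sub_left, h, LinearMap.comp_apply, hr, map_sub, resLin_apply, resLin_apply,
    resForm_algebraMap_right, sub_zero, sub_self]

end Splitting

/-! ### The scalars act faithfully on the coinvariants -/

section Faithful

variable {R : Type u} [CommRing R]

/-- The polar part of a Laurent series, as a finitely supported function. -/
def polar : K R →ₗ[R] (ℕ →₀ R) where
  toFun f := Finsupp.ofSupportFinite (fun n : ℕ => coeff f (-(n : ℤ) - 1)) (by
    obtain ⟨N, hN⟩ := exists_nat_mem_mPow f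
    refine (Set.finite_lt_nat N).subset fun n hn => ?_
    by_contra h
    replace h : N ≤ n := not_lt.1 h
    exact hn (hN _ (by omega)))
  map_add' f g := by ext n; rfl
  map_smul' r f := by ext n; rfl

theorem polar_apply (f : K R) (n : ℕ) : polar f n = coeff f (-(n : ℤ) - 1) := rfl

theorem sub_polar_mem (f : K R) :
    f - Finsupp.linearCombination R (fun n : ℕ => (e (-(n : ℤ) - 1) : K R)) (polar f) ∈
      ringO R := by
  intro n hn
  rw [coeff_sub, Finsupp.linearCombination_apply, Finsupp.sum, coeff_sum]
  have : ∀ m ∈ (polar f).support, coeff (polar f m • (e (-(m : ℤ) - 1) : K R)) n =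
      if (-n - 1).toNat = m then coeff f n else 0 := by
    intro m _
    rw [coeff_smul, coeff_e, polar_apply]
    by_cases h : (-n - 1).toNat = m
    · rw [if_pos h, if_pos (by omega), mul_one]
      congr 1; omega
    · rw [if_neg h, if_neg (by omega), mul_zero]
  rw [Finset.sum_congr rfl this, Finset.sum_ite_eq]
  split_ifs with h
  · rw [sub_self]
  · rw [sub_zero]
    rw [Finsupp.notMem_support_iff, polar_apply] at h
    rw [← h]
    congr 1; omega

/-- The linear polynomial attached to the polar part. -/
def polarPoly : K R →ₗ[R] MvPolynomial ℕ R :=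
  Finsupp.linearCombination R (MvPolynomial.X : ℕ → MvPolynomial ℕ R) ∘ₗ polar

/-- The constant vector field on polynomials attached to a linear form on `K`. -/
def constField : (K R →ₗ[R] R) →ₗ[R] Derivation R (MvPolynomial ℕ R) (MvPolynomial ℕ R) where
  toFun l := MvPolynomial.mkDerivation R fun n => MvPolynomial.C (l (e (-(n : ℤ) - 1)))
  map_add' l m := MvPolynomial.derivation_ext fun n => by
    simp [MvPolynomial.mkDerivation_X]
  map_smul' r l := MvPolynomial.derivation_ext fun n => by
    simp [MvPolynomial.mkDerivation_X, MvPolynomial.smul_eq_C_mul]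

theorem constField_X (l : K R →ₗ[R] R) (n : ℕ) :
    constField l (MvPolynomial.X n) = MvPolynomial.C (l (e (-(n : ℤ) - 1))) :=
  MvPolynomial.mkDerivation_X _ _ _

theorem constField_polarPoly (l : K R →ₗ[R] R) (hl : ∀ o ∈ ringO R, l o = 0) (f : K R) :
    constField l (polarPoly f) = MvPolynomial.C (l f) := by
  have h := hl _ (sub_polar_mem f)
  rw [map_sub, sub_eq_zero] at h
  rw [h, polarPoly, LinearMap.comp_apply, Finsupp.linearCombination_apply,
    Finsupp.linearCombination_apply, Finsupp.sum, Finsupp.sum, map_sum, map_sum, map_sum]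
  refine Finset.sum_congr rfl fun n _ => ?_
  rw [Derivation.map_smul, constField_X, map_smul, smul_eq_mul, map_mul,
    MvPolynomial.smul_eq_C_mul]

theorem constField_comm (l m : K R →ₗ[R] R) (s : MvPolynomial ℕ R) :
    constField l (constField m s) = constField m (constField l s) := by
  have : ⁅constField l, constField m⁆ = 0 := MvPolynomial.derivation_ext fun n => by
    rw [Derivation.commutator_apply, constField_X, constField_X, MvPolynomial.derivation_C,
      MvPolynomial.derivation_C]
    simp
  have h := DFunLike.congr_fun this s
  rwa [Derivation.commutator_apply, Derivation.zero_apply, sub_eq_zero] at h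

/-- The action of `K` on polynomials through a form `B` whose antisymmetrization is the residue
form. -/
def polyOp (B : K R →ₗ[R] K R →ₗ[R] R) : K R →ₗ[R] Module.End R (MvPolynomial ℕ R) :=
  LinearMap.mk₂ R (fun f s => polarPoly f * s + constField (B f) s)
    (fun f g s => by simp only [map_add, add_mul, Derivation.add_apply]; ring)
    (fun r f s => by
      simp only [map_smul, smul_mul_assoc, Derivation.smul_apply, smul_add])
    (fun f s t => by simp only [map_add, mul_add]; ring)
    (fun r f s => by
      simp only [Derivation.map_smul, mul_smul_comm, smul_add])

theorem polyOp_apply (B : K R →ₗ[R] K R →ₗ[R] R) (f : K R) (s : MvPolynomial ℕ R) :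
    polyOp B f s = polarPoly f * s + constField (B f) s := rfl

/-- Multiplications commute with each other, and so do constant vector fields. The cross terms
contribute `B f g - B g f`; they see only polar parts, which suffices since `B` vanishes on `𝒪`. -/
theorem polyOp_comm (B : K R →ₗ[R] K R →ₗ[R] R) (hO : ∀ f, ∀ o ∈ ringO R, B f o = 0)
    (hB : ∀ f g, B f g - B g f = resForm f g) (f g : K R) (s : MvPolynomial ℕ R) :
    polyOp B f (polyOp B g s) - polyOp B g (polyOp B f s) = resForm f g • s := by
  simp only [polyOp_apply, map_add, Derivation.leibniz, constField_polarPoly _ (hO _), smul_eq_mul]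
  rw [constField_comm (B f) (B g), ← hB, MvPolynomial.smul_eq_C_mul, map_sub]
  ring

variable [Algebra ℂ R]

/-- The Heisenberg algebra acts on polynomials. -/
def polyLie (B : K R →ₗ[R] K R →ₗ[R] R) (hO : ∀ f, ∀ o ∈ ringO R, B f o = 0)
    (hB : ∀ f g, B f g - B g f = resForm f g) :
    Heis R →ₗ⁅R⁆ Module.End R (MvPolynomial ℕ R) where
  toFun x := polyOp B x.1 + x.2 • LinearMap.id
  map_add' x y := by
    change polyOp B (x.1 + y.1) + (x.2 + y.2) • LinearMap.id = _
    rw [map_add, add_smul]; abel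
  map_smul' r x := by
    change polyOp B (r • x.1) + (r * x.2) • LinearMap.id = r • _
    rw [map_smul, mul_smul, smul_add]
  map_lie' {x y} := by
    refine LinearMap.ext fun s => ?_
    change polyOp B (0 : K R) s + resForm x.1 y.1 • s =
      (polyOp B x.1 (polyOp B y.1 s + y.2 • s) + x.2 • (polyOp B y.1 s + y.2 • s)) -
      (polyOp B y.1 (polyOp B x.1 s + x.2 • s) + y.2 • (polyOp B x.1 s + x.2 • s))
    rw [← polyOp_comm B hO hB, map_zero, LinearMap.zero_apply, map_add, map_add, map_smul, map_smul,
      smul_add, smul_add, smul_comm y.2 x.2]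
    abel

/-- A form as above that vanishes on `𝒪` on the right yields a model of the Fock representation. -/
theorem exists_toPoly (B : K R →ₗ[R] K R →ₗ[R] R) (hO : ∀ f, ∀ o ∈ ringO R, B f o = 0)
    (hB : ∀ f g, B f g - B g f = resForm f g) :
    ∃ Ψ : FockSpace R →ₗ[R] MvPolynomial ℕ R, Ψ (vac R) = 1 ∧
      ∀ f v, Ψ (act f v) = polyOp B f (Ψ v) := by
  let Φ := UniversalEnvelopingAlgebra.lift R (polyLie B hO hB)
  have hΦι : ∀ x, Φ (UniversalEnvelopingAlgebra.ι R x) = polyLie B hO hB x :=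
    UniversalEnvelopingAlgebra.lift_ι_apply R _
  have hΦf : ∀ f s, Φ (inU f) s = polyOp B f s := fun f s => by
    rw [inU, hΦι]
    change polyOp B f s + (0 : R) • s = _
    rw [zero_smul, add_zero]
  have hΦh : Φ hbar = 1 := by
    rw [hbar, hΦι]
    refine LinearMap.ext fun s => ?_
    change polyOp B (0 : K R) s + (1 : R) • s = s
    rw [map_zero, LinearMap.zero_apply, zero_add, one_smul]
  -- Elements of `𝒪` have no polar part and vector fields kill constants; so 1 satisfies the
  -- relations that define the vacuum.
  have hpO : ∀ o ∈ ringO R, polyOp B o 1 = 0 := fun o ho => by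
    have : polar o = 0 := by
      ext n
      exact ho _ (by omega)
    rw [polyOp_apply, polarPoly, LinearMap.comp_apply, this, map_zero, zero_mul, zero_add,
      Derivation.map_one_eq_zero]
  let E : UHeis R →+ MvPolynomial ℕ R :=
    AddMonoidHom.mk' (fun u => Φ u 1) fun u v => by rw [map_add, LinearMap.add_apply]
  have hE : ∀ u : UHeis R, u • vac R = 0 → E u = 0 := by
    intro u hu
    rw [← mk_eq_smul_vac] at hu
    replace hu := (Submodule.Quotient.mk_eq_zero _).1 hu
    change Φ u 1 = 0
    induction hu using Submodule.span_induction with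
    | mem x hx =>
      rcases hx with ⟨f, hf, rfl⟩ | rfl
      · rw [hΦf, hpO f hf]
      · rw [map_sub, hΦh, map_one Φ, sub_self, LinearMap.zero_apply]
    | zero => rw [map_zero, LinearMap.zero_apply]
    | add x y _ _ hx hy => rw [map_add, LinearMap.add_apply, hx, hy, add_zero]
    | smul a x _ hx =>
      rw [smul_eq_mul, map_mul, Module.End.mul_apply, hx, map_zero]
  let Ψ : FockSpace R →+ MvPolynomial ℕ R :=
    AddMonoidHom.liftOfSurjective toFock toFock_surjective ⟨E, fun u hu => hE u hu⟩
  have hΨ : ∀ u : UHeis R, Ψ (u • vac R) = Φ u 1 := fun u =>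
    AddMonoidHom.liftOfRightInverse_comp_apply toFock _ _ _ u
  refine ⟨{ Ψ with
    map_smul' := fun r v => ?_ }, ?_, fun f v => ?_⟩
  · obtain ⟨u, rfl⟩ := exists_eq_smul_vac v
    change Ψ (r • u • vac R) = r • Ψ (u • vac R)
    rw [← smul_assoc, hΨ, hΨ, map_smul, LinearMap.smul_apply]
  · change Ψ (vac R) = 1
    rw [← one_smul (UHeis R) (vac R), hΨ, map_one Φ, Module.End.one_apply]
  · obtain ⟨u, rfl⟩ := exists_eq_smul_vac v
    change Ψ (inU f • u • vac R) = polyOp B f (Ψ (u • vac R))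
    rw [← mul_smul, hΨ, hΨ, map_mul, Module.End.mul_apply, hΦf]

/-- The form adapted to a splitting. -/
def Splitting.form {A : Subalgebra R (K R)} (P : Splitting A) : K R →ₗ[R] K R →ₗ[R] R :=
  (resLin R).comp P.β + (resLin R).compl₁₂ P.γ P.α +
    algebraMap ℂ R (1 / 2) • (resLin R).compl₁₂ P.γ P.γ

theorem Splitting.form_apply {A : Subalgebra R (K R)} (P : Splitting A) (f g : K R) :
    P.form f g = resForm (P.β f) g + resForm (P.γ f) (P.α g) +
      algebraMap ℂ R (1 / 2) * resForm (P.γ f) (P.γ g) := rfl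

/-- A multiple of the vacuum that lies in `A ∘ 𝔽(K, 𝒪)` is zero. -/
theorem IsFockType.eq_zero_of_smul_vac_mem {A : Subalgebra R (K R)} (hA : IsFockType A) {r : R}
    (hr : r • vac R ∈ AFock A) : r = 0 := by
  obtain ⟨P⟩ := hA.exists_splitting
  have hzero : ∀ f : K R, resForm f 0 = 0 := fun f => (resLin R f).map_zero
  have hzero' : ∀ f : K R, resForm 0 f = 0 := fun f => by rw [resForm_swap, hzero, neg_zero]
  have hO : ∀ f, ∀ o ∈ ringO R, P.form f o = 0 := fun f o ho => by
    rw [P.form_apply, P.α_ringO o ho, P.γ_ringO o ho, resForm_ringO (P.β_mem f) ho, hzero]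
    simp
  -- Expand both arguments by the splitting. The pairings of `A` with itself and of `𝒪` with itself
  -- vanish, each mixed pairing occurs once up to antisymmetry, and the pairing of the complement
  -- with itself is divided evenly.
  have hform : ∀ f g, P.form f g - P.form g f = resForm f g := fun f g => by
    have h2 : (2 : R) * algebraMap ℂ R (1 / 2) = 1 := by
      rw [← map_ofNat (algebraMap ℂ R) 2, ← map_mul]; norm_num
    have e₁ : ∀ x y : K R, resForm x y =
        resForm x (P.α y) + resForm x (P.β y) + resForm x (P.γ y) := fun x y => by
      conv_lhs => rw [← P.sum y]
      rw [resForm_add_right, resForm_add_right]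
    have e₂ : ∀ x y : K R, resForm x y =
        resForm (P.α x) y + resForm (P.β x) y + resForm (P.γ x) y := fun x y => by
      conv_lhs => rw [← P.sum x]
      rw [resForm_add_left, resForm_add_left]
    rw [P.form_apply, P.form_apply]
    linear_combination e₁ (P.β f) g - e₁ (P.β g) f - e₂ f g - e₁ (P.α f) g - e₁ (P.β f) g -
      e₁ (P.γ f) g - hA.isotropic _ (P.α_mem f) _ (P.α_mem g) -
      resForm_ringO (P.β_mem g) (P.β_mem f) - resForm_add_swap (P.α f) (P.β g) -
      resForm_add_swap (P.α f) (P.γ g) - resForm_add_swap (P.γ f) (P.β g) -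
      algebraMap ℂ R (1 / 2) * resForm_add_swap (P.γ f) (P.γ g) + resForm (P.γ f) (P.γ g) * h2
  -- For `a ∈ A` the component `γ a` is zero and `β a` is a constant, hence in the radical. So `a`
  -- acts by multiplication with a linear polynomial alone.
  have hformA : ∀ a ∈ A, P.form a = 0 := fun a ha => by
    obtain ⟨s, hs⟩ := P.β_of_mem a ha
    ext g
    rw [P.form_apply, hs, P.γ_of_mem a ha, resForm_algebraMap_left, hzero', hzero']
    simp
  obtain ⟨Ψ, h1, hΨ⟩ := exists_toPoly P.form hO hform
  have key : ∀ v ∈ AFock A, MvPolynomial.constantCoeff (Ψ v) = 0 := by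
    intro v hv
    induction hv using Submodule.span_induction with
    | mem w hw =>
      obtain ⟨a, ha, v, rfl⟩ := hw
      rw [← act_apply, hΨ, polyOp_apply, hformA a ha, map_zero, Derivation.zero_apply, add_zero,
        map_mul]
      have : MvPolynomial.constantCoeff (polarPoly a) = 0 := by
        rw [polarPoly, LinearMap.comp_apply, Finsupp.linearCombination_apply, Finsupp.sum, map_sum]
        exact Finset.sum_eq_zero fun n _ => by
          rw [MvPolynomial.smul_eq_C_mul, map_mul, MvPolynomial.constantCoeff_X, mul_zero]
      rw [this, zero_mul]
    | zero => rw [map_zero, map_zero]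
    | add v w _ _ hv hw => rw [map_add, map_add, hv, hw, add_zero]
    | smul s v _ hv => rw [map_smul, MvPolynomial.smul_eq_C_mul, map_mul, hv, mul_zero]
  have := key _ hr
  rwa [map_smul, h1, MvPolynomial.smul_eq_C_mul, mul_one, MvPolynomial.constantCoeff_C] at this

end Faithful

/-! ### The action on the coinvariants -/

section CoinvLemmas

variable {R : Type u} [CommRing R] [Algebra ℂ R] {A : Subalgebra R (K R)}

/-- Elements of `A^⊥` commute with `A` on the Fock space. -/
theorem act_mem_AFock_of_perp {f : K R} (hf : ∀ a ∈ A, resForm f a = 0) {v : FockSpace R}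
    (hv : v ∈ AFock A) : act f v ∈ AFock A := by
  induction hv using Submodule.span_induction with
  | mem w hw =>
    obtain ⟨a, ha, v, rfl⟩ := hw
    rw [← act_apply, act_comm, hf a ha, zero_smul, add_zero]
    exact act_mem_AFock ha _
  | zero => rw [map_zero]; exact zero_mem _
  | add v w _ _ hv hw => rw [map_add]; exact add_mem hv hw
  | smul r v _ hv => rw [map_smul]; exact Submodule.smul_mem _ _ hv

/-- A lift of a vertical derivation that preserves `A` acts on the coinvariants as a scalar. -/
theorem IsFockType.exists_sub_smul_mem (hA : IsFockType A) {x : Pairs R} (hx : IsLift x)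
    (hD : IsVertical x.1) (hxA : ∀ a ∈ A, x.1 a ∈ A) :
    ∃ r : R, ∀ v, x.2 v - r • v ∈ AFock A := by
  obtain ⟨P⟩ := hA.exists_splitting
  let S := Subalgebra.toSubmodule A ⊔ ringO R
  have := hA.free_quotient
  let c := Module.Free.chooseBasis R (K R ⧸ S)
  have hS : ∀ {y}, y ∈ S → S.mkQ y = 0 := fun hy => (Submodule.Quotient.mk_eq_zero S).2 hy
  -- A representative of a basis vector can be changed by an element of `𝒪` so as to become
  -- orthogonal to `A`.
  have hb : ∀ i, ∃ b : K R, S.mkQ b = c i ∧ ∀ a ∈ A, resForm b a = 0 := fun i => by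
    obtain ⟨k, hk⟩ := S.mkQ_surjective (c i)
    obtain ⟨o, ho, h⟩ := P.exists_sub_perp k
    exact ⟨k - o, by rw [map_sub, hk, hS (Submodule.mem_sup_right ho), sub_zero], h⟩
  choose b hbc hbA using hb
  -- The coordinate forms vanish on `𝒪`, so they are represented by elements of `𝒪`; they also
  -- vanish on `A`, so these elements lie in `A^⊥`.
  have ho : ∀ i, ∃ o ∈ ringO R, ∀ f, resForm o f = c.coord i (S.mkQ f) := fun i =>
    exists_resForm_eq (c.coord i ∘ₗ S.mkQ) fun f hf => by
      rw [LinearMap.comp_apply, hS (Submodule.mem_sup_right hf), map_zero]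
  choose o hoO ho using ho
  have hoA : ∀ i, ∀ a ∈ A, resForm (o i) a = 0 := fun i a ha => by
    rw [ho, hS (Submodule.mem_sup_left ha), map_zero]
  -- The commutator of `T` with `f ∈ A^⊥` is `D(f)`, which lies in `A` by condition (4) of Fock
  -- type.
  have hstep : ∀ f, (∀ a ∈ A, resForm f a = 0) → ∀ v,
      x.2 (act f v) - act f (x.2 v) ∈ AFock A := fun f hf v => by
    rw [hx.map_act, add_sub_cancel_right]
    exact act_mem_AFock (hA.perp x.1 hD hxA f hf) v
  have hspan := exists_mem_wordSpan_sup (AFock A) b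
    (fun i v hv => act_mem_AFock_of_perp (hbA i) hv) fun f => by
      let t := Finsupp.linearCombination R b (c.repr (S.mkQ f))
      have ht : f - t ∈ S := by
        rw [← Submodule.Quotient.mk_eq_zero, ← Submodule.mkQ_apply, map_sub, sub_eq_zero]
        conv_lhs => rw [← c.linearCombination_repr (S.mkQ f)]
        rw [Finsupp.apply_linearCombination]
        congr 2
        ext i
        exact (hbc i).symm
      obtain ⟨a, ha, o, ho, hao⟩ := Submodule.mem_sup.1 ht
      exact ⟨t, Finsupp.mem_span_range_iff_exists_finsupp.2 ⟨_, rfl⟩, a,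
        fun v => act_mem_AFock ha v, o, ho, by rw [add_assoc, hao, add_sub_cancel]⟩
  obtain ⟨n, hn⟩ := hspan (x.2 (vac R))
  obtain ⟨r, hr⟩ := exists_sub_smul_vac_mem (AFock A) b o
    (fun i v hv => act_mem_AFock_of_perp (hbA i) hv) hoO
    (fun i => by rw [ho, hbc, Module.Basis.coord_apply, Module.Basis.repr_self,
      Finsupp.single_eq_same])
    (fun i j hij => by rw [ho, hbc, Module.Basis.coord_apply, Module.Basis.repr_self,
      Finsupp.single_eq_of_ne hij])
    (fun i v hv => act_mem_AFock_of_perp (hoA i) hv) n hn fun i => by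
      have := hstep (o i) (hoA i) (vac R)
      rwa [act_vac (hoO i), map_zero, zero_sub, neg_mem_iff] at this
  have hsmul : ∀ (s : R) v, x.2 (s • v) = s • x.2 v := fun s v => by
    rw [hx.map_smul 0 hD.restricts]; simp
  refine ⟨r, fun v => ?_⟩
  obtain ⟨n, hn⟩ := hspan v
  obtain ⟨y, hy, z, hz, rfl⟩ := Submodule.mem_sup.1 hn
  -- Modulo `A ∘ 𝔽` the operator commutes with the letters `bᵢ`, so the scalar found on the vacuum
  -- propagates along the words.
  have hy' : x.2 y - r • y ∈ AFock A := by
    clear hn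
    induction hy using Submodule.span_induction with
    | mem w hw =>
      obtain ⟨l, -, rfl⟩ := hw
      induction l with
      | nil => rwa [List.map_nil, word_nil]
      | cons i l ih =>
        rw [List.map_cons, word_cons]
        have h₁ := hstep (b i) (hbA i) (word (l.map b))
        have h₂ := act_mem_AFock_of_perp (hbA i) ih
        rw [map_sub, _root_.map_smul] at h₂
        have := add_mem h₁ h₂
        rwa [sub_add_sub_cancel] at this
    | zero => simp
    | add v w _ _ hv hw =>
      rw [map_add, smul_add, add_sub_add_comm]
      exact add_mem hv hw
    | smul s v _ hv =>
      rw [hsmul, smul_comm r, ← smul_sub]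
      exact Submodule.smul_mem _ _ hv
  rw [map_add, smul_add, add_sub_add_comm]
  exact add_mem hy' (sub_mem (hx.map_AFock hxA hz) (Submodule.smul_mem _ _ hz))

end CoinvLemmas

/-! ### The central extension -/

section Extension

variable {R : Type u} [CommRing R] [Algebra ℂ R] {A : Subalgebra R (K R)}

instance : SMulCommClass ℂ R (Coinv A) :=
  ⟨fun z r v => by
    rw [← algebraMap_smul R z v, ← algebraMap_smul R z (r • v), smul_comm]⟩

theorem IsLift.smul {x : Pairs R} (hx : IsLift x) (r : R) : IsLift (r • x) := by
  refine ⟨smul_mem_thetaKR hx.mem r, fun f v => ?_, fun ε hε s v => ?_⟩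
  · change r • x.2 (act f v) = act (r • x.1 f) v + act f (r • x.2 v)
    rw [hx.map_act, smul_add, _root_.map_smul, _root_.map_smul]; rfl
  · obtain ⟨δ, hδ⟩ := exists_restricts hx.mem
    obtain rfl := hε.unique (hδ.smul r)
    change r • x.2 (s • v) = (r • δ s) • v + s • r • x.2 v
    rw [hx.map_smul δ hδ, smul_add, smul_smul, smul_eq_mul, smul_comm]

variable (A)

/-- The restriction to `R` of the derivation underlying a lift. -/
def baseDer (x : hatThetaKAR A) : Derivation ℂ R R :=
  (exists_restricts (mem_hatThetaKAR.1 x.2).1.mem).choose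

theorem baseDer_restricts (x : hatThetaKAR A) : Restricts x.1.1 (baseDer A x) :=
  (exists_restricts (mem_hatThetaKAR.1 x.2).1.mem).choose_spec

theorem mk_complex_smul (z : ℂ) (v : FockSpace R) :
    (Submodule.Quotient.mk (z • v) : Coinv A) = z • Submodule.Quotient.mk v := rfl

/-- The operator on the coinvariants induced by a lift. -/
def coinvAdd (x : hatThetaKAR A) : Coinv A →+ Coinv A :=
  AddMonoidHom.liftOfSurjective (AFock A).mkQ.toAddMonoidHom (AFock A).mkQ_surjective
    ⟨(AFock A).mkQ.toAddMonoidHom.comp x.1.2.toAddMonoidHom, fun v hv => by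
      have hv' : v ∈ AFock A := (Submodule.Quotient.mk_eq_zero _).1 hv
      exact (Submodule.Quotient.mk_eq_zero _).2
        ((mem_hatThetaKAR.1 x.2).1.map_AFock (mem_hatThetaKAR.1 x.2).2.2 hv')⟩

theorem coinvAdd_mk (x : hatThetaKAR A) (v : FockSpace R) :
    coinvAdd A x (Submodule.Quotient.mk v) = Submodule.Quotient.mk (x.1.2 v) :=
  AddMonoidHom.liftOfRightInverse_comp_apply (AFock A).mkQ.toAddMonoidHom _ _ _ v

/-- The operator on the coinvariants induced by a lift, as a complex linear map. -/
def coinvOp (x : hatThetaKAR A) : Module.End ℂ (Coinv A) where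
  toFun := coinvAdd A x
  map_add' := map_add _
  map_smul' z v := by
    obtain ⟨v, rfl⟩ := Submodule.Quotient.mk_surjective _ v
    rw [← mk_complex_smul, coinvAdd_mk, map_smul, mk_complex_smul, RingHom.id_apply, coinvAdd_mk]

theorem coinvOp_mk (x : hatThetaKAR A) (v : FockSpace R) :
    coinvOp A x (Submodule.Quotient.mk v) = Submodule.Quotient.mk (x.1.2 v) := coinvAdd_mk A x v

theorem coinv_ext {S T : Module.End ℂ (Coinv A)}
    (h : ∀ v : FockSpace R, S (Submodule.Quotient.mk v) = T (Submodule.Quotient.mk v)) : S = T :=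
  LinearMap.ext fun v => by
    obtain ⟨v, rfl⟩ := Submodule.Quotient.mk_surjective _ v
    exact h v

/-- The pair of actions of a lift on `R` and on the coinvariants. -/
def coinvHom : hatThetaKAR A →ₗ⁅ℂ⁆ Derivation ℂ R R × Module.End ℂ (Coinv A) where
  toFun x := (baseDer A x, coinvOp A x)
  map_add' x y := Prod.ext
    ((baseDer_restricts A (x + y)).unique ((baseDer_restricts A x).add (baseDer_restricts A y)))
    (coinv_ext A fun v => by
      change coinvOp A (x + y) _ = coinvOp A x _ + coinvOp A y _
      simp only [coinvOp_mk]; rfl)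
  map_smul' z x := Prod.ext
    ((baseDer_restricts A (z • x)).unique ((baseDer_restricts A x).complex_smul z))
    (coinv_ext A fun v => by
      change coinvOp A (z • x) _ = z • coinvOp A x _
      simp only [coinvOp_mk]; rfl)
  map_lie' {x y} := Prod.ext
    ((baseDer_restricts A ⁅x, y⁆).unique ((baseDer_restricts A x).lie (baseDer_restricts A y)))
    (coinv_ext A fun v => by
      change coinvOp A ⁅x, y⁆ _ = coinvOp A x (coinvOp A y _) - coinvOp A y (coinvOp A x _)
      simp only [coinvOp_mk]; rfl)

/-- The extension of the liftable derivations that acts on the coinvariants. -/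
abbrev coinvExt : LieSubalgebra ℂ (Derivation ℂ R R × Module.End ℂ (Coinv A)) := (coinvHom A).range

variable {A}

/-- The multiple of a lift by a scalar. -/
def smulLift (r : R) (x : hatThetaKAR A) : hatThetaKAR A :=
  ⟨r • x.1, mem_hatThetaKAR.2 ⟨(mem_hatThetaKAR.1 x.2).1.smul r,
    smul_mem_thetaKR (mem_hatThetaKAR.1 x.2).1.mem r, fun a ha =>
      A.smul_mem ((mem_hatThetaKAR.1 x.2).2.2 a ha) r⟩⟩

theorem coinvHom_eq {x : hatThetaKAR A} {δ : Derivation ℂ R R} {S : Module.End ℂ (Coinv A)}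
    (h : Restricts x.1.1 δ)
    (h' : ∀ v, S (Submodule.Quotient.mk v) = Submodule.Quotient.mk (x.1.2 v)) :
    coinvHom A x = (δ, S) :=
  Prod.ext ((baseDer_restricts A x).unique h)
    (coinv_ext A fun v => (coinvOp_mk A x v).trans (h' v).symm)

theorem coinvHom_eq_smul {x y : hatThetaKAR A} (r : R) (h : y.1.1 = r • x.1.1)
    (h' : ∀ v, y.1.2 v = r • x.1.2 v) : coinvHom A y = r • coinvHom A x :=
  coinvHom_eq (by rw [h]; exact (baseDer_restricts A x).smul r) fun v => by
    change r • coinvOp A x _ = _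
    rw [coinvOp_mk, h', Submodule.Quotient.mk_smul]

instance : SMul R (coinvExt A) :=
  ⟨fun r x => ⟨r • x.1, by
    obtain ⟨y, hy⟩ := x.2
    exact ⟨smulLift r y, by rw [← hy]; exact coinvHom_eq_smul r rfl fun v => rfl⟩⟩⟩

instance : Module R (coinvExt A) :=
  Function.Injective.module R (coinvExt A).toSubmodule.subtype.toAddMonoidHom
    Subtype.val_injective fun _ _ => rfl

instance : IsScalarTower ℂ R (coinvExt A) :=
  ⟨fun z r x => Subtype.ext (smul_assoc z r x.1)⟩

theorem scalarOp_mem (r : R) : ((0, scalarOp r) : Pairs R) ∈ hatThetaKAR A :=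
  mem_hatThetaKAR.2 ⟨isLift_scalarOp r, (thetaKAR A).zero_mem⟩

theorem coinvHom_scalarOp (r : R) : coinvHom A ⟨(0, scalarOp r), scalarOp_mem r⟩ =
    r • ((0, 1) : Derivation ℂ R R × Module.End ℂ (Coinv A)) :=
  coinvHom_eq (x := ⟨(0, scalarOp r), scalarOp_mem r⟩) (fun s => by simp) fun v => rfl

/-- The inclusion of the scalars. -/
def coinvIncl : R →ₗ[R] coinvExt A where
  toFun r := ⟨r • ((0, 1) : Derivation ℂ R R × Module.End ℂ (Coinv A)), _, coinvHom_scalarOp r⟩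
  map_add' r s := Subtype.ext (add_smul r s _)
  map_smul' r s := Subtype.ext (mul_smul r s _)

theorem coinvExt_leibniz (x : coinvExt A) (r : R) (v : Coinv A) :
    x.1.2 (r • v) = r • x.1.2 v + x.1.1 r • v := by
  obtain ⟨_, x, rfl⟩ := x
  obtain ⟨v, rfl⟩ := Submodule.Quotient.mk_surjective _ v
  change coinvOp A x _ = r • coinvOp A x _ + baseDer A x r • _
  rw [← Submodule.Quotient.mk_smul, coinvOp_mk, coinvOp_mk,
    (mem_hatThetaKAR.1 x.2).1.map_smul _ (baseDer_restricts A x), Submodule.Quotient.mk_add,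
    Submodule.Quotient.mk_smul, Submodule.Quotient.mk_smul, add_comm]

/-- The central extension by `R` through which the lifts act on the coinvariants. -/
def coinvCentralExtension (hA : IsFockType A) : CentralExtension (liftable A) (coinvExt A) where
  proj := (LieHom.fst ℂ _ _).comp (coinvExt A).incl
  proj_smul r x := rfl
  range_proj := by
    ext δ
    rw [LieHom.mem_range]
    constructor
    · rintro ⟨⟨_, x, rfl⟩, rfl⟩
      exact ⟨x.1.1, (mem_hatThetaKAR.1 x.2).2, baseDer_restricts A x⟩
    · rintro ⟨D, hD, hδ⟩
      obtain ⟨T, hT⟩ := exists_isLift hD.1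
      exact ⟨⟨_, ⟨(D, T), mem_hatThetaKAR.2 ⟨hT, hD⟩⟩, rfl⟩,
        (baseDer_restricts A ⟨(D, T), mem_hatThetaKAR.2 ⟨hT, hD⟩⟩).unique hδ⟩
  incl := coinvIncl
  -- A scalar acting as zero on the coinvariants sends the vacuum into `A ∘ 𝔽`, which forces it to
  -- be zero.
  incl_injective := by
    rw [injective_iff_map_eq_zero]
    intro r hr
    have h : (r • (1 : Module.End ℂ (Coinv A))) (Submodule.Quotient.mk (vac R)) = 0 := by
      have := congrArg (fun x : coinvExt A => x.1.2) hr
      exact LinearMap.congr_fun this _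
    exact hA.eq_zero_of_smul_vac_mem ((Submodule.Quotient.mk_eq_zero _).1 h)
  -- An element over the zero derivation of `R` comes from a vertical lift preserving `A`; as such
  -- it acts by a scalar, and `E` remembers nothing else of it.
  exact x := by
    constructor
    · obtain ⟨_, x, rfl⟩ := x
      intro h0
      have h0' : baseDer A x = 0 := h0
      have hx := mem_hatThetaKAR.1 x.2
      have hD : IsVertical x.1.1 :=
        Restricts.isVertical hx.1.mem (h0' ▸ baseDer_restricts A x)
      obtain ⟨r, hr⟩ := hA.exists_sub_smul_mem hx.1 hD hx.2.2
      refine ⟨r, Subtype.ext ?_⟩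
      refine Eq.trans ?_ (coinvHom_eq (x := x) (S := r • 1) hD.restricts fun v => ?_).symm
      · exact Prod.ext (smul_zero r) rfl
      · change r • (Submodule.Quotient.mk v : Coinv A) = _
        rw [← Submodule.Quotient.mk_smul, eq_comm, ← sub_eq_zero, ← Submodule.Quotient.mk_sub]
        exact (Submodule.Quotient.mk_eq_zero _).2 (hr v)
    · rintro ⟨r, rfl⟩
      exact smul_zero r
  leibniz x y r := by
    refine Subtype.ext (Prod.ext ?_ (LinearMap.ext fun v => ?_))
    · change ⁅x.1.1, r • y.1.1⁆ = r • ⁅x.1.1, y.1.1⁆ + x.1.1 r • y.1.1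
      ext s
      simp only [Derivation.commutator_apply, Derivation.add_apply, Derivation.smul_apply,
        smul_eq_mul, Derivation.leibniz]
      ring
    · change x.1.2 (r • y.1.2 v) - r • y.1.2 (x.1.2 v) =
        r • (x.1.2 (y.1.2 v) - y.1.2 (x.1.2 v)) + x.1.1 r • y.1.2 v
      rw [coinvExt_leibniz, smul_sub]; abel
  central x := by
    refine Subtype.ext (Prod.ext ?_ (LinearMap.ext fun v => ?_))
    · change ⁅x.1.1, (1 : R) • (0 : Derivation ℂ R R)⁆ = 0
      rw [smul_zero, lie_zero]
    · change x.1.2 ((1 : R) • v) - (1 : R) • x.1.2 v = 0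
      rw [one_smul, one_smul, sub_self]

theorem exists_coinvariant_extension (hA : IsFockType A) :
    ∃ (E : Type u) (_ : LieRing E) (_ : LieAlgebra ℂ E) (_ : Module R E)
        (_ : IsScalarTower ℂ R E) (X : CentralExtension (liftable A) E)
        (ρ : E →ₗ⁅ℂ⁆ Module.End ℂ (Coinv A)) (q : hatThetaKAR A →ₗ⁅ℂ⁆ E),
      X.IsAction ρ ∧
      Function.Surjective q ∧
      (∀ (r : R) (x y : hatThetaKAR A), y.1.1 = r • x.1.1 → (∀ v, y.1.2 v = r • x.1.2 v) →
        q y = r • q x) ∧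
      (∀ x : hatThetaKAR A, Restricts x.1.1 (X.proj (q x))) ∧
      (∀ r : R, ∃ h : ((0, scalarOp r) : Pairs R) ∈ hatThetaKAR A,
        q ⟨(0, scalarOp r), h⟩ = X.incl r) ∧
      (∀ (x : hatThetaKAR A) (v : FockSpace R),
        ρ (q x) (Submodule.Quotient.mk v) = Submodule.Quotient.mk (x.1.2 v)) :=
  ⟨coinvExt A, inferInstance, inferInstance, inferInstance, inferInstance,
    coinvCentralExtension hA, (LieHom.snd ℂ _ _).comp (coinvExt A).incl, (coinvHom A).rangeRestrict,
    ⟨fun _ _ _ => rfl, coinvExt_leibniz, fun _ _ => rfl⟩, (coinvHom A).surjective_rangeRestrict,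
    fun r _ _ h h' => Subtype.ext (coinvHom_eq_smul r h h'), baseDer_restricts A,
    fun r => ⟨scalarOp_mem r, Subtype.ext (coinvHom_scalarOp r)⟩, coinvOp_mk A⟩

end Extension

/-! ### The commutator action on the completed enveloping algebra -/

section Completion

variable {R : Type u} [CommRing R] [Algebra ℂ R]

theorem Ubar.ext {x y : Ubar R} (h : ∀ N, x.1 N = y.1 N) : x = y := Subtype.ext (funext h)

theorem idealJ_le {M N : ℕ} (h : M ≤ N) : idealJ R N ≤ idealJ R M := idealJ_anti R h

theorem Ubar.eq_mk_of_le (x : Ubar R) {M N : ℕ} (h : N ≤ M) {u : UHeis R}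
    (hu : x.1 M = Submodule.Quotient.mk u) : x.1 N = Submodule.Quotient.mk u := by
  induction h with
  | refl => exact hu
  | step _ ih =>
    apply ih
    rw [← x.2, hu]
    rfl

theorem Ubar.exists_mk (x : Ubar R) (M : ℕ) :
    ∃ u : UHeis R, ∀ N ≤ M, x.1 N = Submodule.Quotient.mk u := by
  obtain ⟨u, hu⟩ := Submodule.Quotient.mk_surjective _ (x.1 M)
  exact ⟨u, fun N hN => Ubar.eq_mk_of_le x hN hu.symm⟩

theorem mk_eq_of_idealJ {N : ℕ} {u v : UHeis R} (h : u - v ∈ idealJ R N) :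
    (Submodule.Quotient.mk u : UHeis R ⧸ idealJ R N) = Submodule.Quotient.mk v :=
  (Submodule.Quotient.eq _).2 h

theorem Ubar.smul_apply (u : UHeis R) (x : Ubar R) (N : ℕ) : (u • x).1 N = u • x.1 N := rfl

theorem Ubar.add_apply (x y : Ubar R) (N : ℕ) : (x + y).1 N = x.1 N + y.1 N := rfl

theorem Ubar.algebraMap_smul (r : R) (x : Ubar R) : (algebraMap R (UHeis R) r) • x = r • x :=
  _root_.algebraMap_smul (UHeis R) r x

variable {D : Derivation ℂ (K R) (K R)} (hD : D ∈ thetaKR R) {δ : Derivation ℂ R R}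
  (h : Restricts D δ)

theorem exists_derU_mem_idealJ (N : ℕ) :
    ∃ M : ℕ, N ≤ M ∧ ∀ u ∈ idealJ R M, derU hD h u ∈ idealJ R N := by
  obtain ⟨M, hM⟩ := hD.1 N
  -- Continuity of `D` handles the generators. The bound `N` is needed for the Leibniz term in which
  -- the left factor is differentiated and the element of the ideal stays as it is.
  refine ⟨max N M.toNat, le_max_left _ _, fun u hu => ?_⟩
  induction hu using Submodule.span_induction with
  | mem x hx =>
    obtain ⟨f, hf, rfl⟩ := hx
    rw [derU_inU]
    exact Submodule.subset_span ⟨D f, hM f (mPow_anti R (by push_cast; omega) hf), rfl⟩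
  | zero => rw [map_zero]; exact zero_mem _
  | add x y _ _ hx hy => rw [map_add]; exact add_mem hx hy
  | smul a x hx' hx =>
    rw [smul_eq_mul, derU_mul]
    exact add_mem (Submodule.smul_mem _ a hx)
      (Submodule.smul_mem _ (derU hD h a) (idealJ_le (le_max_left _ _) hx'))

/-- A level of precision that suffices to compute the derivative at level `N`. -/
def derLevel (N : ℕ) : ℕ := (exists_derU_mem_idealJ hD h N).choose

theorem le_derLevel (N : ℕ) : N ≤ derLevel hD h N := (exists_derU_mem_idealJ hD h N).choose_spec.1

theorem derU_mem_idealJ {N M : ℕ} (hM : derLevel hD h N ≤ M) {u : UHeis R} (hu : u ∈ idealJ R M) :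
    derU hD h u ∈ idealJ R N :=
  (exists_derU_mem_idealJ hD h N).choose_spec.2 u (idealJ_le hM hu)

/-- The derivative of an element of the completion at level `N`. -/
def derUbarAt (x : Ubar R) (N : ℕ) : UHeis R ⧸ idealJ R N :=
  Submodule.Quotient.mk (derU hD h (Ubar.exists_mk x (derLevel hD h N)).choose)

theorem derUbarAt_eq (x : Ubar R) {N M : ℕ} (hM : derLevel hD h N ≤ M) {u : UHeis R}
    (hu : x.1 M = Submodule.Quotient.mk u) :
    derUbarAt hD h x N = Submodule.Quotient.mk (derU hD h u) := by
  refine mk_eq_of_idealJ ?_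
  rw [← map_sub]
  refine derU_mem_idealJ hD h le_rfl ((Submodule.Quotient.eq _).1 ?_)
  rw [← (Ubar.exists_mk x (derLevel hD h N)).choose_spec _ le_rfl, Ubar.eq_mk_of_le x hM hu]

/-- The continuous derivation of `Ū K̂` that extends `D`. -/
def derUbar : Ubar R →+ Ubar R :=
  AddMonoidHom.mk' (fun x => ⟨derUbarAt hD h x, fun N => by
    obtain ⟨u, hu⟩ := Ubar.exists_mk x (max (derLevel hD h N) (derLevel hD h (N + 1)))
    rw [derUbarAt_eq hD h x (le_max_right _ _) (hu _ le_rfl),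
      derUbarAt_eq hD h x (le_max_left _ _) (hu _ le_rfl)]
    rfl⟩) fun x y => Ubar.ext fun N => by
      obtain ⟨u, hu⟩ := Ubar.exists_mk x (derLevel hD h N)
      obtain ⟨v, hv⟩ := Ubar.exists_mk y (derLevel hD h N)
      have h₁ := hu _ le_rfl
      have h₂ := hv _ le_rfl
      change derUbarAt hD h (x + y) N = derUbarAt hD h x N + derUbarAt hD h y N
      rw [derUbarAt_eq hD h x le_rfl h₁, derUbarAt_eq hD h y le_rfl h₂,
        derUbarAt_eq hD h (x + y) (u := u + v) le_rfl (by
          rw [Ubar.add_apply, h₁, h₂, Submodule.Quotient.mk_add]), map_add,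
        Submodule.Quotient.mk_add]

theorem derUbar_apply (x : Ubar R) {N M : ℕ} (hM : derLevel hD h N ≤ M) {u : UHeis R}
    (hu : x.1 M = Submodule.Quotient.mk u) :
    (derUbar hD h x).1 N = Submodule.Quotient.mk (derU hD h u) := derUbarAt_eq hD h x hM hu

theorem derUbar_smul (u : UHeis R) (x : Ubar R) :
    derUbar hD h (u • x) = derU hD h u • x + u • derUbar hD h x := by
  refine Ubar.ext fun N => ?_
  obtain ⟨v, hv⟩ := Ubar.exists_mk x (derLevel hD h N)
  rw [Ubar.add_apply, Ubar.smul_apply, Ubar.smul_apply, hv N (le_derLevel hD h N),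
    derUbar_apply hD h x le_rfl (hv _ le_rfl), derUbar_apply hD h (u • x) (u := u * v) le_rfl (by
      rw [Ubar.smul_apply, hv _ le_rfl]; rfl), derU_mul, add_comm]
  rfl

theorem derUbar_isCommutatorAction : IsCommutatorAction D δ (derUbar hD h) where
  map_one := Ubar.ext fun N => by
    rw [derUbar_apply hD h (Ubar.one R) (u := 1) le_rfl rfl, derU_one]
    rfl
  map_inU f x := by rw [derUbar_smul, derU_inU]
  map_hbar x := by rw [derUbar_smul, derU_hbar, zero_smul, zero_add]
  map_smul r x := by
    rw [← Ubar.algebraMap_smul, derUbar_smul, Algebra.algebraMap_eq_smul_one, derU_smul, derU_one,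
      smul_zero, add_zero, ← Algebra.algebraMap_eq_smul_one, ← Algebra.algebraMap_eq_smul_one,
      Ubar.algebraMap_smul, Ubar.algebraMap_smul]
  continuous N := ⟨derLevel hD h N, fun x hx => by
    rw [derUbar_apply hD h x (u := 0) le_rfl hx, map_zero]
    rfl⟩

theorem IsCommutatorAction.map_u_smul {δ' : Ubar R →+ Ubar R} (hδ' : IsCommutatorAction D δ δ')
    (u : UHeis R) (x : Ubar R) : δ' (u • x) = derU hD h u • x + u • δ' x := by
  induction u using UHeis.induction generalizing x with
  | hr r =>
    rw [Algebra.algebraMap_eq_smul_one, derU_smul, derU_one, smul_zero, add_zero,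
      ← Algebra.algebraMap_eq_smul_one, ← Algebra.algebraMap_eq_smul_one, Ubar.algebraMap_smul,
      Ubar.algebraMap_smul, Ubar.algebraMap_smul, hδ'.map_smul]
  | hf f => rw [derU_inU, hδ'.map_inU]
  | hh => rw [derU_hbar, zero_smul, zero_add, hδ'.map_hbar]
  | hadd u v hu hv => rw [add_smul, map_add, map_add, hu, hv, add_smul, add_smul]; abel
  | hmul u v hu hv =>
    rw [mul_smul, hu, hv, derU_mul, add_smul, smul_add, mul_smul, mul_smul, mul_smul]; abel

/-- The commutator action attached to a derivation is unique. -/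
theorem IsCommutatorAction.eq_derUbar {δ' : Ubar R →+ Ubar R}
    (hδ' : IsCommutatorAction D δ δ') : δ' = derUbar hD h := by
  refine AddMonoidHom.ext fun x => Ubar.ext fun N => ?_
  obtain ⟨M, hM⟩ := hδ'.continuous N
  obtain ⟨M', hM'⟩ := (derUbar_isCommutatorAction hD h).continuous N
  -- Approximate `x` by `u · 1` so closely that both maps ignore the error at level `N`; on `u · 1`
  -- they are determined by the rules for generators.
  obtain ⟨u, hu⟩ := Ubar.exists_mk x (max M M')
  have hz : ∀ L ≤ max M M', (x - u • Ubar.one R).1 L = 0 := fun L hL => by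
    change x.1 L - u • (Submodule.Quotient.mk 1 : UHeis R ⧸ idealJ R L) = 0
    rw [hu L hL, ← Submodule.Quotient.mk_smul, smul_eq_mul, mul_one, sub_self]
  have h₁ := hM _ (hz M (le_max_left _ _))
  have h₂ := hM' _ (hz M' (le_max_right _ _))
  have hs : ∀ φ : Ubar R →+ Ubar R, (φ (x - u • Ubar.one R)).1 N = 0 →
      (φ x).1 N = (φ (u • Ubar.one R)).1 N := fun φ hφ => by
    have e := congrArg (fun y : Ubar R => y.1 N) (AddMonoidHom.map_sub φ x (u • Ubar.one R))
    exact sub_eq_zero.1 (e.symm.trans hφ)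
  have h₃ := hs _ h₁
  have h₄ := hs _ h₂
  rw [h₃, h₄, hδ'.map_u_smul hD h, (derUbar_isCommutatorAction hD h).map_u_smul hD h, hδ'.map_one,
    (derUbar_isCommutatorAction hD h).map_one]

theorem IsCommutatorAction.map_AUbar {A : Subalgebra R (K R)} (hA : ∀ a ∈ A, D a ∈ A)
    {δ' : Ubar R →+ Ubar R} (hδ' : IsCommutatorAction D δ δ') {y : Ubar R} (hy : y ∈ AUbar A) :
    δ' y ∈ AUbar A := by
  induction hy using Submodule.span_induction with
  | mem y hy =>
    obtain ⟨a, ha, x, rfl⟩ := hy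
    rw [hδ'.map_inU]
    exact add_mem (Submodule.subset_span ⟨_, hA a ha, _, rfl⟩)
      (Submodule.subset_span ⟨a, ha, _, rfl⟩)
  | zero => rw [map_zero]; exact zero_mem _
  | add v w _ _ hv hw => rw [map_add]; exact add_mem hv hw
  | smul r v hv' hv =>
    rw [hδ'.map_smul]
    exact add_mem (Submodule.smul_mem _ _ hv') (Submodule.smul_mem _ _ hv)

end Completion

/-! ### Extending a derivation from `A` to its completion `K` -/

section Extension

variable {R : Type u} [CommRing R]

/-- A Laurent series `1 + x` with `x ∈ 𝔪` is invertible in `𝒪`. -/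
theorem exists_mul_eq_one {f : K R} (hf : f - 1 ∈ mPow R 1) : ∃ g ∈ ringO R, f * g = 1 := by
  let p : PowerSeries R := PowerSeries.mk fun n => coeff f n
  have hc : ∀ n : ℤ, n ≤ 0 → coeff f n = if n = 0 then 1 else 0 := fun n hn => by
    have := hf n (by omega)
    rwa [coeff_sub, ← e_zero, coeff_e, sub_eq_zero] at this
  have hp : (show K R from HahnSeries.ofPowerSeries ℤ R p) = f := by
    ext n
    refine (PowerSeries.coeff_coe p n).trans ?_
    split_ifs with h
    · rw [hc n h.le, if_neg h.ne]
    · rw [PowerSeries.coeff_mk]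
      congr 1; omega
  have hu : IsUnit p := by
    rw [PowerSeries.isUnit_iff_constantCoeff, ← PowerSeries.coeff_zero_eq_constantCoeff_apply,
      PowerSeries.coeff_mk, Nat.cast_zero, hc 0 le_rfl, if_pos rfl]
    exact isUnit_one
  obtain ⟨q, hq⟩ := hu.exists_right_inv
  refine ⟨HahnSeries.ofPowerSeries ℤ R q, fun n hn => ?_, ?_⟩
  · exact (PowerSeries.coeff_coe q n).trans (if_pos hn)
  · conv_lhs => rw [← hp]
    exact (map_mul (HahnSeries.ofPowerSeries ℤ R) p q).symm.trans (by rw [hq, map_one]; rfl)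

/-- A sequence of Laurent series whose consecutive differences tend to zero at a linear rate
converges at that rate. -/
theorem exists_limit (s : ℕ → K R) (C : ℤ) (h : ∀ l : ℕ, s (l + 1) - s l ∈ mPow R ((l : ℤ) - C)) :
    ∃ x, ∀ l : ℕ, x - s l ∈ mPow R ((l : ℤ) - C) := by
  have hs : ∀ l m : ℕ, l ≤ m → s m - s l ∈ mPow R ((l : ℤ) - C) := by
    intro l m hlm
    induction m, hlm using Nat.le_induction with
    | base => rw [sub_self]; exact Submodule.zero_mem _
    | succ m hm ih =>
      rw [← sub_add_sub_cancel _ (s m)]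
      exact Submodule.add_mem _ (mPow_anti R (by omega) (h m)) ih
  obtain ⟨M, hM⟩ := exists_mem_mPow (s 0)
  -- The coefficient of `t^n` no longer changes once `l > n + C`, so it can be read off at index `n
  -- + C + 1`.
  let x : K R := HahnSeries.ofSuppBddBelow (fun n => coeff (s (n + C + 1).toNat) n)
    ⟨min M (-C), fun n hn => by
      by_contra hlt
      refine hn ?_
      have := hs 0 (n + C + 1).toNat (Nat.zero_le _) n (by push_cast; omega)
      rw [coeff_sub, sub_eq_zero] at this
      exact this.trans (hM n (by omega))⟩
  refine ⟨x, fun l n hn => ?_⟩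
  rw [coeff_sub, sub_eq_zero]
  change coeff (s (n + C + 1).toNat) n = coeff (s l) n
  have := hs _ l (show (n + C + 1).toNat ≤ l by omega) n (by omega)
  rw [coeff_sub, sub_eq_zero] at this
  exact this.symm

variable {A : Subalgebra R (K R)}

/-- The quotient rule: the value at `f ^ (-l) * a`, where `g` is the inverse of `f`, of the
extension of a derivation `d` of `A`. -/
def quotRule (d : A →+ K R) (f : A) (g : K R) (l : ℕ) : A →+ K R :=
  AddMonoidHom.mk' (fun a => g ^ l * d a - l * g ^ (l + 1) * d f * a) fun a b => by
    rw [map_add]; push_cast; ring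

theorem quotRule_apply (d : A →+ K R) (f : A) (g : K R) (l : ℕ) (a : A) :
    quotRule d f g l a = g ^ l * d a - l * g ^ (l + 1) * d f * a := rfl

/-- The quotient rule gives the same value for `a / f^l` and `f a / f^(l+1)`, so fractions may be
brought to a common denominator. -/
theorem quotRule_succ {d : A →+ K R} (hd : ∀ a b : A, d (a * b) = d a * b + a * d b) {f : A}
    {g : K R} (hfg : f * g = 1) (l : ℕ) (a : A) :
    quotRule d f g (l + 1) (f * a) = quotRule d f g l a := by
  rw [quotRule_apply, quotRule_apply, hd]
  push_cast
  linear_combination (g ^ l * d a - (l + 1) * g ^ (l + 1) * d f * a) * hfg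

theorem quotRule_add_pow {d : A →+ K R} (hd : ∀ a b : A, d (a * b) = d a * b + a * d b) {f : A}
    {g : K R} (hfg : f * g = 1) (l j : ℕ) (a : A) :
    quotRule d f g (l + j) (f ^ j * a) = quotRule d f g l a := by
  induction j with
  | zero => simp
  | succ j ih => rw [pow_succ', mul_assoc, ← add_assoc, quotRule_succ hd hfg, ih]

theorem quotRule_mul {d : A →+ K R} (hd : ∀ a b : A, d (a * b) = d a * b + a * d b) (f : A)
    (g : K R) (l m : ℕ) (a b : A) :
    quotRule d f g (l + m) (a * b) =
      quotRule d f g l a * (g ^ m * b) + g ^ l * a * quotRule d f g m b := by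
  simp only [quotRule_apply, hd]
  push_cast
  ring

/-- A derivation of `A` over a derivation of `R` raises the pole order of functions of bounded
pole order by a bounded amount. -/
theorem Splitting.exists_pole_bound (P : Splitting A) {d : A →+ K R}
    (hd : ∀ a b : A, d (a * b) = d a * b + a * d b)
    (hR : ∀ r : R, d (algebraMap R A r) ∈ ringO R) (L : ℕ) :
    ∃ C : ℕ, ∀ a : A, (a : K R) ∈ mPow R (-(L : ℤ)) → d a ∈ mPow R (-(C : ℤ)) := by
  let b : ℤ → A := fun i => ⟨P.α (e i), P.α_mem _⟩
  choose c hc using fun i => exists_nat_mem_mPow (d (b i))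
  choose c' hc' using fun i => exists_nat_mem_mPow (b i : K R)
  let S := Finset.Ico (-(L : ℤ)) 0
  have hS : ∀ (u : ℤ → ℕ), ∀ i ∈ S, (u i : ℤ) ≤ (S.sup u : ℕ) := fun u i hi => by
    exact_mod_cast Finset.le_sup (f := u) hi
  refine ⟨max (S.sup c) (S.sup c'), fun a ha => ?_⟩
  obtain ⟨r, hr⟩ := P.α_of_mem a.2
  -- Subtract the polar part of `a` and apply `α`, which kills the rest. So `A` in bounded pole
  -- order is spanned over `R` by 1 and finitely many `α(e_i)`.
  have key : a = algebraMap R A r + ∑ i ∈ S, algebraMap R A (coeff (a : K R) i) * b i := by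
    apply Subtype.ext
    have h := P.α_ringO _ (sub_sum_Ico_mem ha 0)
    rw [map_sub, hr, map_sum] at h
    simp only [map_smul] at h
    push_cast
    simp only [b, ← Algebra.smul_def]
    linear_combination h
  rw [key, map_add, map_sum]
  refine Submodule.add_mem _ (mPow_anti R (by omega) (hR r)) (Submodule.sum_mem _ fun i hi => ?_)
  rw [hd]
  refine Submodule.add_mem _ ?_ ?_
  · have := mul_mem_mPow (hR (coeff (a : K R) i)) (hc' i)
    exact mPow_anti R (by have := hS c' i hi; push_cast; omega) this
  · rw [Subalgebra.coe_algebraMap, ← Algebra.smul_def]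
    exact Submodule.smul_mem _ _ (mPow_anti R (by have := hS c i hi; push_cast; omega) (hc i))

/-- `A` contains an element with an invertible leading coefficient and a pole. -/
theorem Splitting.exists_pole (P : Splitting A) :
    ∃ (n : ℕ) (f : A) (g : K R), 1 ≤ n ∧ (f : K R) ∈ mPow R (-(n : ℤ)) ∧ g ∈ mPow R (n : ℤ) ∧
      (f : K R) * g = 1 := by
  -- The components of `t^(-n)` outside `A` have poles of order at most `P.bound`, so with one order
  -- more the leading term survives in `α(t^(-n))`.
  let n := P.bound + 1
  let f : A := ⟨P.α (e (-(n : ℤ))), P.α_mem _⟩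
  have hf : (f : K R) - e (-(n : ℤ)) ∈ mPow R (-(P.bound : ℤ)) := by
    have h := P.sum (e (-(n : ℤ)))
    rw [show (f : K R) - e (-(n : ℤ)) = -(P.β (e (-(n : ℤ))) + P.γ (e (-(n : ℤ)))) by
      linear_combination h]
    exact Submodule.neg_mem _ (Submodule.add_mem _ (mPow_anti R (by omega) (P.β_mem _)) (P.γ_mem _))
  have hf' : e (n : ℤ) * (f : K R) - 1 ∈ mPow R 1 := by
    have h := mul_mem_mPow (e_mem_mPow (R := R) (n : ℤ)) hf
    rw [mul_sub, e_mul_e, add_neg_cancel, e_zero] at h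
    exact mPow_anti R (by push_cast [n]; omega) h
  obtain ⟨g, hg, hfg⟩ := exists_mul_eq_one hf'
  refine ⟨n, f, e (n : ℤ) * g, by omega, ?_, ?_, by rw [← hfg]; ring⟩
  · rw [← sub_add_cancel (f : K R) (e (-(n : ℤ)))]
    exact Submodule.add_mem _ (mPow_anti R (by push_cast [n]; omega) hf) (e_mem_mPow _)
  · simpa using mul_mem_mPow (e_mem_mPow (R := R) (n : ℤ)) hg

theorem Splitting.sub_α_mem (P : Splitting A) (x : K R) :
    x - P.α x ∈ mPow R (-(P.bound : ℤ)) := by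
  rw [show x - P.α x = P.β x + P.γ x by linear_combination -P.sum x]
  exact Submodule.add_mem _ (mPow_anti R (by omega) (P.β_mem _)) (P.γ_mem _)

/-- A derivation of `A` over a derivation of `R` extends to a continuous derivation of `K`. -/
theorem Splitting.exists_extension (P : Splitting A) {d : A →+ K R}
    (hd : ∀ a b : A, d (a * b) = d a * b + a * d b)
    (hR : ∀ r : R, d (algebraMap R A r) ∈ ringO R) :
    ∃ φ : K R →+ K R, AddCont φ ∧ (∀ x y, φ (x * y) = φ x * y + x * φ y) ∧
      ∀ a : A, φ a = d a := by
  obtain ⟨n, f, g, hn, hf, hg, hfg⟩ := P.exists_pole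
  let a : K R →ₗ[R] A := P.α.codRestrict (Subalgebra.toSubmodule A) P.α_mem
  have ha : ∀ x, (a x : K R) = P.α x := fun _ => rfl
  have hgpow : ∀ l : ℕ, g ^ l ∈ mPow R (l : ℤ) := fun l =>
    mPow_anti R (by nlinarith) (pow_mem_mPow hg l)
  have hfgp : ∀ l : ℕ, g ^ l * (f : K R) ^ l = 1 := fun l => by
    rw [← mul_pow, mul_comm, hfg, one_pow]
  have hbound : ∀ L : ℕ, ∃ C : ℕ, ∀ (l : ℕ) (x : A), (x : K R) ∈ mPow R (-(L : ℤ)) →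
      quotRule d f g l x ∈ mPow R ((l : ℤ) - C) := by
    intro L
    obtain ⟨C, hC⟩ := P.exists_pole_bound hd hR L
    obtain ⟨C', hC'⟩ := exists_nat_mem_mPow (d f)
    refine ⟨C + C' + L, fun l x hx => ?_⟩
    rw [quotRule_apply, mul_assoc, mul_assoc, ← nsmul_eq_mul]
    refine Submodule.sub_mem _ (mPow_anti R ?_ (mul_mem_mPow (hgpow l) (hC x hx)))
      (nsmul_mem (mPow_anti R ?_ (mul_mem_mPow (hgpow (l + 1)) (mul_mem_mPow hC' hx))) _)
    · push_cast; omega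
    · push_cast; omega
  obtain ⟨C, hC⟩ := hbound (P.bound + n)
  -- The fractions `f^(-l) α(f^l k)` converge to `k`, since `α` leaves an error of bounded pole
  -- order and `f^(-l)` tends to zero; `s l k` is the quotient rule applied to them.
  let s : ℕ → K R → K R := fun l k => quotRule d f g l (a ((f : K R) ^ l * k))
  have hs : ∀ (l : ℕ) (k : K R), s (l + 1) k - s l k ∈ mPow R ((l : ℤ) - C) := by
    intro l k
    simp only [s]
    -- Over the common denominator `f^(l+1)` the numerators `α(f y)` and `f α(y)` are elements of
    -- `A` that differ by bounded poles.
    rw [← quotRule_succ hd hfg l, ← map_sub]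
    refine mPow_anti R (by push_cast; omega) (hC (l + 1) _ ?_)
    set y := (f : K R) ^ l * k
    have h₁ := P.sub_α_mem ((f : K R) * y)
    have h₂ := mul_mem_mPow hf (P.sub_α_mem y)
    rw [show (f : K R) ^ (l + 1) * k = f * y by rw [pow_succ']; ring]
    push_cast
    rw [ha, ha, show P.α (f * y) - f * P.α y = f * (y - P.α y) - (f * y - P.α (f * y)) by ring]
    exact Submodule.sub_mem _ (mPow_anti R (by omega) h₂) (mPow_anti R (by omega) h₁)
  choose φ hφ using fun k => exists_limit (fun l => s l k) C fun l => hs l k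
  have huniq : ∀ (k x : K R) (N : ℕ), (∀ l : ℕ, N ≤ l → s l k - x ∈ mPow R ((l : ℤ) - C)) →
      φ k = x := by
    intro k x N h
    refine sub_eq_zero.1 (eq_zero_of_forall_mem_mPow fun m => ?_)
    have := Submodule.add_mem _ (hφ k (N + m + C)) (h (N + m + C) (by omega))
    rw [sub_add_sub_cancel] at this
    exact mPow_anti R (by push_cast; omega) this
  have hadd : ∀ x y, φ (x + y) = φ x + φ y := fun x y => huniq _ _ 0 fun l _ => by
    have : s l (x + y) = s l x + s l y := by
      simp only [s]; rw [mul_add, map_add, map_add]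
    rw [this, show s l x + s l y - (φ x + φ y) = -((φ x - s l x) + (φ y - s l y)) by ring]
    exact Submodule.neg_mem _ (Submodule.add_mem _ (hφ x l) (hφ y l))
  have hfrac : ∀ (l : ℕ) (x : A), φ (g ^ l * x) = quotRule d f g l x := by
    intro l x
    refine huniq _ _ l fun m hm => ?_
    obtain ⟨j, rfl⟩ := Nat.exists_eq_add_of_le hm
    have hx : (f : K R) ^ (l + j) * (g ^ l * x) = ((f ^ j * x : A) : K R) := by
      push_cast
      rw [pow_add]
      linear_combination (f : K R) ^ j * x * hfgp l
    -- On a genuine fraction the approximation is exact except for the constant that `α` drops, and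
    -- the quotient rule at a constant tends to zero.
    obtain ⟨r, hr⟩ := P.α_of_mem (f ^ j * x : A).2
    have : a ((f : K R) ^ (l + j) * (g ^ l * x)) = f ^ j * x - algebraMap R A r :=
      Subtype.ext (by rw [ha, hx, hr]; rfl)
    simp only [s]
    rw [this, map_sub, quotRule_add_pow hd hfg, sub_sub_cancel_left]
    exact Submodule.neg_mem _ (hC _ _ (mPow_anti R (by omega) (algebraMap_mem_ringO r)))
  have hcont : ∀ N : ℤ, ∃ M : ℤ, ∀ k ∈ mPow R M, φ k ∈ mPow R N := by
    intro N
    let l := (N + C).toNat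
    -- At this order `f^l k` lies in `𝒪`, so the approximation at stage `l` is zero and only the
    -- rate of convergence remains.
    refine ⟨n * l, fun k hk => ?_⟩
    have h₁ := mul_mem_mPow (pow_mem_mPow hf l) hk
    have h₂ : a ((f : K R) ^ l * k) = 0 := Subtype.ext (P.α_ringO _ (mPow_anti R (by nlinarith) h₁))
    have h₃ := hφ k l
    simp only [s] at h₃
    rw [h₂, map_zero, sub_zero] at h₃
    exact mPow_anti R (by omega) h₃
  have hdense : SpansDense {k : K R | ∃ (l : ℕ) (x : A), k = g ^ l * x} := by
    intro k N
    let l := (N + P.bound).toNat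
    refine ⟨g ^ l * a ((f : K R) ^ l * k), AddSubgroup.subset_closure ⟨l, _, rfl⟩, ?_⟩
    have h := mul_mem_mPow (hgpow l) (P.sub_α_mem ((f : K R) ^ l * k))
    rw [mul_sub, ← mul_assoc, hfgp, one_mul] at h
    exact mPow_anti R (by omega) h
  refine ⟨AddMonoidHom.mk' φ hadd, hcont, fun x y => ?_, fun x => ?_⟩
  · refine AddCont.leibniz (φ := AddMonoidHom.mk' φ hadd) hcont hdense ?_ x y
    rintro _ ⟨l, x, rfl⟩ _ ⟨m, y, rfl⟩
    change φ _ = φ _ * _ + _ * φ _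
    rw [hfrac, hfrac, ← quotRule_mul hd, ← hfrac]
    congr 1
    push_cast
    ring
  · have := hfrac 0 x
    rw [pow_zero, one_mul] at this
    change φ x = _
    rw [this, quotRule_apply]
    simp

end Extension

/-! ### Derivations of the base and formal smoothness -/

section Smooth

variable {R : Type u} [CommRing R] [Algebra ℂ R]

/-- Every derivation of `R` extends to a formally smooth `R`-algebra. -/
theorem exists_derivation_of_formallySmooth {B : Type u} [CommRing B] [Algebra R B]
    [Algebra.FormallySmooth R B] (δ : Derivation ℂ R R) :
    ∃ d : B →+ B, (∀ a b, d (a * b) = d a * b + a * d b) ∧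
      ∀ r, d (algebraMap R B r) = algebraMap R B (δ r) := by
  let re : TwistedDual δ B →ₐ[R] B :=
    { toFun := TwistedDual.re
      map_one' := rfl
      map_mul' := fun _ _ => rfl
      map_zero' := rfl
      map_add' := fun _ _ => rfl
      commutes' := fun _ => rfl }
  have hre : ∀ z, re z = z.re := fun _ => rfl
  have hs : Function.Surjective re := fun b => ⟨TwistedDual.mk δ b 0, rfl⟩
  have hn : IsNilpotent (RingHom.ker (re : TwistedDual δ B →+* B)) := by
    refine ⟨2, ?_⟩
    rw [pow_two, Submodule.zero_eq_bot, eq_bot_iff, Ideal.mul_le]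
    intro x hx y hy
    have hx' : x.re = 0 := hx
    have hy' : y.re = 0 := hy
    exact TwistedDual.ext (by simp [hx']) (by simp [hx', hy'])
  -- The ideal of multiples of `ε` has square zero, so the identity of `B` lifts; the `ε`-part of
  -- the lift is the required derivation.
  let φ : B →ₐ[R] TwistedDual δ B :=
    Algebra.FormallySmooth.liftOfSurjective (AlgHom.id R B) re hs hn
  have hφ : ∀ b, (φ b).re = b := fun b =>
    Algebra.FormallySmooth.liftOfSurjective_apply (AlgHom.id R B) re hs hn b
  refine ⟨AddMonoidHom.mk' (fun b => (φ b).im) fun a b => by rw [map_add, TwistedDual.im_add],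
    fun a b => ?_, fun r => ?_⟩
  · simp only [AddMonoidHom.mk'_apply]
    rw [map_mul, TwistedDual.im_mul, hφ, hφ, add_comm]
  · simp only [AddMonoidHom.mk'_apply]
    rw [AlgHom.commutes, TwistedDual.im_algebraMap]

/-- If `A` is formally smooth over `R`, every derivation of `R` is liftable. -/
theorem IsFockType.liftable_eq_top {A : Subalgebra R (K R)} (hA : IsFockType A)
    [Algebra.FormallySmooth R A] : liftable A = ⊤ := by
  refine eq_top_iff.2 fun δ _ => ?_
  obtain ⟨P⟩ := hA.exists_splitting
  obtain ⟨d, hd, hR⟩ := exists_derivation_of_formallySmooth (B := A) δ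
  obtain ⟨φ, hc, hmul, hφ⟩ := P.exists_extension
    (d := A.val.toRingHom.toAddMonoidHom.comp d)
    (fun a b => congrArg Subtype.val (hd a b))
    (fun r => by
      change ((d (algebraMap R A r) : A) : K R) ∈ _
      rw [hR]
      exact algebraMap_mem_ringO _)
  have hφR : ∀ r : R, φ (algebraMap R (K R) r) = algebraMap R (K R) (δ r) := fun r =>
    (hφ (algebraMap R A r)).trans (congrArg Subtype.val (hR r))
  refine ⟨Derivation.mk'
    { toFun := φ
      map_add' := map_add φ
      -- The extension is `ℂ`-linear because on constants it is `δ`, which kills the image of `ℂ`.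
      map_smul' := fun z f => by
        rw [RingHom.id_apply, complex_smul_eq, complex_smul_eq, Algebra.smul_def, Algebra.smul_def,
          hmul, hφR, Derivation.map_algebraMap, map_zero, zero_mul, zero_add] }
    (fun f g => by
      change φ (f * g) = f * φ g + g * φ f
      rw [hmul]; ring), ⟨⟨hc, fun r => ⟨δ r, hφR r⟩⟩, fun a ha => ?_⟩, hφR⟩
  have : φ a = d ⟨a, ha⟩ := hφ ⟨a, ha⟩
  change φ a ∈ A
  rw [this]
  exact (d ⟨a, ha⟩).2

end Smooth

end WZW

end

/-! ### The proposition -/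

theorem mainTheorem4 {R : Type u} [CommRing R] [Algebra ℂ R] (A : Subalgebra R (WZW.K R))
    (hA : WZW.IsFockType A) :
    -- the lifts form an extension of `θ_{K,A,R}` by the scalars `R`
    (∀ D ∈ WZW.thetaKAR A, ∃ x ∈ WZW.hatThetaKAR A, x.1 = D) ∧
    (∀ x : WZW.Pairs R, (x ∈ WZW.hatThetaKAR A ∧ x.1 = 0) ↔ ∃ r : R, x = (0, WZW.scalarOp r)) ∧
    -- every lift satisfies `[D̂, f] = D f` on the Fock space, and its commutator action on `Ū K̂`
    -- preserves `A ∘ Ū K̂`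
    (∀ x ∈ WZW.hatThetaKAR A,
      (∀ (f : WZW.K R) (v : WZW.FockSpace R), x.2 ((WZW.inU f : WZW.UHeis R) • v) =
        (WZW.inU (x.1 f) : WZW.UHeis R) • v + (WZW.inU f : WZW.UHeis R) • x.2 v) ∧
      ∃ δ₀ : Derivation ℂ R R, WZW.Restricts x.1 δ₀ ∧
        ∃ δ : WZW.Ubar R →+ WZW.Ubar R, WZW.IsCommutatorAction x.1 δ₀ δ ∧
          (∀ δ' : WZW.Ubar R →+ WZW.Ubar R, WZW.IsCommutatorAction x.1 δ₀ δ' → δ' = δ) ∧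
          ∀ y ∈ WZW.AUbar A, δ y ∈ WZW.AUbar A) ∧
    -- every lift preserves `A ∘ 𝔽(K, 𝒪)`
    (∀ x ∈ WZW.hatThetaKAR A, ∀ v ∈ WZW.AFock A, x.2 v ∈ WZW.AFock A) ∧
    -- the induced action on the coinvariants factors through a central extension by `R` of the
    -- Lie algebra of liftable derivations of `R`
    (∃ (E : Type u) (_ : LieRing E) (_ : LieAlgebra ℂ E) (_ : Module R E)
        (_ : IsScalarTower ℂ R E) (X : WZW.CentralExtension (WZW.liftable A) E)
        (ρ : E →ₗ⁅ℂ⁆ Module.End ℂ (WZW.Coinv A)) (q : WZW.hatThetaKAR A →ₗ⁅ℂ⁆ E),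
      X.IsAction ρ ∧
      Function.Surjective q ∧
      (∀ (r : R) (x y : WZW.hatThetaKAR A), y.1.1 = r • x.1.1 → (∀ v, y.1.2 v = r • x.1.2 v) →
        q y = r • q x) ∧
      (∀ x : WZW.hatThetaKAR A, WZW.Restricts x.1.1 (X.proj (q x))) ∧
      (∀ r : R, ∃ h : ((0, WZW.scalarOp r) : WZW.Pairs R) ∈ WZW.hatThetaKAR A,
        q ⟨(0, WZW.scalarOp r), h⟩ = X.incl r) ∧
      (∀ (x : WZW.hatThetaKAR A) (v : WZW.FockSpace R),
        ρ (q x) (Submodule.Quotient.mk v) = Submodule.Quotient.mk (x.1.2 v))) ∧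
    -- if `A` is smooth over `R`, every derivation of `R` is liftable
    (Algebra.FormallySmooth R A → WZW.liftable A = ⊤) := by
  refine ⟨fun D hD => ?_, fun x => ⟨fun ⟨hx, h0⟩ => ?_, ?_⟩, fun x hx => ?_, fun x hx v hv => ?_,
    WZW.exists_coinvariant_extension hA, fun _ => hA.liftable_eq_top⟩
  · obtain ⟨T, hT⟩ := WZW.exists_isLift hD.1
    exact ⟨(D, T), WZW.mem_hatThetaKAR.2 ⟨hT, hD⟩, rfl⟩
  · exact (WZW.mem_hatThetaKAR.1 hx).1.exists_scalarOp h0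
  · rintro ⟨r, rfl⟩
    exact ⟨WZW.scalarOp_mem r, rfl⟩
  · obtain ⟨hL, hD⟩ := WZW.mem_hatThetaKAR.1 hx
    obtain ⟨δ₀, hδ₀⟩ := WZW.exists_restricts hD.1
    have hδ := WZW.derUbar_isCommutatorAction hD.1 hδ₀
    exact ⟨hL.map_act, δ₀, hδ₀, WZW.derUbar hD.1 hδ₀, hδ, fun _ h => h.eq_derUbar hD.1 hδ₀,
      fun _ hy => hδ.map_AUbar hD.2 hy⟩
  · obtain ⟨hL, hD⟩ := WZW.mem_hatThetaKAR.1 hx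
    exact hL.map_AFock hD.2 hv
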